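/- Let $N\ge 1$, let $\pi=(\pi_1,\dots,\pi_N)$ be strictly positive and let $\hat\pi=(\hat\pi_n)_{n\ge1}$ be a nonnegative sequence. Let $\{W_{ij}:1\le i\le N,\ j\ge1\}$ be independent random variables under a probability measure $P^{\pi,\hat\pi}$, with $W_{ij}$ exponentially distributed with parameter $\pi_i+\hat\pi_j$. **Notation.** Let $W^N=\{x\in\mathbb R^N:x_1\ge\dots\ge x_N\}$ and $\Delta(z)=\prod_{i<j}(z_i-z_j)$. Let $h_\pi(z)=\det\{e^{-\pi_iz_j}\}/(\Delta(\pi)\Delta(z))$, extended by continuity to all $(\pi,z)\in(0,\infty)^N\times W^N$. For $z\in W^N$ let $Q(z,\cdot)$ be the law of the decreasingly ordered eigenvalues of $\mathrm{diag}(z)+(g_i\bar g_j)_{i,j\le N}$, where $g_1,\dots,g_N$ are independent standard complex Gaussian variables ($\mathbb E|g_i|^2=1$). For $n\ge1$ let $$Q^{\pi,\hat\pi}_{n-1,n}(z,dz')=\prod_{i=1}^N(\pi_i+\hat\pi_n)\,\frac{h_\pi(z')}{h_\pi(z)}\,e^{-(\hat\pi_n-1)\sum_{i=1}^N(z_i'-z_i)}\,Q(z,dz').$$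 A Gelfand–Tsetlin (GT) pattern with $N$ levels is an array $(x_i^k)_{1\le i\le k\le N}$ with $x^k_{i+1}\le x^{k-1}_i\le x^k_i$ for $1\le i<k\le N$; its bottom row is $x^N$. For an array $\xi=(\xi_{ij})_{1\le i\le N,\,j\ge1}$ of nonnegative integers, the Robinson–Schensted–Knuth (RSK) algorithm starts with the empty tableau and, for $j=1,2,\dots$, row inserts successively the word $1^{\xi_{1j}}2^{\xi_{2j}}\cdots N^{\xi_{Nj}}$; the GT pattern at time $n$ has as its entry $x_i^k(n)$ the number of letters $\le k$ in row $i$ of the tableau obtained from $j=1,\dots,n$, and $\mathbf x(0)=0$. These rules can be written with additions, subtractions and maxima only, and in this form they define RSK for arrays of nonnegative reals. **Lemma.** Let $\{\mathbf Z(n):n\ge0\}$ be the sequence of GT patterns obtained by applying RSK to $\{W_{ij}\}$, and let $Z^N(n)$ be the bottom row of $\mathbf Z(n)$. Then: 1. Almost surely, every $\mathbf Z(n)$ is a GT pattern. Under $P^{\pi,\hat\pi}$ the process $\{Z^N(n):n\ge0\}$ is an inhomogeneous Markov chain on $W^N$, and its one-step transition kernels are the Markov kernels $Q^{\pi,\hat\pi}_{n-1,n}$,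 $n\ge1$. 2. Almost surely, for all $n\ge1$, $Z_1^N(n)=Y(N,n)=\max_{p}\sum_{(i,j)\in p}W_{ij}$, where the maximum is over the up-right lattice paths $p$ from $(1,1)$ to $(N,n)$. 3. For real $L>0$ let $\{\xi_{ij}\}$ (depending on $L$) be independent $\mathbb Z_+$-valued random variables such that, whenever $\pi_i<L$ and $\hat\pi_j<L$, $\xi_{ij}$ is geometric with $P(\xi_{ij}=m)=(1-a_ib_j)(a_ib_j)^m$, $m\ge 0$, where $a_i=1-\pi_i/L$ and $b_j=1-\hat\pi_j/L$. Let $\mathbf X_L(n)$, $n\ge 0$, be the GT patterns obtained from $\xi$ by RSK. (a) If $\pi_i<L$ for all $i$ and $\hat\pi_j<L$ for all $j\le n$, then the conditional probability of $X_L^N(n)=x'$ given $X_L^N(0),\dots,X_L^N(n-1)$ is almost surely $P_{n-1,n}(X_L^N(n-1),x')$, where $$P_{n-1,n}(x,x')=\prod_{i=1}^N(1-a_ib_n)\,\frac{s_{x'}(a)}{s_x(a)}\,b_n^{\sum_i(x_i'-x_i)}\,1_{\{0\le x\prec x'\}}.$$ Here $x\prec x'$ means $x'_1\ge x_1\ge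 x_2'\ge x_2\ge\dots\ge x_N'\ge x_N$, and $s_\lambda(a)$ is the Schur polynomial, that is, the sum over integer GT patterns $\mathbf x$ with bottom row $\lambda$ of $\prod_{k=1}^Na_k^{\sum_ix_i^k-\sum_ix_i^{k-1}}$ (the sum over level $0$ being $0$). (b) As $L\to\infty$, the process $\{\mathbf X_L(n)/L:n\ge0\}$ converges in distribution (for the product topology over $n$) to $\{\mathbf Z(n):n\ge0\}$. -/

import Mathlib

open MeasureTheory ProbabilityTheory Filter Topology
open scoped NNReal ENNReal

/-! ### Triangular arrays and Gelfand-Tsetlin patterns -/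

/-- Triangular arrays with `N` levels.  Level `k : Fin N` (the level `k + 1` in one-based
numbering) has the `k + 1` entries `x k 0, …, x k k`. -/
abbrev Triangle (N : ℕ) (R : Type*) := (k : Fin N) → Fin (k.1 + 1) → R

/-- The interlacing inequalities of a Gelfand-Tsetlin pattern. -/
def IsGTPattern {N : ℕ} {R : Type*} [LE R] (x : Triangle N R) : Prop :=
  ∀ (k : ℕ) (hk : k + 1 < N) (i : ℕ) (hi : i < k + 1),
    x ⟨k + 1, hk⟩ ⟨i + 1, by simpa using hi⟩ ≤ x ⟨k, by omega⟩ ⟨i, hi⟩ ∧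
      x ⟨k, by omega⟩ ⟨i, hi⟩ ≤ x ⟨k + 1, hk⟩ ⟨i, Nat.lt_succ_of_lt hi⟩

/-- The last (bottom) level of a triangular array with `N` levels. -/
def bottomRow {N : ℕ} {R : Type*} (x : Triangle N R) : Fin N → R :=
  fun i => x ⟨N - 1, Nat.sub_one_lt_of_lt i.2⟩ ⟨i.1, Nat.lt_add_one_of_le (Nat.le_sub_one_of_lt i.2)⟩

/-- The chamber `x₁ ≥ … ≥ x_N`. -/
def chamber (N : ℕ) : Set (Fin N → ℝ) := {x | Antitone x}

/-! ### The Robinson-Schensted-Knuth algorithm with row insertion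

A row of a tableau is encoded by `y`, where `y k` is the number of its entries among the letters
`0, …, k`, and a weakly increasing word by `ξ`, where `ξ k` is the number of its letters `k`.
Written this way the algorithm only uses addition, subtraction and maxima, and so it makes sense
for real inputs as well; there it is the continuous extension. -/

section RSK

variable {R : Type*} [AddCommGroup R] [LinearOrder R]

/-- The row `y` after row insertion of the weakly increasing word `ξ`. -/
def rowInsert (y ξ : ℕ → R) : ℕ → R
  | 0 => y 0 + ξ 0
  | k + 1 => max (y (k + 1)) (rowInsert y ξ k) + ξ (k + 1)

/-- The (again weakly increasing) word bumped out of the row `y` when the word `ξ` is inserted: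
the letters `k` inserted, plus those in the old row, minus those in the new row. -/
def bumped (y ξ : ℕ → R) : ℕ → R
  | 0 => ξ 0 + y 0 - rowInsert y ξ 0
  | k + 1 => ξ (k + 1) + (y (k + 1) - y k) - (rowInsert y ξ (k + 1) - rowInsert y ξ k)

/-- The word that reaches row `i` of the tableau `x` when the word `ξ` is inserted in the top
row `0`. -/
def wordAtRow (x : ℕ → ℕ → R) (ξ : ℕ → R) : ℕ → ℕ → R
  | 0 => ξ
  | i + 1 => bumped (x i) (wordAtRow x ξ i)

/-- Row insertion of the word `ξ` in the tableau `x`, where `x i k` is the number of letters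
`0, …, k` in row `i`. -/
def rskInsert (x : ℕ → ℕ → R) (ξ : ℕ → R) : ℕ → ℕ → R :=
  fun i => rowInsert (x i) (wordAtRow x ξ i)

/-- The tableau obtained from the empty one by inserting successively the columns
`0, …, n - 1` of the array `ξ`. -/
def rskTableau (ξ : ℕ → ℕ → R) : ℕ → ℕ → ℕ → R
  | 0 => fun _ _ => 0
  | n + 1 => rskInsert (rskTableau ξ n) (fun k => ξ k n)

/-- Extension by zero of an array with `N` rows. -/
def extendRows {N : ℕ} (ξ : Fin N → ℕ → R) : ℕ → ℕ → R :=
  fun i j => if h : i < N then ξ ⟨i, h⟩ j else 0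

/-- The Gelfand-Tsetlin pattern that RSK produces from the first `n` columns of an array with `N`
rows: entry `i` of level `k` is the number of letters `0, …, k` in row `i` of the tableau. -/
def rskPattern {N : ℕ} (ξ : Fin N → ℕ → R) (n : ℕ) : Triangle N R :=
  fun k i => rskTableau (extendRows ξ) n i.1 k.1

end RSK

/-! ### Last-passage times -/

/-- `IsUpRightPath P v`: the list `P` of lattice points, read from its end to its start, is an
up-right path from `(0, 0)` to `v`. -/
inductive IsUpRightPath : List (ℕ × ℕ) → ℕ × ℕ → Prop
  | origin : IsUpRightPath [(0, 0)] (0, 0)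
  | stepFst {P : List (ℕ × ℕ)} {i j : ℕ} (h : IsUpRightPath P (i, j)) :
      IsUpRightPath ((i + 1, j) :: P) (i + 1, j)
  | stepSnd {P : List (ℕ × ℕ)} {i j : ℕ} (h : IsUpRightPath P (i, j)) :
      IsUpRightPath ((i, j + 1) :: P) (i, j + 1)

/-- The weights of the up-right paths from `(0, 0)` to `v`. -/
def pathWeights (w : ℕ → ℕ → ℝ) (v : ℕ × ℕ) : Set ℝ :=
  {s | ∃ P, IsUpRightPath P v ∧ s = (P.map fun p => w p.1 p.2).sum}

/-! ### The transition kernels -/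

section Kernels

noncomputable section

variable {N : ℕ}

/-- The standard complex Gaussian law: independent real and imaginary parts, each centered with
variance `1 / 2`. -/
def stdComplexGaussian : Measure ℂ :=
  ((gaussianReal 0 (1 / 2)).prod (gaussianReal 0 (1 / 2))).map fun p => ⟨p.1, p.2⟩

/-- The vector of eigenvalues of a Hermitian matrix in decreasing order. -/
def sp {M : Matrix (Fin N) (Fin N) ℂ} (hM : M.IsHermitian) : Fin N → ℝ :=
  fun i => hM.eigenvalues₀ (Fin.cast (Fintype.card_fin N).symm i)

/-- The matrix `diag(z) + (gᵢ \bar g_j)`. -/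
def rankOnePerturb (z : Fin N → ℝ) (g : Fin N → ℂ) : Matrix (Fin N) (Fin N) ℂ :=
  Matrix.diagonal (fun i => (z i : ℂ)) + Matrix.vecMulVec g (star g)

theorem rankOnePerturb_isHermitian (z : Fin N → ℝ) (g : Fin N → ℂ) :
    (rankOnePerturb z g).IsHermitian := by
  ext i j
  by_cases h : i = j
  · subst h
    simp [rankOnePerturb, Matrix.vecMulVec_apply, mul_comm]
  · simp [rankOnePerturb, Matrix.vecMulVec_apply, mul_comm, Matrix.diagonal_apply_ne _ h,
      Matrix.diagonal_apply_ne _ (Ne.symm h)]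

/-- The kernel `Q(z, ·)`: the law of the eigenvalues of `diag(z) + (gᵢ \bar g_j)`, where `g` is a
vector of independent standard complex Gaussian variables. -/
def baseQ (z : Fin N → ℝ) : Measure (Fin N → ℝ) :=
  (Measure.pi fun _ : Fin N => stdComplexGaussian).map
    fun g => sp (rankOnePerturb_isHermitian z g)

/-- The Vandermonde product `Δ(z) = ∏_{i < j} (zᵢ - z_j)`. -/
def vandermondeProd (z : Fin N → ℝ) : ℝ :=
  ∏ i : Fin N, ∏ j ∈ Finset.Ioi i, (z i - z j)

/-- The function `h_π(z) = det(e^{-πᵢ z_j}) / (Δ(π) Δ(z))`, extended by continuity from the pairs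
`(π, z)` at which the denominator does not vanish. -/
def hFun (π z : Fin N → ℝ) : ℝ :=
  extendFrom {p : (Fin N → ℝ) × (Fin N → ℝ) | Function.Injective p.1 ∧ Function.Injective p.2}
    (fun p => (Matrix.of fun i j => Real.exp (-(p.1 i * p.2 j))).det /
      (vandermondeProd p.1 * vandermondeProd p.2)) (π, z)

/-- The transition kernel `Q^{π, \hat π}_{n-1, n}`, where `c` stands for `\hat π_n`. -/
def transitionQ (π : Fin N → ℝ) (c : ℝ) (z : Fin N → ℝ) : Measure (Fin N → ℝ) :=
  (baseQ z).withDensity fun z' => ENNReal.ofReal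
    ((∏ i, (π i + c)) * (hFun π z' / hFun π z) * Real.exp (-((c - 1) * ∑ i, (z' i - z i))))

end

end Kernels

/-! ### Markov chains -/

section Markov

variable {Ω E : Type*} [MeasurableSpace Ω] [MeasurableSpace E]

/-- The σ-algebra generated by `X 0, …, X n`. -/
abbrev pastSigma (X : ℕ → Ω → E) (n : ℕ) : MeasurableSpace Ω :=
  ⨆ k ≤ n, MeasurableSpace.comap (X k) inferInstance

/-- `X` is a (time-inhomogeneous) Markov chain on the state space `S` with one-step transition
kernels `κ n` from time `n` to time `n + 1`: each `κ n` is a Markov kernel on `S`, the chain stays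
in `S` almost surely, and `κ n (X n)` is the conditional law of `X (n + 1)` given
`X 0, …, X n`. -/
structure IsMarkovChainOn (S : Set E) (P : Measure Ω) (X : ℕ → Ω → E)
    (κ : ℕ → E → Measure E) : Prop where
  isProbability : ∀ n, ∀ z ∈ S, IsProbabilityMeasure (κ n z)
  supported : ∀ n, ∀ z ∈ S, κ n z Sᶜ = 0
  measurable_kernel : ∀ n, ∀ B : Set E, MeasurableSet B → Measurable fun z : S => κ n z B
  measurable_chain : ∀ n, Measurable (X n)
  mem : ∀ᵐ ω ∂P, ∀ n, X n ω ∈ S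
  markov : ∀ n, ∀ B : Set E, MeasurableSet B →
    P⟦X (n + 1) ⁻¹' B | pastSigma X n⟧ =ᵐ[P] fun ω => (κ n (X n ω)).real B

end Markov

/-! ### Schur polynomials and the discrete transition probabilities -/

section Schur

noncomputable section

variable {N : ℕ}

/-- The sum of the entries of level `k`, in one-based numbering; it is zero for `k = 0`. -/
def levelSum (x : Triangle N ℤ) : ℕ → ℤ
  | 0 => 0
  | k + 1 => if h : k < N then ∑ i, x ⟨k, h⟩ i else 0

/-- The weight `a^x` of a pattern. -/
def patternWeight (a : Fin N → ℝ) (x : Triangle N ℤ) : ℝ :=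
  ∏ k : Fin N, a k ^ (levelSum x (k.1 + 1) - levelSum x k.1)

/-- The Schur polynomial `s_μ(a)`: the sum of the weights of the (finitely many) integer patterns
with bottom row `μ`. -/
def schur (a : Fin N → ℝ) (μ : Fin N → ℤ) : ℝ :=
  ∑ᶠ x : {x : Triangle N ℤ // IsGTPattern x ∧ bottomRow x = μ}, patternWeight a x.1

/-- `0 ≤ x ≺ x'`: all coordinates are nonnegative, `x` and `x'` are decreasing, and
`x'₁ ≥ x₁ ≥ x'₂ ≥ x₂ ≥ … ≥ x'_N ≥ x_N`. -/
def NonnegInterlace (x x' : Fin N → ℤ) : Prop :=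
  (∀ i, 0 ≤ x i) ∧ (∀ i, x i ≤ x' i) ∧ ∀ i j : Fin N, i < j → x' j ≤ x i

open Classical in
/-- The transition probabilities
`∏ (1 - aᵢ b) · s_{x'}(a) / s_x(a) · b^{∑ (x'ᵢ - xᵢ)} · 1_{0 ≤ x ≺ x'}`. -/
def schurTransition (a : Fin N → ℝ) (b : ℝ) (x x' : Fin N → ℤ) : ℝ :=
  if NonnegInterlace x x' then
    (∏ i, (1 - a i * b)) * (schur a x' / schur a x) * b ^ (∑ i, (x' i - x i))
  else 0

end

end Schur

set_option linter.unusedSectionVars false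

/-! ### The local form of row insertion on triangular arrays -/

section Combinatorics

variable {R : Type*} {N : ℕ}

/-! In Gelfand-Tsetlin coordinates row insertion is local. A new level `l'` is a function of the old
level `a` above it, the new level `a'` above it, the old level `l` and the weight `t` of the
inserted letter. For fixed `l` and `a'` the map from `(a, t)` to `l'` translates the first
coordinate and reflects each of the others in an interval determined by `l` and `a'`. So it
preserves Lebesgue or counting measure, it matches the interlacing constraints on `(a, t)` exactly
with those on `l'` (`localUpdate_interlaces_iff`), and it conserves sums (`sum_localUpdate`).

Let the entries of the new column have densities `C k * E k t * B t` on `0 ≤ t`, with `E k` and `B`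
multiplicative. Exponential and geometric laws are both of this form. Weight a pattern by the
product of `E k` at the differences of successive level sums. Induction over the levels,
substituting `l'` for `(a, t)` at each one, gives the intertwining relation `gtInt_patternInsert`:
inserting a random column into a random pattern with given bottom row is the same as moving the
bottom row by a kernel and then choosing a random pattern above it. Hence, given the history of the
bottom row, the pattern is always distributed as the random pattern with the current bottom row, and
the bottom row is Markov (`gtInt_lintegral_patternProcess`, `gtInt_markov`). All this is done once,
over an ordered group `R` with measure `μ`.

For `R = ℤ` the total mass of the patterns is a Schur polynomial, and the zero pattern is the only
one with bottom row zero, so the discrete Markov property follows at once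
(`condExp_bottomRow_rskPattern`).

For `R = ℝ` the total mass is a Vandermonde product times the continuous extension of `h_π`
(`gtInt_one_eq_gtDet`, `hFun_eq_hDet`). The eigenvalues of a rank one perturbation depend on the
Gaussian vector only through its squared absolute values. These are independent exponential
variables, recovered from the spectrum as residues of a rational function with Jacobian `Δ(v) /
Δ(z)` up to sign (`lintegral_sp`). At strictly decreasing `z` this turns `transitionQ` into the
kernel of the intertwining (`lintegral_transitionQ_of_strictAnti`). At the actual starting point
zero the mass vanishes once `N ≥ 2`. The chain is therefore started from a strictly decreasing row
that tends to zero, and the limit is taken by continuity of insertion and the Feller property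
(`tendsto_lintegral_transitionQ`, `lintegral_bottomHistory_mul`).

The first row of the tableau obeys the last-passage recursion, which gives the path formula
(`isGreatest_pathWeights`). For the scaling limit, the integer part of a suitable multiple of an
exponential variable is exactly geometric. All values of `L` are coupled in this way to one
exponential array, and since RSK is continuous and commutes with scaling, almost sure convergence of
the inputs gives convergence of the patterns (`tendstoInDistribution_rskPattern`). -/

/-- The first `N` levels of an array with `N + 1` levels. -/
def triInit (x : Triangle (N + 1) R) : Triangle N R := fun k => x k.castSucc

/-- Adds a last level to an array with `N` levels. -/
def triSnoc (x : Triangle N R) (l : Fin (N + 1) → R) : Triangle (N + 1) R :=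
  Fin.snoc (α := fun k : Fin (N + 1) => Fin (k.1 + 1) → R) x l

@[simp] theorem triInit_triSnoc (x : Triangle N R) (l : Fin (N + 1) → R) :
    triInit (triSnoc x l) = x := by
  funext k
  simp [triInit, triSnoc]

@[simp] theorem triSnoc_last (x : Triangle N R) (l : Fin (N + 1) → R) :
    triSnoc x l (Fin.last N) = l := by
  simp [triSnoc]

@[simp] theorem triSnoc_castSucc (x : Triangle N R) (l : Fin (N + 1) → R) (k : Fin N) :
    triSnoc x l k.castSucc = x k := by
  simp [triSnoc]

theorem triSnoc_triInit (x : Triangle (N + 1) R) : triSnoc (triInit x) (x (Fin.last N)) = x := by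
  funext k
  induction k using Fin.lastCases with
  | last => simp
  | cast k => simp [triInit]

theorem bottomRow_eq_last (x : Triangle (N + 1) R) : bottomRow x = x (Fin.last N) := rfl

@[simp] theorem bottomRow_triSnoc (x : Triangle N R) (l : Fin (N + 1) → R) :
    bottomRow (triSnoc x l) = l := by
  rw [bottomRow_eq_last, triSnoc_last]

/-- The level `a` interlaces with the next level `l`. -/
def Interlaces [LE R] (a : Fin N → R) (l : Fin (N + 1) → R) : Prop :=
  ∀ i : Fin N, l i.succ ≤ a i ∧ a i ≤ l i.castSucc

theorem isGTPattern_succ_iff [LE R] (x : Triangle (N + 1) R) :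
    IsGTPattern x ↔ IsGTPattern (triInit x) ∧ Interlaces (bottomRow (triInit x)) (bottomRow x) := by
  constructor
  · intro h
    refine ⟨fun k hk i hi => h k (by omega) i hi, fun i => ?_⟩
    cases N with
    | zero => exact i.elim0
    | succ M => exact h M (by omega) i.1 i.2
  · rintro ⟨h1, h2⟩ k hk i hi
    rcases Nat.lt_or_ge (k + 1) N with hk' | hk'
    · exact h1 k hk' i hi
    · obtain rfl : N = k + 1 := by omega
      exact h2 ⟨i, hi⟩

theorem isGTPattern_triSnoc_iff [LE R] (x : Triangle N R) (l : Fin (N + 1) → R) :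
    IsGTPattern (triSnoc x l) ↔ IsGTPattern x ∧ Interlaces (bottomRow x) l := by
  rw [isGTPattern_succ_iff, triInit_triSnoc, bottomRow_triSnoc]

/-- `l'` differs from `l` by a horizontal strip: `l'₁ ≥ l₁ ≥ l'₂ ≥ l₂ ≥ …`. -/
def HStrip [LE R] (l l' : Fin N → R) : Prop :=
  (∀ i, l i ≤ l' i) ∧ ∀ i j : Fin N, i.1 + 1 = j.1 → l' j ≤ l i

section Order

variable [AddCommGroup R] [LinearOrder R]

/-- The left end point of the interval in which the entry `i` of a new level can lie, where `l` is
the old level and `a'` the new level before it. -/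
def lowerEnd (l : Fin (N + 1) → R) (a' : Fin N → R) (i : Fin (N + 1)) : R :=
  if h : i.1 < N then max (l i) (a' ⟨i.1, h⟩) else l i

/-- The new level, as a function of the old level `a` and the new level `a'` before it, of the old
level `l`, and of the number `t` of inserted letters. -/
def localUpdate (a : Fin N → R) (l : Fin (N + 1) → R) (a' : Fin N → R) (t : R) : Fin (N + 1) → R :=
  Fin.cons (lowerEnd l a' 0 + t)
    (fun j => lowerEnd l a' j.succ + min (l j.castSucc) (a' j) - a j)

/-- Row insertion, computed level by level. -/
def patternInsert : {N : ℕ} → Triangle N R → (Fin N → R) → Triangle N R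
  | 0, x, _ => x
  | _ + 1, x, ξ =>
    triSnoc (patternInsert (triInit x) (Fin.init ξ))
      (localUpdate (bottomRow (triInit x)) (bottomRow x)
        (bottomRow (patternInsert (triInit x) (Fin.init ξ))) (ξ (Fin.last _)))

theorem patternInsert_triSnoc (x : Triangle N R) (l : Fin (N + 1) → R) (ξ : Fin (N + 1) → R) :
    patternInsert (triSnoc x l) ξ = triSnoc (patternInsert x (Fin.init ξ))
      (localUpdate (bottomRow x) l (bottomRow (patternInsert x (Fin.init ξ))) (ξ (Fin.last _))) := by
  rw [patternInsert, triInit_triSnoc, bottomRow_triSnoc]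

/-- For given `l` and `a'` the constraints on `l'` decouple: each entry has its own interval, and
only entry `0` is unbounded above. -/
theorem hStrip_and_interlaces_iff (l l' : Fin (N + 1) → R) (a' : Fin N → R) :
    HStrip l l' ∧ Interlaces a' l' ↔
      (∀ i, lowerEnd l a' i ≤ l' i) ∧ ∀ j : Fin N, l' j.succ ≤ min (l j.castSucc) (a' j) := by
  constructor
  · rintro ⟨⟨h1, h2⟩, h3⟩
    refine ⟨fun i => ?_, fun j => le_min (h2 _ _ (by simp)) (h3 j).1⟩
    unfold lowerEnd
    split_ifs with h
    · exact max_le (h1 i) (h3 ⟨i.1, h⟩).2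
    · exact h1 i
  · rintro ⟨h1, h2⟩
    refine ⟨⟨fun i => ?_, fun i j hij => ?_⟩, fun i => ⟨(h2 i).trans (min_le_right _ _), ?_⟩⟩
    · refine le_trans ?_ (h1 i)
      unfold lowerEnd
      split_ifs
      · exact le_max_left _ _
      · exact le_rfl
    · have hi : i.1 < N := by omega
      have := (h2 ⟨i.1, hi⟩).trans (min_le_left _ _)
      rwa [show (⟨i.1, hi⟩ : Fin N).succ = j from Fin.ext hij] at this
    · refine le_trans ?_ (h1 i.castSucc)
      unfold lowerEnd
      rw [dif_pos (by simp)]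
      exact le_max_right _ _

/-- The entry `a j` ranges over the same interval as the entry `j.succ` of the new level in
`hStrip_and_interlaces_iff`. This coincidence is what makes the local update a bijection. -/
theorem interlaces_and_hStrip_iff (a a' : Fin N → R) (l : Fin (N + 1) → R) :
    Interlaces a l ∧ HStrip a a' ↔
      ∀ j : Fin N, lowerEnd l a' j.succ ≤ a j ∧ a j ≤ min (l j.castSucc) (a' j) := by
  constructor
  · rintro ⟨h1, h2, h3⟩ j
    refine ⟨?_, le_min (h1 j).2 (h2 j)⟩
    unfold lowerEnd
    split_ifs with h
    · exact max_le (h1 j).1 (h3 _ _ (by simp))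
    · exact (h1 j).1
  · intro h
    refine ⟨fun i => ⟨le_trans ?_ (h i).1, (h i).2.trans (min_le_left _ _)⟩,
      fun i => (h i).2.trans (min_le_right _ _), fun i j hij => le_trans ?_ (h i).1⟩
    · unfold lowerEnd
      split_ifs
      · exact le_max_left _ _
      · exact le_rfl
    · unfold lowerEnd
      rw [dif_pos (by simp only [Fin.val_succ]; omega)]
      refine le_trans (le_of_eq ?_) (le_max_right _ _)
      congr 1
      exact Fin.ext hij.symm

variable [IsOrderedAddMonoid R]

/-- Each entry `j.succ` of the update is the reflection of `a j` in its interval, which exchanges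
the two end points. Entry `0` is above its lower end exactly when `0 ≤ t`. -/
theorem localUpdate_interlaces_iff (a a' : Fin N → R) (l : Fin (N + 1) → R) (t : R) :
    HStrip l (localUpdate a l a' t) ∧ Interlaces a' (localUpdate a l a' t) ↔
      0 ≤ t ∧ Interlaces a l ∧ HStrip a a' := by
  rw [hStrip_and_interlaces_iff, interlaces_and_hStrip_iff, Fin.forall_fin_succ]
  simp only [localUpdate, Fin.cons_zero, Fin.cons_succ, le_add_iff_nonneg_right]
  have e1 : ∀ j : Fin N, lowerEnd l a' j.succ ≤
      lowerEnd l a' j.succ + min (l j.castSucc) (a' j) - a j ↔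
      a j ≤ min (l j.castSucc) (a' j) := fun j => by
    rw [add_sub_assoc, le_add_iff_nonneg_right, sub_nonneg]
  have e2 : ∀ j : Fin N, lowerEnd l a' j.succ + min (l j.castSucc) (a' j) - a j ≤
      min (l j.castSucc) (a' j) ↔ lowerEnd l a' j.succ ≤ a j := fun j => by
    rw [sub_le_iff_le_add, add_comm, add_le_add_iff_left]
  simp only [e1, e2]
  rw [and_assoc, ← forall_and]
  simp only [and_comm]

/-- The lower ends are maxima and the upper ends minima of the same pairs, so `max + min` makes them
add up to the sums of `l` and `a'`. -/
theorem sum_localUpdate (a a' : Fin N → R) (l : Fin (N + 1) → R) (t : R) :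
    ∑ i, localUpdate a l a' t i = ∑ i, l i + (∑ i, a' i - ∑ i, a i) + t := by
  have h : ∑ i, lowerEnd l a' i + ∑ j, min (l (Fin.castSucc j)) (a' j) = ∑ i, l i + ∑ i, a' i := by
    rw [Fin.sum_univ_castSucc, Fin.sum_univ_castSucc (f := l)]
    have e : ∀ j : Fin N, lowerEnd l a' j.castSucc = max (l j.castSucc) (a' j) := fun j => by
      simp [lowerEnd]
    have e' : lowerEnd l a' (Fin.last N) = l (Fin.last N) := by simp [lowerEnd]
    simp only [e, e']
    have := Finset.sum_add_distrib (s := Finset.univ) (f := fun j : Fin N => max (l j.castSucc) (a' j))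
      (g := fun j => min (l j.castSucc) (a' j))
    simp only [max_add_min] at this
    rw [Finset.sum_add_distrib] at this
    rw [add_right_comm, ← this]
    abel
  rw [Fin.sum_univ_succ] at h
  rw [Fin.sum_univ_succ]
  simp only [localUpdate, Fin.cons_zero, Fin.cons_succ, Finset.sum_sub_distrib,
    Finset.sum_add_distrib]
  rw [eq_sub_of_add_eq h.symm]
  abel

theorem patternInsert_isGTPattern (x : Triangle N R) (ξ : Fin N → R) (hx : IsGTPattern x)
    (hξ : ∀ i, 0 ≤ ξ i) :
    IsGTPattern (patternInsert x ξ) ∧ HStrip (bottomRow x) (bottomRow (patternInsert x ξ)) := by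
  induction N with
  | zero => exact ⟨hx, fun i => i.elim0, fun i => i.elim0⟩
  | succ N ih =>
    rw [isGTPattern_succ_iff] at hx
    obtain ⟨h1, h2⟩ := ih (triInit x) (Fin.init ξ) hx.1 (fun i => hξ _)
    have h3 := (localUpdate_interlaces_iff (bottomRow (triInit x))
      (bottomRow (patternInsert (triInit x) (Fin.init ξ))) (bottomRow x) (ξ (Fin.last _))).2
      ⟨hξ _, hx.2, h2⟩
    rw [patternInsert, isGTPattern_triSnoc_iff, bottomRow_triSnoc]
    exact ⟨⟨h1, h3.2⟩, h3.1⟩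

theorem HStrip.antitone {l l' : Fin N → R} (h : HStrip l l') : Antitone l ∧ Antitone l' := by
  have h1 : ∀ (n : ℕ) (i j : Fin N), j.1 = i.1 + n → l j ≤ l i ∧ l' j ≤ l' i := by
    intro n
    induction n with
    | zero => intro i j hij; obtain rfl : i = j := Fin.ext hij.symm; exact ⟨le_rfl, le_rfl⟩
    | succ n ih =>
      intro i j hij
      obtain ⟨ha, hb⟩ := ih i ⟨i.1 + n, by omega⟩ rfl
      have hc := h.2 ⟨i.1 + n, by omega⟩ j (by simp; omega)
      exact ⟨((h.1 j).trans hc).trans ha, (hc.trans (h.1 _)).trans hb⟩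
  exact ⟨fun i j hij => (h1 (j.1 - i.1) i j (by have : i.1 ≤ j.1 := hij; omega)).1,
    fun i j hij => (h1 (j.1 - i.1) i j (by have : i.1 ≤ j.1 := hij; omega)).2⟩

/-- Inserting the zero column exhibits the bottom row as one side of a horizontal strip, and both
sides of a strip decrease. -/
theorem IsGTPattern.antitone_bottomRow {x : Triangle N R} (hx : IsGTPattern x) :
    Antitone (bottomRow x) :=
  (patternInsert_isGTPattern x 0 hx fun _ => le_rfl).2.antitone.1

/-! ### Tableaux -/

/-- The conditions under which `x i k` can be the number of letters `0, …, k` in row `i` of a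
tableau. -/
structure IsTableau (x : ℕ → ℕ → R) : Prop where
  zero : ∀ i k, k < i → x i k = 0
  mono : ∀ i k, x i k ≤ x i (k + 1)
  below : ∀ i k, x (i + 1) (k + 1) ≤ x i k
  nonneg : ∀ i k, 0 ≤ x i k

theorem rskInsert_zero_zero (x : ℕ → ℕ → R) (ξ : ℕ → R) :
    rskInsert x ξ 0 0 = x 0 0 + ξ 0 := rfl

theorem rskInsert_zero_succ (x : ℕ → ℕ → R) (ξ : ℕ → R) (k : ℕ) :
    rskInsert x ξ 0 (k + 1) = max (x 0 (k + 1)) (rskInsert x ξ 0 k) + ξ (k + 1) := rfl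

theorem wordAtRow_succ_zero (x : ℕ → ℕ → R) (ξ : ℕ → R) (i : ℕ) :
    wordAtRow x ξ (i + 1) 0 = 0 := by
  simp only [wordAtRow, bumped, rowInsert]
  abel

/-- The incoming letters cancel from the balance of letters, and `max + min` turns the remaining
difference into a minimum. This is the form that appears in `localUpdate`. -/
theorem wordAtRow_succ_succ (x : ℕ → ℕ → R) (ξ : ℕ → R) (i k : ℕ) :
    wordAtRow x ξ (i + 1) (k + 1) = min (x i (k + 1)) (rskInsert x ξ i k) - x i k := by
  have h := max_add_min (x i (k + 1)) (rowInsert (x i) (wordAtRow x ξ i) k)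
  simp only [wordAtRow, bumped, rskInsert, rowInsert]
  rw [← eq_sub_iff_add_eq'] at h
  rw [h]
  abel

theorem rskInsert_succ_zero (x : ℕ → ℕ → R) (ξ : ℕ → R) (i : ℕ) :
    rskInsert x ξ (i + 1) 0 = x (i + 1) 0 := by
  change x (i + 1) 0 + wordAtRow x ξ (i + 1) 0 = _
  rw [wordAtRow_succ_zero, add_zero]

theorem rskInsert_succ_succ (x : ℕ → ℕ → R) (ξ : ℕ → R) (i k : ℕ) :
    rskInsert x ξ (i + 1) (k + 1) = max (x (i + 1) (k + 1)) (rskInsert x ξ (i + 1) k) +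
      (min (x i (k + 1)) (rskInsert x ξ i k) - x i k) := by
  rw [← wordAtRow_succ_succ]
  rfl

theorem wordAtRow_nonneg {x : ℕ → ℕ → R} {ξ : ℕ → R} (hx : IsTableau x) (hξ : ∀ k, 0 ≤ ξ k)
    (i k : ℕ) : 0 ≤ wordAtRow x ξ i k := by
  induction i generalizing k with
  | zero => exact hξ k
  | succ i ih =>
    cases k with
    | zero => rw [wordAtRow_succ_zero]
    | succ k =>
      rw [wordAtRow_succ_succ, sub_nonneg]
      refine le_min (hx.mono i k) ?_
      cases k with
      | zero => exact le_add_of_nonneg_right (ih 0)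
      | succ k => exact (le_max_left _ _).trans (le_add_of_nonneg_right (ih (k + 1)))

theorem rskInsert_isTableau {x : ℕ → ℕ → R} {ξ : ℕ → R} (hx : IsTableau x) (hξ : ∀ k, 0 ≤ ξ k) :
    IsTableau (rskInsert x ξ) := by
  have hmono : ∀ i k, rskInsert x ξ i k ≤ rskInsert x ξ i (k + 1) := fun i k =>
    (le_max_right (x i (k + 1)) _).trans (le_add_of_nonneg_right (wordAtRow_nonneg hx hξ i (k + 1)))
  have hle : ∀ i k, x i k ≤ rskInsert x ξ i k := by
    intro i k
    cases k with
    | zero => exact le_add_of_nonneg_right (wordAtRow_nonneg hx hξ i 0)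
    | succ k =>
      exact (le_max_left _ _).trans (le_add_of_nonneg_right (wordAtRow_nonneg hx hξ i (k + 1)))
  have hzero : ∀ i k, k < i → rskInsert x ξ i k = 0 := by
    intro i
    induction i with
    | zero => intro k hk; omega
    | succ i ih =>
      intro k
      induction k with
      | zero => intro _; rw [rskInsert_succ_zero, hx.zero _ _ (by omega)]
      | succ k ihk =>
        intro hk
        rw [rskInsert_succ_succ, ihk (by omega), ih k (by omega), hx.zero _ _ hk,
          hx.zero i k (by omega), min_eq_right (hx.nonneg _ _)]
        simp
  have hbelow : ∀ i k, rskInsert x ξ (i + 1) (k + 1) ≤ min (x i (k + 1)) (rskInsert x ξ i k) := by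
    intro i k
    rw [rskInsert_succ_succ]
    -- The new entry is this maximum plus a minimum minus `x i k`, so this inequality is equivalent
    -- to bounding the entry by that minimum.
    have key : max (x (i + 1) (k + 1)) (rskInsert x ξ (i + 1) k) ≤ x i k := by
      refine max_le (hx.below i k) ?_
      induction k with
      | zero => rw [rskInsert_succ_zero, hx.zero (i + 1) 0 (by omega)]; exact hx.nonneg _ _
      | succ k ihk =>
        rw [rskInsert_succ_succ]
        refine le_trans ?_ (min_le_left (x i (k + 1)) (rskInsert x ξ i k))
        rw [add_sub_left_comm, add_le_iff_nonpos_right, sub_nonpos]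
        exact max_le (hx.below i k) ihk
    rw [add_sub_left_comm, add_le_iff_nonpos_right, sub_nonpos]
    exact key
  exact ⟨hzero, hmono, fun i k => (hbelow i k).trans (min_le_right _ _),
    fun i k => (hx.nonneg i k).trans (hle i k)⟩

theorem isTableau_zero : IsTableau (fun _ _ => (0 : R)) :=
  ⟨fun _ _ _ => rfl, fun _ _ => le_rfl, fun _ _ => le_rfl, fun _ _ => le_rfl⟩

/-- The first `N` levels of a tableau. -/
def toTriangle (N : ℕ) (x : ℕ → ℕ → R) : Triangle N R := fun k i => x i.1 k.1

theorem IsTableau.isGTPattern {x : ℕ → ℕ → R} (hx : IsTableau x) (N : ℕ) :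
    IsGTPattern (toTriangle N x) :=
  fun k _ i _ => ⟨hx.below i k, hx.mono i k⟩

/-- The row-by-row recursion, read column by column, is the level-by-level recursion. They could
differ only on the diagonal, where a level has no entry above it. -/
theorem toTriangle_rskInsert {x : ℕ → ℕ → R} {ξ : ℕ → R} (hx : IsTableau x)
    (hξ : ∀ k, 0 ≤ ξ k) (N : ℕ) :
    toTriangle N (rskInsert x ξ) = patternInsert (toTriangle N x) (fun i => ξ i) := by
  have hx' := rskInsert_isTableau hx hξ
  induction N with
  | zero => funext k; exact k.elim0
  | succ N ih =>
    rw [patternInsert]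
    have e1 : triInit (toTriangle (N + 1) x) = toTriangle N x := rfl
    have e2 : (Fin.init fun i : Fin (N + 1) => ξ i) = fun i : Fin N => ξ i := rfl
    rw [e1, e2, ← ih, ← triSnoc_triInit (toTriangle (N + 1) (rskInsert x ξ))]
    congr 1
    change (fun i : Fin (N + 1) => rskInsert x ξ i N) = _
    funext i
    cases N with
    | zero =>
      obtain rfl : i = 0 := Fin.ext (by omega)
      simp [localUpdate, lowerEnd, rskInsert_zero_zero, bottomRow_eq_last, toTriangle]
    | succ N =>
      have hl : ∀ j : Fin (N + 2), lowerEnd (bottomRow (toTriangle (N + 2) x))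
          (bottomRow (toTriangle (N + 1) (rskInsert x ξ))) j =
          max (x j (N + 1)) (rskInsert x ξ j N) := by
        intro j
        unfold lowerEnd
        split_ifs with h
        · rfl
        -- On the diagonal the missing entry above is zero in the tableau, and nonnegativity lets
        -- the maximum absorb it.
        · have : j.1 = N + 1 := by omega
          rw [hx'.zero j N (by omega), max_eq_left (hx.nonneg _ _)]
          rfl
      induction i using Fin.cases with
      | zero =>
        simp only [localUpdate, Fin.cons_zero, hl]
        exact rskInsert_zero_succ x ξ N
      | succ j =>
        simp only [localUpdate, Fin.cons_succ, hl]
        rw [Fin.val_succ, rskInsert_succ_succ, add_sub_assoc]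
        rfl

theorem rskPattern_eq_toTriangle (ξ : Fin N → ℕ → R) (n : ℕ) :
    rskPattern ξ n = toTriangle N (rskTableau (extendRows ξ) n) := rfl

theorem extendRows_nonneg {ξ : Fin N → ℕ → R} (hξ : ∀ i j, 0 ≤ ξ i j) (i j : ℕ) :
    0 ≤ extendRows ξ i j := by
  unfold extendRows
  split_ifs
  · exact hξ _ _
  · exact le_rfl

theorem rskTableau_isTableau {ξ : ℕ → ℕ → R} (hξ : ∀ i j, 0 ≤ ξ i j) (n : ℕ) :
    IsTableau (rskTableau ξ n) := by
  induction n with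
  | zero => exact isTableau_zero
  | succ n ih => exact rskInsert_isTableau ih fun k => hξ k n

/-- The patterns obtained from `x` by inserting successively the columns `c 0, c 1, …`. -/
def patternProcess (x : Triangle N R) (c : ℕ → Fin N → R) : ℕ → Triangle N R
  | 0 => x
  | n + 1 => patternInsert (patternProcess x c n) (c n)

theorem rskPattern_eq_patternProcess {ξ : Fin N → ℕ → R} (hξ : ∀ i j, 0 ≤ ξ i j) (n : ℕ) :
    rskPattern ξ n = patternProcess 0 (fun j i => ξ i j) n := by
  induction n with
  | zero => rfl
  | succ n ih =>
    rw [patternProcess, ← ih, rskPattern_eq_toTriangle, rskTableau,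
      toTriangle_rskInsert (rskTableau_isTableau (extendRows_nonneg hξ) n)
        (fun k => extendRows_nonneg hξ k n), rskPattern_eq_toTriangle]
    congr 1
    funext i
    simp [extendRows]

theorem map_rowInsert {S : Type*} [AddCommGroup S] [LinearOrder S] (f : R →+ S) (hf : Monotone f)
    (y ξ : ℕ → R) (k : ℕ) :
    f (rowInsert y ξ k) = rowInsert (fun k => f (y k)) (fun k => f (ξ k)) k := by
  induction k with
  | zero => simp [rowInsert]
  | succ k ih => rw [rowInsert, rowInsert, map_add, hf.map_max, ih]

theorem map_wordAtRow {S : Type*} [AddCommGroup S] [LinearOrder S] (f : R →+ S) (hf : Monotone f)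
    (x : ℕ → ℕ → R) (ξ : ℕ → R) (i k : ℕ) :
    f (wordAtRow x ξ i k) = wordAtRow (fun i k => f (x i k)) (fun k => f (ξ k)) i k := by
  induction i generalizing k with
  | zero => rfl
  | succ i ih => cases k <;> simp [wordAtRow, bumped, map_rowInsert f hf, ih]

theorem map_rskTableau {S : Type*} [AddCommGroup S] [LinearOrder S] (f : R →+ S) (hf : Monotone f)
    (ξ : ℕ → ℕ → R) (n i k : ℕ) :
    f (rskTableau ξ n i k) = rskTableau (fun i j => f (ξ i j)) n i k := by
  induction n generalizing i k with
  | zero => simp [rskTableau]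
  | succ n ih => simp [rskTableau, rskInsert, map_rowInsert f hf, map_wordAtRow f hf, ih]

/-- RSK uses only sums, differences and maxima, and monotone additive maps respect these. The map
needed later is `m ↦ m / L` from `ℤ` to `ℝ`. -/
theorem map_rskPattern {S : Type*} [AddCommGroup S] [LinearOrder S] (f : R →+ S) (hf : Monotone f)
    (ξ : Fin N → ℕ → R) (n : ℕ) (k : Fin N) (i : Fin (k.1 + 1)) :
    f (rskPattern ξ n k i) = rskPattern (fun i j => f (ξ i j)) n k i := by
  rw [rskPattern, rskPattern, map_rskTableau f hf]
  congr 1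
  funext i j
  unfold extendRows
  split_ifs <;> simp

theorem patternProcess_isGTPattern {x : Triangle N R} {c : ℕ → Fin N → R} (hx : IsGTPattern x)
    (hc : ∀ n i, 0 ≤ c n i) (n : ℕ) : IsGTPattern (patternProcess x c n) := by
  induction n with
  | zero => exact hx
  | succ n ih => exact (patternInsert_isGTPattern _ _ ih (hc n)).1

end Order

/-! ### Last-passage times -/

/-- The first row satisfies the last-passage recursion: the new entry is the maximum of its two
predecessors plus the weight. This direction needs no sign of the weights. -/
theorem IsUpRightPath.sum_le {w : ℕ → ℕ → ℝ} {P : List (ℕ × ℕ)}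
    {v : ℕ × ℕ} (h : IsUpRightPath P v) :
    (P.map fun p => w p.1 p.2).sum ≤ rskTableau w (v.2 + 1) 0 v.1 := by
  induction h with
  | origin => simp [rskTableau, rskInsert_zero_zero]
  | @stepFst P i j h ih =>
    simp only [List.map_cons, List.sum_cons, rskTableau, rskInsert_zero_succ] at ih ⊢
    linarith [le_max_right (rskTableau w j 0 (i + 1))
      (rskInsert (rskTableau w j) (fun k => w k j) 0 i)]
  | @stepSnd P i j h ih =>
    rw [List.map_cons, List.sum_cons, add_comm]
    change _ ≤ rskInsert (rskTableau w (j + 1)) (fun k => w k (j + 1)) 0 i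
    cases i with
    | zero => rw [rskInsert_zero_zero]; exact add_le_add ih le_rfl
    | succ i =>
      rw [rskInsert_zero_succ]
      exact add_le_add (ih.trans (le_max_left _ _)) le_rfl

theorem exists_isUpRightPath_sum_eq {w : ℕ → ℕ → ℝ} (hw : ∀ i j, 0 ≤ w i j) (i n : ℕ) :
    ∃ P, IsUpRightPath P (i, n) ∧
      rskTableau w (n + 1) 0 i = (P.map fun p => w p.1 p.2).sum := by
  induction n generalizing i with
  | zero =>
    induction i with
    | zero => exact ⟨_, .origin, by simp [rskTableau, rskInsert_zero_zero]⟩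
    | succ i ih =>
      obtain ⟨P, hP, hs⟩ := ih
      refine ⟨_, hP.stepFst, ?_⟩
      -- In the first column the competing predecessor is the empty tableau. Nonnegative weights
      -- ensure that its value `0` never wins against the path within the column.
      have h0 := (rskTableau_isTableau hw 1).nonneg 0 i
      simp only [rskTableau, rskInsert_zero_succ, List.map_cons, List.sum_cons] at hs h0 ⊢
      rw [max_eq_right h0, hs, add_comm]
  | succ n ihn =>
    induction i with
    | zero =>
      obtain ⟨P, hP, hs⟩ := ihn 0
      refine ⟨_, hP.stepSnd, ?_⟩
      rw [rskTableau, rskInsert_zero_zero, hs, List.map_cons, List.sum_cons, add_comm]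
    | succ i ih =>
      rw [rskTableau, rskInsert_zero_succ]
      rcases max_choice (rskTableau w (n + 1) 0 (i + 1))
        (rskInsert (rskTableau w (n + 1)) (fun k => w k (n + 1)) 0 i) with h | h
      · obtain ⟨P, hP, hs⟩ := ihn (i + 1)
        exact ⟨_, hP.stepSnd, by rw [h, hs, List.map_cons, List.sum_cons, add_comm]⟩
      · obtain ⟨P, hP, hs⟩ := ih
        rw [rskTableau] at hs
        exact ⟨_, hP.stepFst, by rw [h, hs, List.map_cons, List.sum_cons, add_comm]⟩

theorem isGreatest_pathWeights {w : ℕ → ℕ → ℝ} (hw : ∀ i j, 0 ≤ w i j) (i n : ℕ) :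
    IsGreatest (pathWeights w (i, n)) (rskTableau w (n + 1) 0 i) := by
  refine ⟨exists_isUpRightPath_sum_eq hw i n, ?_⟩
  rintro s ⟨P, hP, rfl⟩
  exact hP.sum_le

end Combinatorics

/-! ### Sums and integrals over Gelfand-Tsetlin patterns with given bottom row -/

/-! ### Continuity of the level-by-level insertion -/

section Measurability

variable {R : Type} [AddCommGroup R] [LinearOrder R] [IsOrderedAddMonoid R] [TopologicalSpace R]
  [OrderClosedTopology R] [IsTopologicalAddGroup R]
  {N : ℕ}

theorem Continuous.triSnoc {Q : Type*} [TopologicalSpace Q] {f : Q → Triangle N R}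
    {g : Q → Fin (N + 1) → R} (hf : Continuous f) (hg : Continuous g) :
    Continuous fun q => triSnoc (f q) (g q) := by
  refine continuous_pi fun k => ?_
  induction k using Fin.lastCases with
  | last => simpa using hg
  | cast k => simpa [Function.comp_def] using (continuous_apply k).comp hf

theorem Continuous.triInit {Q : Type*} [TopologicalSpace Q] {f : Q → Triangle (N + 1) R}
    (hf : Continuous f) : Continuous fun q => triInit (f q) :=
  continuous_pi fun k => (continuous_apply k.castSucc).comp hf

theorem Continuous.bottomRow {Q : Type*} [TopologicalSpace Q] {f : Q → Triangle N R}
    (hf : Continuous f) : Continuous fun q => bottomRow (f q) := by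
  cases N with
  | zero => exact continuous_pi fun i => i.elim0
  | succ N => exact (continuous_apply (Fin.last N)).comp hf

theorem Continuous.lowerEnd {Q : Type*} [TopologicalSpace Q] {l : Q → Fin (N + 1) → R}
    {a : Q → Fin N → R} (hl : Continuous l) (ha : Continuous a) (i : Fin (N + 1)) :
    Continuous fun q => lowerEnd (l q) (a q) i := by
  unfold _root_.lowerEnd
  split_ifs <;> fun_prop

theorem Continuous.localUpdate {Q : Type*} [TopologicalSpace Q] {l : Q → Fin (N + 1) → R}
    {a a' : Q → Fin N → R} {t : Q → R} (ha : Continuous a) (hl : Continuous l)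
    (ha' : Continuous a') (ht : Continuous t) :
    Continuous fun q => localUpdate (a q) (l q) (a' q) (t q) := by
  refine continuous_pi fun i => ?_
  induction i using Fin.cases with
  | zero =>
    simp only [_root_.localUpdate, Fin.cons_zero]
    exact (hl.lowerEnd ha' 0).add ht
  | succ j =>
    simp only [_root_.localUpdate, Fin.cons_succ]
    have := hl.lowerEnd ha' j.succ
    fun_prop

theorem Continuous.patternInsert {Q : Type*} [TopologicalSpace Q] {x : Q → Triangle N R}
    {ξ : Q → Fin N → R} (hx : Continuous x) (hξ : Continuous ξ) :
    Continuous fun q => patternInsert (x q) (ξ q) := by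
  induction N with
  | zero => exact hx
  | succ N ih =>
    have h : Continuous fun q => (Fin.init (ξ q) : Fin N → R) :=
      continuous_pi fun i => (continuous_apply i.castSucc).comp hξ
    have h' := ih hx.triInit h
    exact h'.triSnoc (Continuous.localUpdate hx.triInit.bottomRow hx.bottomRow h'.bottomRow
      ((continuous_apply _).comp hξ))

theorem continuous_patternProcess {Q : Type*} [TopologicalSpace Q] {x : Q → Triangle N R}
    {c : Q → ℕ → Fin N → R} (hx : Continuous x) (hc : Continuous c) (n : ℕ) :
    Continuous fun q => patternProcess (x q) (c q) n := by
  induction n with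
  | zero => exact hx
  | succ n ih => exact ih.patternInsert ((continuous_apply n).comp hc)

end Measurability

/-! ### Nested integrals over patterns -/

section GTInt

/-- The indicator function of a proposition. -/
noncomputable def ind (p : Prop) : ℝ≥0∞ := open Classical in if p then 1 else 0

theorem ind_of {p : Prop} (h : p) : ind p = 1 := by simp [ind, h]

theorem ind_of_not {p : Prop} (h : ¬p) : ind p = 0 := by simp [ind, h]

theorem ind_and (p q : Prop) : ind (p ∧ q) = ind p * ind q := by
  by_cases hp : p <;> by_cases hq : q <;> simp [ind, hp, hq]

theorem measurable_ind {Q : Type*} [MeasurableSpace Q] {p : Q → Prop}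
    (hp : MeasurableSet {q | p q}) : Measurable fun q => ind (p q) := by
  classical
  unfold ind
  exact Measurable.ite hp measurable_const measurable_const

variable {R : Type} [AddCommGroup R] [LinearOrder R] [IsOrderedAddMonoid R] [TopologicalSpace R]
  [OrderClosedTopology R] [IsTopologicalAddGroup R] [SecondCountableTopology R]
  [MeasurableSpace R] [BorelSpace R] {N : ℕ}

theorem measurableSet_interlaces {Q : Type*} [MeasurableSpace Q] {a : Q → Fin N → R}
    {l : Q → Fin (N + 1) → R} (ha : Measurable a) (hl : Measurable l) :
    MeasurableSet {q | Interlaces (a q) (l q)} := by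
  simp only [Interlaces, Set.ofPred_forall]
  refine MeasurableSet.iInter fun i => ?_
  exact (measurableSet_le (by fun_prop) (by fun_prop)).inter
    (measurableSet_le (by fun_prop) (by fun_prop))

theorem measurableSet_hStrip {Q : Type*} [MeasurableSpace Q] {a l : Q → Fin N → R}
    (ha : Measurable a) (hl : Measurable l) :
    MeasurableSet {q | HStrip (a q) (l q)} := by
  have h : {q | HStrip (a q) (l q)} = (⋂ i, {q | a q i ≤ l q i}) ∩
      ⋂ i, ⋂ j, {q | i.1 + 1 = j.1 → l q j ≤ a q i} := by
    ext q
    simp [HStrip]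
  rw [h]
  refine (MeasurableSet.iInter fun i => measurableSet_le (by fun_prop) (by fun_prop)).inter
    (MeasurableSet.iInter fun i => MeasurableSet.iInter fun j => ?_)
  by_cases hij : i.1 + 1 = j.1
  · simpa [hij] using measurableSet_le (by fun_prop) (by fun_prop)
  · simp [hij]

variable (μ : Measure R) [SigmaFinite μ] (E : ℕ → R → ℝ≥0∞)

/-- The integral of `f` over the patterns with bottom row `l`, where the levels above `l` are
integrated against `μ` with the weight `∏ₖ E k (|xᵏ| - |xᵏ⁻¹|)`. -/
noncomputable def gtInt : (N : ℕ) → (Fin N → R) → (Triangle N R → ℝ≥0∞) → ℝ≥0∞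
  | 0, _, f => f fun k => k.elim0
  | N + 1, l, f => ∫⁻ a : Fin N → R, ind (Interlaces a l) * E N (∑ i, l i - ∑ i, a i) *
      gtInt N a (fun x => f (triSnoc x l)) ∂(Measure.pi fun _ => μ)

variable {μ E}

theorem gtInt_mono {l : Fin N → R} {f g : Triangle N R → ℝ≥0∞}
    (h : ∀ x, IsGTPattern x → bottomRow x = l → f x ≤ g x) :
    gtInt μ E N l f ≤ gtInt μ E N l g := by
  induction N with
  | zero => exact h _ (fun k hk => by omega) (Subsingleton.elim _ _)
  | succ N ih =>
    refine lintegral_mono fun a => ?_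
    by_cases ha : Interlaces a l
    · refine mul_le_mul_right (ih fun x hx hxa => ?_) _
      exact h _ ((isGTPattern_triSnoc_iff x l).2 ⟨hx, hxa ▸ ha⟩) (by simp)
    · simp [ind_of_not ha]

theorem gtInt_congr {l : Fin N → R} {f g : Triangle N R → ℝ≥0∞}
    (h : ∀ x, IsGTPattern x → bottomRow x = l → f x = g x) :
    gtInt μ E N l f = gtInt μ E N l g :=
  le_antisymm (gtInt_mono fun x h1 h2 => (h x h1 h2).le)
    (gtInt_mono fun x h1 h2 => (h x h1 h2).ge)

theorem Measurable.triSnoc {Q : Type*} [MeasurableSpace Q] {f : Q → Triangle N R}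
    {g : Q → Fin (N + 1) → R} (hf : Measurable f) (hg : Measurable g) :
    Measurable fun q => triSnoc (f q) (g q) :=
  (Continuous.triSnoc (R := R) continuous_fst continuous_snd).measurable.comp (hf.prodMk hg)

theorem Measurable.localUpdate {Q : Type*} [MeasurableSpace Q] {l : Q → Fin (N + 1) → R}
    {a a' : Q → Fin N → R} {t : Q → R} (ha : Measurable a) (hl : Measurable l)
    (ha' : Measurable a') (ht : Measurable t) :
    Measurable fun q => localUpdate (a q) (l q) (a' q) (t q) :=
  (Continuous.localUpdate (R := R) (N := N) continuous_fst (continuous_fst.comp continuous_snd)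
    (continuous_fst.comp (continuous_snd.comp continuous_snd))
    (continuous_snd.comp (continuous_snd.comp continuous_snd))).measurable.comp
      (ha.prodMk (hl.prodMk (ha'.prodMk ht)))

theorem Measurable.patternInsert {Q : Type*} [MeasurableSpace Q] {x : Q → Triangle N R}
    {ξ : Q → Fin N → R} (hx : Measurable x) (hξ : Measurable ξ) :
    Measurable fun q => patternInsert (x q) (ξ q) :=
  (Continuous.patternInsert (R := R) continuous_fst continuous_snd).measurable.comp (hx.prodMk hξ)

theorem Measurable.bottomRow {Q : Type*} [MeasurableSpace Q] {f : Q → Triangle N R}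
    (hf : Measurable f) : Measurable fun q => bottomRow (f q) :=
  (Continuous.bottomRow (R := R) continuous_id).measurable.comp hf

theorem Measurable.gtInt (hE : ∀ k, Measurable (E k)) {Q : Type*} [MeasurableSpace Q]
    {l : Q → Fin N → R} {f : Q → Triangle N R → ℝ≥0∞} (hl : Measurable l)
    (hf : Measurable fun p : Q × Triangle N R => f p.1 p.2) :
    Measurable fun q => gtInt μ E N (l q) (f q) := by
  induction N generalizing Q with
  | zero =>
    simp only [_root_.gtInt]
    exact hf.comp (measurable_id.prodMk measurable_const)
  | succ N ih =>
    simp only [_root_.gtInt]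
    refine Measurable.lintegral_prod_right' (f := fun p : Q × (Fin N → R) =>
      ind (Interlaces p.2 (l p.1)) * E N (∑ i, l p.1 i - ∑ i, p.2 i) *
        _root_.gtInt μ E N p.2 (fun x => f p.1 (_root_.triSnoc x (l p.1)))) ?_
    refine Measurable.mul (Measurable.mul ?_ ?_) ?_
    · exact measurable_ind (measurableSet_interlaces measurable_snd (by fun_prop))
    · exact (hE N).comp (by fun_prop)
    · refine ih measurable_snd ?_
      exact hf.comp ((by fun_prop : Measurable fun p : (Q × (Fin N → R)) × Triangle N R =>
        p.1.1).prodMk (Measurable.triSnoc measurable_snd (by fun_prop)))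

theorem gtInt_lintegral (hE : ∀ k, Measurable (E k)) {Y : Type*} [MeasurableSpace Y]
    {ν : Measure Y} [SFinite ν] (l : Fin N → R) {f : Triangle N R → Y → ℝ≥0∞}
    (hf : Measurable fun p : Triangle N R × Y => f p.1 p.2) :
    gtInt μ E N l (fun x => ∫⁻ y, f x y ∂ν) = ∫⁻ y, gtInt μ E N l (fun x => f x y) ∂ν := by
  induction N with
  | zero => rfl
  | succ N ih =>
    have hf' : Measurable fun p : Triangle N R × Y => f (triSnoc p.1 l) p.2 :=
      hf.comp ((Measurable.triSnoc measurable_fst measurable_const).prodMk measurable_snd)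
    have hm : Measurable fun p : (Fin N → R) × Y =>
        gtInt μ E N p.1 (fun x => f (triSnoc x l) p.2) := by
      refine Measurable.gtInt hE measurable_fst ?_
      exact hf'.comp (measurable_snd.prodMk (by fun_prop))
    simp only [gtInt]
    rw [lintegral_lintegral_swap]
    · refine lintegral_congr fun a => ?_
      have hm' : Measurable fun y => gtInt μ E N a (fun x => f (triSnoc x l) y) :=
        hm.comp (measurable_const.prodMk measurable_id)
      rw [ih _ hf', lintegral_const_mul _ hm']
    · refine Measurable.aemeasurable ?_
      refine Measurable.mul (Measurable.mul ?_ ?_) ?_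
      · exact measurable_ind (measurableSet_interlaces (by fun_prop) measurable_const)
      · exact (hE N).comp (by fun_prop)
      · exact hm.comp (measurable_snd.prodMk measurable_fst)

theorem gtInt_const_mul (hE : ∀ k, Measurable (E k)) (l : Fin N → R) {f : Triangle N R → ℝ≥0∞}
    (hf : Measurable f) (c : ℝ≥0∞) :
    gtInt μ E N l (fun x => c * f x) = c * gtInt μ E N l f := by
  induction N with
  | zero => rfl
  | succ N ih =>
    have hm : Measurable fun a : Fin N → R => gtInt μ E N a (fun x => f (triSnoc x l)) :=
      Measurable.gtInt hE measurable_id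
        (hf.comp (Measurable.triSnoc measurable_snd measurable_const))
    simp only [gtInt]
    rw [← lintegral_const_mul]
    · refine lintegral_congr fun a => ?_
      have hf' : Measurable fun x => f (triSnoc x l) :=
        hf.comp (Measurable.triSnoc measurable_id measurable_const)
      rw [ih _ hf']
      ring
    · refine Measurable.mul (Measurable.mul ?_ ?_) hm
      · exact measurable_ind (measurableSet_interlaces measurable_id measurable_const)
      · exact (hE N).comp (by fun_prop)

/-! ### The intertwining relation -/

theorem lintegral_pi_insertNth {n : ℕ} (ν : Fin (n + 1) → Measure R) [∀ i, SigmaFinite (ν i)]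
    (i : Fin (n + 1)) {f : (Fin (n + 1) → R) → ℝ≥0∞} (hf : Measurable f) :
    ∫⁻ x, f x ∂(Measure.pi ν) = ∫⁻ t, ∫⁻ y, f (i.insertNth t y)
      ∂(Measure.pi fun j => ν (i.succAbove j)) ∂(ν i) := by
  have h := (measurePreserving_piFinSuccAbove ν i).symm
  rw [← h.lintegral_comp hf, lintegral_prod]
  · rfl
  · exact (hf.comp (MeasurableEquiv.measurable _)).aemeasurable

/-- With `l` and `a'` fixed, the substitution acts on each coordinate separately: a translation of
`t` and a map `x ↦ s - x` of each `a j`, both preserving `μ`. The indicators correspond by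
`localUpdate_interlaces_iff`. -/
theorem lintegral_localUpdate (hadd : ∀ c : R, MeasurePreserving (fun t => c + t) μ μ)
    (hsub : ∀ c : R, MeasurePreserving (fun t => c - t) μ μ) (l : Fin (N + 1) → R)
    (a' : Fin N → R) {h : (Fin (N + 1) → R) → ℝ≥0∞} (hh : Measurable h) :
    ∫⁻ a, ∫⁻ t, ind (0 ≤ t ∧ Interlaces a l ∧ HStrip a a') * h (localUpdate a l a' t)
      ∂μ ∂(Measure.pi fun _ => μ) =
    ∫⁻ l', ind (HStrip l l' ∧ Interlaces a' l') * h l' ∂(Measure.pi fun _ => μ) := by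
  set G : (Fin (N + 1) → R) → ℝ≥0∞ := fun l' => ind (HStrip l l' ∧ Interlaces a' l') * h l'
  have hG : Measurable G := by
    refine Measurable.mul (measurable_ind ?_) hh
    exact (measurableSet_hStrip measurable_const measurable_id).inter
      (measurableSet_interlaces measurable_const measurable_id)
  have hc : Measurable fun p : R × (Fin N → R) => G (Fin.cons p.1 p.2) := by
    refine hG.comp (measurable_pi_iff.2 fun i => ?_)
    induction i using Fin.cases with
    | zero => simpa using measurable_fst
    | succ i => simpa [Function.comp_def] using (measurable_pi_apply i).comp measurable_snd
  rw [lintegral_pi_insertNth _ 0 hG]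
  simp only [Fin.insertNth_zero']
  rw [← (hadd (lowerEnd l a' 0)).lintegral_comp (Measurable.lintegral_prod_right' hc),
    lintegral_lintegral_swap]
  · refine lintegral_congr fun t => ?_
    have hp := measurePreserving_pi (fun _ : Fin N => μ) (fun _ => μ)
      (fun j => hsub (lowerEnd l a' j.succ + min (l j.castSucc) (a' j)))
    have hc' : Measurable fun y : Fin N → R => G (Fin.cons (lowerEnd l a' 0 + t) y) :=
      hc.comp (measurable_const.prodMk measurable_id)
    rw [← hp.lintegral_comp hc']
    refine lintegral_congr fun a => ?_
    simp only [← localUpdate_interlaces_iff]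
    rfl
  · refine Measurable.aemeasurable (Measurable.mul (measurable_ind ?_) (hh.comp ?_))
    · exact (measurableSet_le measurable_const measurable_snd).inter
        ((measurableSet_interlaces measurable_fst measurable_const).inter
          (measurableSet_hStrip measurable_fst measurable_const))
    · exact Measurable.localUpdate measurable_fst measurable_const measurable_const measurable_snd

set_option maxHeartbeats 2000000 in
/-- Inserting a random column in a random pattern with bottom row `l` amounts to choosing a new
bottom row `l'` and then a random pattern with bottom row `l'`. -/
theorem gtInt_patternInsert (hadd : ∀ c : R, MeasurePreserving (fun t => c + t) μ μ)
    (hsub : ∀ c : R, MeasurePreserving (fun t => c - t) μ μ) (hE : ∀ k, Measurable (E k))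
    (hEmul : ∀ k x y, E k (x + y) = E k x * E k y) {B : R → ℝ≥0∞} (hB : Measurable B)
    (hBmul : ∀ x y, B (x + y) = B x * B y) (hB0 : B 0 = 1) {C : ℕ → ℝ≥0∞} {ν : ℕ → Measure R}
    [∀ k, SigmaFinite (ν k)]
    (hν : ∀ k < N, ν k = μ.withDensity fun t => ind (0 ≤ t) * (C k * (E k t * B t)))
    (l : Fin N → R) {f : Triangle N R → ℝ≥0∞} (hf : Measurable f) :
    gtInt μ E N l (fun x => ∫⁻ ξ, f (patternInsert x ξ) ∂(Measure.pi fun k : Fin N => ν k)) =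
    ∫⁻ l', ind (HStrip l l') * ((∏ k : Fin N, C k) * B (∑ i, l' i - ∑ i, l i)) *
      gtInt μ E N l' f ∂(Measure.pi fun _ => μ) := by
  induction N with
  | zero =>
    simp only [gtInt, patternInsert]
    have h : ∀ l' : Fin 0 → R, ind (HStrip l l') = 1 := fun l' =>
      ind_of ⟨fun i => i.elim0, fun i => i.elim0⟩
    simp [h, hB0]
  | succ N ih =>
    -- `G` integrates out the levels above the new pair `a'`, `l'`, `H` adds the weights of that
    -- pair, and `J` is the integrand in the old variables `a`, `t`.
    obtain ⟨G, hG⟩ : ∃ G : (Fin N → R) → (Fin (N + 1) → R) → ℝ≥0∞, ∀ a' l', G a' l' =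
      gtInt μ E N a' (fun x => f (triSnoc x l')) := ⟨_, fun _ _ => rfl⟩
    have hGm : Measurable fun p : (Fin N → R) × (Fin (N + 1) → R) => G p.1 p.2 := by
      simp only [hG]
      refine Measurable.gtInt hE measurable_fst (hf.comp ?_)
      exact Measurable.triSnoc measurable_snd (by fun_prop)
    obtain ⟨H, hH⟩ : ∃ H : (Fin N → R) → (Fin (N + 1) → R) → ℝ≥0∞, ∀ a' l', H a' l' =
      (∏ k : Fin (N + 1), C k) * (E N (∑ i, l' i - ∑ i, a' i) * B (∑ i, l' i - ∑ i, l i)) *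
        G a' l' := ⟨_, fun _ _ => rfl⟩
    have hHm : Measurable fun p : (Fin N → R) × (Fin (N + 1) → R) => H p.1 p.2 := by
      simp only [hH]
      refine Measurable.mul (Measurable.mul measurable_const (Measurable.mul ?_ ?_)) hGm
      · exact (hE N).comp (by fun_prop)
      · exact hB.comp (by fun_prop)
    obtain ⟨J, hJ⟩ : ∃ J : (Fin N → R) → (Fin N → R) → R → ℝ≥0∞, ∀ a a' t, J a a' t =
      ind (0 ≤ t ∧ Interlaces a l ∧ HStrip a a') * H a' (localUpdate a l a' t) :=
      ⟨_, fun _ _ _ => rfl⟩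
    have hJm : Measurable fun p : (Fin N → R) × (Fin N → R) × R => J p.1 p.2.1 p.2.2 := by
      simp only [hJ]
      refine Measurable.mul (measurable_ind ?_) (hHm.comp (Measurable.prodMk
        (measurable_fst.comp measurable_snd) ?_))
      · exact (measurableSet_le measurable_const (by fun_prop)).inter
          ((measurableSet_interlaces measurable_fst measurable_const).inter
            (measurableSet_hStrip measurable_fst (by fun_prop)))
      · exact Measurable.localUpdate measurable_fst measurable_const (by fun_prop) (by fun_prop)
    have hsplit : ∀ x : Triangle N R,
        ∫⁻ ξ, f (patternInsert (triSnoc x l) ξ) ∂(Measure.pi fun k : Fin (N + 1) => ν k) =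
        ∫⁻ t, ∫⁻ ξ, f (triSnoc (patternInsert x ξ) (localUpdate (bottomRow x) l
          (bottomRow (patternInsert x ξ)) t)) ∂(Measure.pi fun k : Fin N => ν k) ∂(ν N) := by
      intro x
      rw [lintegral_pi_insertNth _ (Fin.last N)]
      · simp only [Fin.insertNth_last', patternInsert_triSnoc, Fin.init_snoc, Fin.snoc_last,
          Fin.succAbove_last, Fin.val_last, Fin.val_castSucc]
      · exact hf.comp (Measurable.patternInsert measurable_const measurable_id)
    have hins : Measurable fun p : (Triangle N R × R) × (Fin N → R) => patternInsert p.1.1 p.2 :=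
      Measurable.patternInsert (by fun_prop) (by fun_prop)
    -- The last level sees the levels above it only through `a` and `a'`. So the induction
    -- hypothesis applies to the first `N` levels while `t` is held fixed.
    have step1 : ∀ a : Fin N → R,
        gtInt μ E N a (fun x => ∫⁻ ξ, f (patternInsert (triSnoc x l) ξ)
          ∂(Measure.pi fun k : Fin (N + 1) => ν k)) =
        ∫⁻ t, ∫⁻ a', ind (HStrip a a') * ((∏ k : Fin N, C k) * B (∑ i, a' i - ∑ i, a i)) *
          G a' (localUpdate a l a' t) ∂(Measure.pi fun _ => μ) ∂(ν N) := by
      intro a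
      have hft : ∀ t, Measurable fun x' : Triangle N R =>
          f (triSnoc x' (localUpdate a l (bottomRow x') t)) := fun t =>
        hf.comp (Measurable.triSnoc measurable_id (Measurable.localUpdate measurable_const
          measurable_const (Measurable.bottomRow measurable_id) measurable_const))
      calc _ = gtInt μ E N a (fun x => ∫⁻ t, ∫⁻ ξ, f (triSnoc (patternInsert x ξ)
            (localUpdate a l (bottomRow (patternInsert x ξ)) t))
            ∂(Measure.pi fun k : Fin N => ν k) ∂(ν N)) := by
            refine gtInt_congr fun x _ hx => ?_
            rw [hsplit, hx]
        _ = ∫⁻ t, gtInt μ E N a (fun x => ∫⁻ ξ, f (triSnoc (patternInsert x ξ)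
            (localUpdate a l (bottomRow (patternInsert x ξ)) t))
            ∂(Measure.pi fun k : Fin N => ν k)) ∂(ν N) := by
            refine gtInt_lintegral hE a ?_
            refine Measurable.lintegral_prod_right' (f := fun p : (Triangle N R × R) × (Fin N → R) =>
              f (triSnoc (patternInsert p.1.1 p.2)
                (localUpdate a l (bottomRow (patternInsert p.1.1 p.2)) p.1.2))) ?_
            exact hf.comp (Measurable.triSnoc hins (Measurable.localUpdate measurable_const
              measurable_const hins.bottomRow (by fun_prop)))
        _ = _ := by
            refine lintegral_congr fun t => ?_
            rw [ih (fun k hk => hν k (by omega)) a (hft t)]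
            refine lintegral_congr fun a' => ?_
            rw [hG]
            congr 1
            exact gtInt_congr fun x _ hx => by rw [hx]
    have step2 : ∀ a : Fin N → R, ind (Interlaces a l) * E N (∑ i, l i - ∑ i, a i) *
        gtInt μ E N a (fun x => ∫⁻ ξ, f (patternInsert (triSnoc x l) ξ)
          ∂(Measure.pi fun k : Fin (N + 1) => ν k)) =
        ∫⁻ a', ∫⁻ t, J a a' t ∂μ ∂(Measure.pi fun _ => μ) := by
      intro a
      have hm : Measurable fun p : R × (Fin N → R) =>
          ind (HStrip a p.2) * ((∏ k : Fin N, C k) * B (∑ i, p.2 i - ∑ i, a i)) *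
          G p.2 (localUpdate a l p.2 p.1) := by
        refine Measurable.mul (Measurable.mul (measurable_ind (measurableSet_hStrip
          measurable_const measurable_snd)) (Measurable.mul measurable_const
            (hB.comp (by fun_prop)))) (hGm.comp (Measurable.prodMk measurable_snd ?_))
        exact Measurable.localUpdate measurable_const measurable_const measurable_snd measurable_fst
      have hd : Measurable fun t : R => ind (0 ≤ t) * (C N * (E N t * B t)) :=
        Measurable.mul (measurable_ind (measurableSet_le measurable_const measurable_id))
          (Measurable.mul measurable_const ((hE N).mul hB))
      rw [step1, hν N (by omega), lintegral_withDensity_eq_lintegral_mul _ hd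
        (Measurable.lintegral_prod_right' hm), ← lintegral_const_mul _
        (hd.mul (Measurable.lintegral_prod_right' hm)), lintegral_lintegral_swap]
      · refine lintegral_congr fun t => ?_
        have hm' : Measurable fun a' : Fin N → R =>
            ind (HStrip a a') * ((∏ k : Fin N, C k) * B (∑ i, a' i - ∑ i, a i)) *
            G a' (localUpdate a l a' t) := hm.comp (measurable_const.prodMk measurable_id)
        rw [Pi.mul_apply, ← lintegral_const_mul _ hm', ← lintegral_const_mul]
        · refine lintegral_congr fun a' => ?_
          simp only [hJ, hH]
          -- Conservation of sums moves the weights from the old level to the new one: `t` completes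
          -- the old difference of level sums for `E N` and the increment of the upper level for
          -- `B`.
          have e1 : ∑ i, localUpdate a l a' t i - ∑ i, a' i =
              (∑ i, l i - ∑ i, a i) + t := by rw [sum_localUpdate]; abel
          have e2 : ∑ i, localUpdate a l a' t i - ∑ i, l i =
              (∑ i, a' i - ∑ i, a i) + t := by rw [sum_localUpdate]; abel
          rw [e1, e2, hEmul, hBmul, ind_and, ind_and, Fin.prod_univ_castSucc]
          simp only [Fin.val_castSucc, Fin.val_last]
          ring
        · exact measurable_const.mul hm'
      · exact (hJm.comp (measurable_const (a := a) |>.prodMk measurable_id)).aemeasurable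
    simp only [gtInt]
    calc _ = ∫⁻ a, ∫⁻ a', ∫⁻ t, J a a' t ∂μ ∂(Measure.pi fun _ => μ) ∂(Measure.pi fun _ => μ) :=
          lintegral_congr step2
      _ = ∫⁻ a', ∫⁻ a, ∫⁻ t, J a a' t ∂μ ∂(Measure.pi fun _ => μ) ∂(Measure.pi fun _ => μ) := by
          rw [lintegral_lintegral_swap]
          refine Measurable.aemeasurable ?_
          exact Measurable.lintegral_prod_right' (f := fun p : ((Fin N → R) × (Fin N → R)) × R =>
            J p.1.1 p.1.2 p.2) (hJm.comp (f := fun p : ((Fin N → R) × (Fin N → R)) × R =>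
              (p.1.1, p.1.2, p.2)) (by fun_prop))
      -- This is the substitution itself; Tonelli before it puts `a'` outside, since the map `(a, t)
      -- ↦ l'` is measure preserving only for fixed `a'`.
      _ = ∫⁻ a', ∫⁻ l', ind (HStrip l l' ∧ Interlaces a' l') * H a' l'
            ∂(Measure.pi fun _ => μ) ∂(Measure.pi fun _ => μ) := by
          refine lintegral_congr fun a' => ?_
          simp only [hJ]
          exact lintegral_localUpdate hadd hsub l a'
            (hHm.comp (measurable_const.prodMk measurable_id))
      _ = ∫⁻ l', ∫⁻ a', ind (HStrip l l' ∧ Interlaces a' l') * H a' l'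
            ∂(Measure.pi fun _ => μ) ∂(Measure.pi fun _ => μ) := by
          rw [lintegral_lintegral_swap]
          refine Measurable.aemeasurable (Measurable.mul (measurable_ind ?_) hHm)
          exact (measurableSet_hStrip measurable_const measurable_snd).inter
            (measurableSet_interlaces measurable_fst measurable_snd)
      _ = _ := by
          refine lintegral_congr fun l' => ?_
          have hm : Measurable fun a' : Fin N → R => ind (Interlaces a' l') *
              E N (∑ i, l' i - ∑ i, a' i) * G a' l' := by
            refine Measurable.mul (Measurable.mul (measurable_ind (measurableSet_interlaces
              measurable_id measurable_const)) ((hE N).comp (by fun_prop))) ?_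
            exact hGm.comp (measurable_id.prodMk measurable_const)
          simp only [← hG]
          rw [← lintegral_const_mul _ hm]
          refine lintegral_congr fun a' => ?_
          simp only [ind_and, hH]
          ring

end GTInt

/-! ### The Markov property of the bottom row -/

section MarkovProperty

variable {R : Type} [AddCommGroup R] [LinearOrder R] [IsOrderedAddMonoid R] [TopologicalSpace R]
  [OrderClosedTopology R] [IsTopologicalAddGroup R] [SecondCountableTopology R]
  [MeasurableSpace R] [BorelSpace R] {N : ℕ}

theorem Measurable.patternProcess {Q : Type*} [MeasurableSpace Q] {x : Q → Triangle N R}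
    {c : Q → ℕ → Fin N → R} (hx : Measurable x) (hc : Measurable c) (n : ℕ) :
    Measurable fun q => patternProcess (x q) (c q) n := by
  induction n with
  | zero => exact hx
  | succ n ih => exact ih.patternInsert ((measurable_pi_apply n).comp hc)

theorem patternProcess_congr (x : Triangle N R) {c c' : ℕ → Fin N → R} {n : ℕ}
    (h : ∀ m < n, c m = c' m) : patternProcess x c n = patternProcess x c' n := by
  induction n with
  | zero => rfl
  | succ n ih => rw [patternProcess, patternProcess, ih fun m hm => h m (by omega), h n (by omega)]

/-- The sequence `c`, replaced by `0` from the index `n` on. -/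
def truncSeq {S : Type*} [Zero S] (n : ℕ) (c : ℕ → S) : ℕ → S := fun j => if j < n then c j else 0

theorem measurable_truncSeq {S : Type*} [Zero S] [MeasurableSpace S] (n : ℕ) :
    Measurable (truncSeq n : (ℕ → S) → ℕ → S) := by
  refine measurable_pi_iff.2 fun j => ?_
  unfold truncSeq
  split_ifs <;> fun_prop

theorem patternProcess_truncSeq (x : Triangle N R) (c : ℕ → Fin N → R) {m n : ℕ} (h : m ≤ n) :
    patternProcess x (truncSeq n c) m = patternProcess x c m :=
  patternProcess_congr x fun j hj => by simp [truncSeq, show j < n by omega]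

/-- The bottom rows up to time `n`, as a sequence that is constant from the index `n` on. -/
def bottomHistory (x : Triangle N R) (c : ℕ → Fin N → R) (n : ℕ) : ℕ → Fin N → R :=
  fun i => bottomRow (patternProcess x c (min i n))

theorem Measurable.bottomHistory {Q : Type*} [MeasurableSpace Q] {x : Q → Triangle N R}
    {c : Q → ℕ → Fin N → R} (hx : Measurable x) (hc : Measurable c) (n : ℕ) :
    Measurable fun q => bottomHistory (x q) (c q) n :=
  measurable_pi_iff.2 fun i => (Measurable.patternProcess hx hc _).bottomRow

theorem bottomHistory_truncSeq (x : Triangle N R) (c : ℕ → Fin N → R) (n : ℕ) :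
    bottomHistory x (truncSeq n c) n = bottomHistory x c n :=
  funext fun i => by rw [bottomHistory, patternProcess_truncSeq x c (min_le_right i n)]; rfl

/-- The sequence that agrees with `h` up to `n` and is equal to `l` afterwards. -/
def extendAfter {S : Type*} (n : ℕ) (h : ℕ → S) (l : S) : ℕ → S := fun i => if i ≤ n then h i else l

theorem bottomHistory_succ (x : Triangle N R) (c : ℕ → Fin N → R) (n : ℕ) :
    bottomHistory x c (n + 1) =
      extendAfter n (bottomHistory x c n) (bottomRow (patternProcess x c (n + 1))) := by
  funext i
  simp only [bottomHistory, extendAfter]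
  split_ifs with h
  · rw [min_eq_left h, min_eq_left (by omega)]
  · rw [min_eq_right (by omega)]

theorem Measurable.extendAfter {S Q : Type*} [MeasurableSpace S] [MeasurableSpace Q] (n : ℕ)
    {h : Q → ℕ → S} {l : Q → S} (hh : Measurable h) (hl : Measurable l) :
    Measurable fun q => extendAfter n (h q) (l q) := by
  refine measurable_pi_iff.2 fun i => ?_
  unfold _root_.extendAfter
  split_ifs <;> fun_prop

variable {μ : Measure R} [SigmaFinite μ] {E : ℕ → R → ℝ≥0∞}

variable (μ E) in
/-- The average of `f` over the random pattern with bottom row `l`. -/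
noncomputable def gtAvg (l : Fin N → R) (f : Triangle N R → ℝ≥0∞) : ℝ≥0∞ :=
  gtInt μ E N l f / gtInt μ E N l 1

theorem gtInt_const (hE : ∀ k, Measurable (E k)) (l : Fin N → R) (c : ℝ≥0∞) :
    gtInt μ E N l (fun _ => c) = c * gtInt μ E N l 1 := by
  rw [← gtInt_const_mul hE l (f := 1) measurable_const]
  simp

/-- Where the mass vanishes, every integral over the same row vanishes too, so the value of the
quotient there is irrelevant. -/
theorem gtAvg_mul_mass (hE : ∀ k, Measurable (E k)) {l : Fin N → R}
    (hfin : gtInt μ E N l 1 ≠ ∞) (f : Triangle N R → ℝ≥0∞) :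
    gtAvg μ E l f * gtInt μ E N l 1 = gtInt μ E N l f := by
  rcases eq_or_ne (gtInt μ E N l 1) 0 with h | h
  · have : gtInt μ E N l f ≤ gtInt μ E N l fun _ => ∞ := gtInt_mono fun _ _ _ => le_top
    rw [gtInt_const hE, h, mul_zero] at this
    rw [h, mul_zero, le_antisymm this zero_le]
  · exact ENNReal.div_mul_cancel h hfin

theorem gtInt_gtAvg (hE : ∀ k, Measurable (E k)) {l : Fin N → R}
    (hfin : gtInt μ E N l 1 ≠ ∞) (f : Triangle N R → ℝ≥0∞) :
    gtInt μ E N l (fun x => gtAvg μ E (bottomRow x) f) = gtInt μ E N l f := by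
  rw [gtInt_congr (g := fun _ => gtAvg μ E l f) fun x _ hx => by rw [hx], gtInt_const hE,
    gtAvg_mul_mass hE hfin]

theorem Measurable.gtAvg (hE : ∀ k, Measurable (E k)) {Q : Type*} [MeasurableSpace Q]
    {l : Q → Fin N → R} {f : Q → Triangle N R → ℝ≥0∞} (hl : Measurable l)
    (hf : Measurable fun p : Q × Triangle N R => f p.1 p.2) :
    Measurable fun q => gtAvg μ E (l q) (f q) :=
  (Measurable.gtInt hE hl hf).div (Measurable.gtInt hE hl measurable_const)

/-- Two random columns are independent and the second has independent entries with the given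
laws. -/
structure IndepColumn {Ω : Type*} [MeasurableSpace Ω] (P : Measure Ω) (c : Ω → ℕ → Fin N → R)
    (n : ℕ) (ν : ℕ → Measure R) : Prop where
  indep : IndepFun (fun ω => truncSeq n (c ω)) (fun ω => c ω n) P
  law : P.map (fun ω => c ω n) = Measure.pi fun k : Fin N => ν k

theorem IndepColumn.lintegral_eq {Ω : Type*} [MeasurableSpace Ω] {P : Measure Ω}
    [IsProbabilityMeasure P] {c : Ω → ℕ → Fin N → R} (hc : Measurable c) {n : ℕ}
    {ν : ℕ → Measure R} [∀ k, SigmaFinite (ν k)] (h : IndepColumn P c n ν)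
    {f : (ℕ → Fin N → R) × (Fin N → R) → ℝ≥0∞} (hf : Measurable f) :
    ∫⁻ ω, f (truncSeq n (c ω), c ω n) ∂P =
      ∫⁻ ω, ∫⁻ ξ, f (truncSeq n (c ω), ξ) ∂(Measure.pi fun k : Fin N => ν k) ∂P := by
  have h1 : Measurable fun ω => truncSeq n (c ω) := (measurable_truncSeq n).comp hc
  have h2 : Measurable fun ω => c ω n := (measurable_pi_apply n).comp hc
  have e := (indepFun_iff_map_prod_eq_prod_map_map h1.aemeasurable h2.aemeasurable).1 h.indep
  rw [h.law] at e
  rw [← lintegral_map (f := f) hf (h1.prodMk h2), e, lintegral_prod _ hf.aemeasurable,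
    lintegral_map (Measurable.lintegral_prod_right' hf) h1]

theorem lintegral_patternProcess_succ {Ω : Type*} [MeasurableSpace Ω] {P : Measure Ω}
    [IsProbabilityMeasure P] {c : Ω → ℕ → Fin N → R} (hc : Measurable c) {n : ℕ}
    {ν : ℕ → Measure R} [∀ k, SigmaFinite (ν k)] (h : IndepColumn P c n ν) (x : Triangle N R)
    {f : (ℕ → Fin N → R) → Triangle N R → ℝ≥0∞}
    (hf : Measurable fun p : (ℕ → Fin N → R) × Triangle N R => f p.1 p.2) :
    ∫⁻ ω, f (bottomHistory x (c ω) n) (patternProcess x (c ω) (n + 1)) ∂P =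
      ∫⁻ ω, ∫⁻ ξ, f (bottomHistory x (c ω) n) (patternInsert (patternProcess x (c ω) n) ξ)
        ∂(Measure.pi fun k : Fin N => ν k) ∂P := by
  have := h.lintegral_eq hc (f := fun p => f (bottomHistory x p.1 n)
    (patternInsert (patternProcess x p.1 n) p.2)) (hf.comp (Measurable.prodMk
      (Measurable.bottomHistory measurable_const measurable_fst n)
      ((Measurable.patternProcess measurable_const measurable_fst n).patternInsert measurable_snd)))
  simpa only [bottomHistory_truncSeq, patternProcess_truncSeq x _ le_rfl, patternProcess] using this

section Main

variable {Ω : Type*} [MeasurableSpace Ω] {P : Measure Ω} [IsProbabilityMeasure P]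
  {c : Ω → ℕ → Fin N → R} {B : ℕ → R → ℝ≥0∞} {C : ℕ → ℕ → ℝ≥0∞} {ν : ℕ → ℕ → Measure R}
  [∀ n k, SigmaFinite (ν n k)]

/-- Given the bottom rows up to time `n`, the pattern at time `n` is distributed as the random
pattern with the bottom row at time `n`. -/
theorem gtInt_lintegral_patternProcess (hadd : ∀ c : R, MeasurePreserving (fun t => c + t) μ μ)
    (hsub : ∀ c : R, MeasurePreserving (fun t => c - t) μ μ) (hE : ∀ k, Measurable (E k))
    (hEmul : ∀ k x y, E k (x + y) = E k x * E k y) (hfin : ∀ l, gtInt μ E N l 1 ≠ ∞)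
    (hc : Measurable c) {n : ℕ} (hB : ∀ m < n, Measurable (B m))
    (hBmul : ∀ m < n, ∀ x y, B m (x + y) = B m x * B m y) (hB0 : ∀ m < n, B m 0 = 1)
    (hν : ∀ m < n, ∀ k < N, ν m k = μ.withDensity fun t => ind (0 ≤ t) * (C m k * (E k t * B m t)))
    (hcol : ∀ m < n, IndepColumn P c m (ν m)) (z : Fin N → R)
    {f : (ℕ → Fin N → R) → Triangle N R → ℝ≥0∞}
    (hf : Measurable fun p : (ℕ → Fin N → R) × Triangle N R => f p.1 p.2) :
    gtInt μ E N z (fun x => ∫⁻ ω, f (bottomHistory x (c ω) n) (patternProcess x (c ω) n) ∂P) =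
    gtInt μ E N z (fun x => ∫⁻ ω, gtAvg μ E (bottomRow (patternProcess x (c ω) n))
      (f (bottomHistory x (c ω) n)) ∂P) := by
  induction n generalizing f with
  | zero =>
    have e : ∀ (x : Triangle N R) ω, bottomHistory x (c ω) 0 = fun _ => bottomRow x :=
      fun x ω => funext fun i => by simp [bottomHistory, patternProcess]
    simp only [e, patternProcess, lintegral_const, measure_univ, mul_one]
    rw [gtInt_congr (g := fun x => f (fun _ => z) x) fun x _ hx => by rw [hx],
      gtInt_congr (f := fun x => gtAvg μ E (bottomRow x) (f fun _ => bottomRow x))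
      (g := fun x => gtAvg μ E (bottomRow x) (f fun _ => z)) fun x _ hx => by rw [hx],
      gtInt_gtAvg hE (hfin z)]
  | succ n ih =>
    have hfm : ∀ h, Measurable (f h) := fun h => hf.comp (measurable_const.prodMk measurable_id)
    -- The one-step formula sees `g` only through its integrals over the patterns with bottom row
    -- `l'`. Replacing `f` by its average leaves these unchanged, so both sides of the claim are
    -- equal.
    have step : ∀ {g : (ℕ → Fin N → R) → Triangle N R → ℝ≥0∞}
        (hg : Measurable fun p : (ℕ → Fin N → R) × Triangle N R => g p.1 p.2),
        gtInt μ E N z (fun x => ∫⁻ ω, g (bottomHistory x (c ω) (n + 1))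
          (patternProcess x (c ω) (n + 1)) ∂P) =
        gtInt μ E N z (fun x => ∫⁻ ω, (∫⁻ l', ind (HStrip (bottomRow (patternProcess x (c ω) n)) l') *
          ((∏ k : Fin N, C n k) * B n (∑ i, l' i - ∑ i, bottomRow (patternProcess x (c ω) n) i)) *
          gtInt μ E N l' (g (extendAfter n (bottomHistory x (c ω) n) l'))
            ∂(Measure.pi fun _ => μ)) / gtInt μ E N (bottomRow (patternProcess x (c ω) n)) 1 ∂P) := by
      intro g hg
      have hg' : Measurable fun p : (ℕ → Fin N → R) × Triangle N R =>
          g (extendAfter n p.1 (bottomRow p.2)) p.2 :=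
        hg.comp ((Measurable.extendAfter n measurable_fst
          (Measurable.bottomRow measurable_snd)).prodMk measurable_snd)
      have e1 : ∀ x, ∫⁻ ω, g (bottomHistory x (c ω) (n + 1)) (patternProcess x (c ω) (n + 1)) ∂P =
          ∫⁻ ω, ∫⁻ ξ, g (extendAfter n (bottomHistory x (c ω) n)
            (bottomRow (patternInsert (patternProcess x (c ω) n) ξ)))
            (patternInsert (patternProcess x (c ω) n) ξ)
            ∂(Measure.pi fun k : Fin N => ν n k) ∂P := by
        intro x
        simp only [bottomHistory_succ]
        exact lintegral_patternProcess_succ hc (hcol n (by omega)) x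
          (f := fun h y => g (extendAfter n h (bottomRow y)) y) hg'
      simp only [e1]
      have hins : Measurable fun p : ((ℕ → Fin N → R) × Triangle N R) × (Fin N → R) =>
          patternInsert p.1.2 p.2 := Measurable.patternInsert (by fun_prop) (by fun_prop)
      have hm : Measurable fun p : ((ℕ → Fin N → R) × Triangle N R) × (Fin N → R) =>
          g (extendAfter n p.1.1 (bottomRow (patternInsert p.1.2 p.2))) (patternInsert p.1.2 p.2) :=
        hg'.comp (Measurable.prodMk (by fun_prop) hins)
      -- The induction hypothesis is used for the expectation over the new column, which is again a
      -- function of the history and of the pattern at time `n`.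
      refine (ih (fun m hm => hB m (by omega)) (fun m hm => hBmul m (by omega))
        (fun m hm => hB0 m (by omega)) (fun m hm => hν m (by omega))
        (fun m hm => hcol m (by omega)) (f := fun h y => ∫⁻ ξ, g (extendAfter n h
          (bottomRow (patternInsert y ξ))) (patternInsert y ξ)
          ∂(Measure.pi fun k : Fin N => ν n k)) (Measurable.lintegral_prod_right' hm)).trans ?_
      refine gtInt_congr fun x _ _ => lintegral_congr fun ω => ?_
      rw [gtAvg]
      congr 1
      have hg'' : Measurable fun y => g (extendAfter n (bottomHistory x (c ω) n) (bottomRow y)) y :=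
        hg'.comp (measurable_const.prodMk measurable_id)
      refine (gtInt_patternInsert hadd hsub hE hEmul (hB n (by omega)) (hBmul n (by omega))
        (hB0 n (by omega)) (hν n (by omega)) (bottomRow (patternProcess x (c ω) n)) hg'').trans ?_
      refine lintegral_congr fun l' => ?_
      congr 1
      exact gtInt_congr fun y _ hy => by rw [hy]
    rw [step hf]
    rw [step (g := fun h y => gtAvg μ E (bottomRow y) (f h)) (Measurable.gtAvg hE
      (Measurable.bottomRow measurable_snd) (hf.comp (f := fun p :
        ((ℕ → Fin N → R) × Triangle N R) × Triangle N R => (p.1.1, p.2)) (by fun_prop)))]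
    refine gtInt_congr fun x _ _ => lintegral_congr fun ω => ?_
    simp only [gtInt_gtAvg hE (hfin _)]

/-- The bottom row is a Markov chain, started from a random pattern with bottom row `z`. -/
theorem gtInt_markov (hadd : ∀ c : R, MeasurePreserving (fun t => c + t) μ μ)
    (hsub : ∀ c : R, MeasurePreserving (fun t => c - t) μ μ) (hE : ∀ k, Measurable (E k))
    (hEmul : ∀ k x y, E k (x + y) = E k x * E k y) (hfin : ∀ l, gtInt μ E N l 1 ≠ ∞)
    (hc : Measurable c) {n : ℕ} (hB : ∀ m ≤ n, Measurable (B m))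
    (hBmul : ∀ m ≤ n, ∀ x y, B m (x + y) = B m x * B m y) (hB0 : ∀ m ≤ n, B m 0 = 1)
    (hν : ∀ m ≤ n, ∀ k < N, ν m k = μ.withDensity fun t => ind (0 ≤ t) * (C m k * (E k t * B m t)))
    (hcol : ∀ m ≤ n, IndepColumn P c m (ν m)) (z : Fin N → R)
    {g : (ℕ → Fin N → R) → ℝ≥0∞} (hg : Measurable g) {φ : (Fin N → R) → ℝ≥0∞}
    (hφ : Measurable φ) :
    gtInt μ E N z (fun x => ∫⁻ ω, g (bottomHistory x (c ω) n) *
      φ (bottomRow (patternProcess x (c ω) (n + 1))) ∂P) =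
    gtInt μ E N z (fun x => ∫⁻ ω, g (bottomHistory x (c ω) n) *
      ((∫⁻ l', ind (HStrip (bottomRow (patternProcess x (c ω) n)) l') *
        ((∏ k : Fin N, C n k) * B n (∑ i, l' i - ∑ i, bottomRow (patternProcess x (c ω) n) i)) *
        (φ l' * gtInt μ E N l' 1) ∂(Measure.pi fun _ => μ)) /
        gtInt μ E N (bottomRow (patternProcess x (c ω) n)) 1) ∂P) := by
  have hφb : Measurable fun y : Triangle N R => φ (bottomRow y) :=
    hφ.comp (Measurable.bottomRow measurable_id)
  have e1 : ∀ x, ∫⁻ ω, g (bottomHistory x (c ω) n) *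
      φ (bottomRow (patternProcess x (c ω) (n + 1))) ∂P =
      ∫⁻ ω, ∫⁻ ξ, g (bottomHistory x (c ω) n) *
        φ (bottomRow (patternInsert (patternProcess x (c ω) n) ξ))
        ∂(Measure.pi fun k : Fin N => ν n k) ∂P := fun x =>
    lintegral_patternProcess_succ hc (hcol n le_rfl) x (f := fun h y => g h * φ (bottomRow y))
      ((hg.comp measurable_fst).mul (hφb.comp measurable_snd))
  simp only [e1]
  have hins : Measurable fun p : ((ℕ → Fin N → R) × Triangle N R) × (Fin N → R) =>
      patternInsert p.1.2 p.2 := Measurable.patternInsert (by fun_prop) (by fun_prop)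
  have hm : Measurable fun p : ((ℕ → Fin N → R) × Triangle N R) × (Fin N → R) =>
      g p.1.1 * φ (bottomRow (patternInsert p.1.2 p.2)) :=
    (hg.comp (by fun_prop)).mul (hφb.comp hins)
  -- Averaging the pattern at time `n` given the history of bottom rows leaves, after the
  -- intertwining relation, a kernel that sees only the current bottom row.
  refine (gtInt_lintegral_patternProcess hadd hsub hE hEmul hfin hc (fun m hm => hB m hm.le)
    (fun m hm => hBmul m hm.le) (fun m hm => hB0 m hm.le) (fun m hm => hν m hm.le)
    (fun m hm => hcol m hm.le) z (f := fun h y => ∫⁻ ξ, g h * φ (bottomRow (patternInsert y ξ))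
      ∂(Measure.pi fun k : Fin N => ν n k)) (Measurable.lintegral_prod_right' hm)).trans ?_
  refine gtInt_congr fun x _ _ => lintegral_congr fun ω => ?_
  have hins' : ∀ y : Triangle N R, Measurable fun ξ : Fin N → R =>
      φ (bottomRow (patternInsert y ξ)) := fun y =>
    hφb.comp (Measurable.patternInsert measurable_const measurable_id)
  have hins'' : Measurable fun p : Triangle N R × (Fin N → R) =>
      φ (bottomRow (patternInsert p.1 p.2)) :=
    hφb.comp (Measurable.patternInsert measurable_fst measurable_snd)
  simp only [lintegral_const_mul _ (hins' _)]
  rw [gtAvg, gtInt_const_mul hE _ (Measurable.lintegral_prod_right' hins''), mul_div_assoc]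
  congr 2
  rw [gtInt_patternInsert hadd hsub hE hEmul (hB n le_rfl) (hBmul n le_rfl) (hB0 n le_rfl)
    (hν n le_rfl) _ hφb]
  refine lintegral_congr fun l' => ?_
  congr 1
  rw [← gtInt_const hE]
  exact gtInt_congr fun y _ hy => by rw [hy]

end Main

end MarkovProperty

/-! ### Conditional probabilities given the past of a process -/

section CondExp

/-- Every event of the past is a preimage under the stopped path `fun i => X (min i n)`, so
functions of this one variable suffice as tests. Integrability of `k` along the chain comes from the
tested identity on the whole space. -/
theorem condExp_pastSigma_ae_eq {Ω E : Type*} [MeasurableSpace Ω] [MeasurableSpace E]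
    {P : Measure Ω} [IsProbabilityMeasure P] {X : ℕ → Ω → E} (hX : ∀ n, Measurable (X n)) (n : ℕ)
    {B : Set E} (hB : MeasurableSet B) {k : E → ℝ} (hk : Measurable k)
    (hk0 : ∀ᵐ ω ∂P, 0 ≤ k (X n ω))
    (h : ∀ g : (ℕ → E) → ℝ≥0∞, Measurable g →
      ∫⁻ ω, g (fun i => X (min i n) ω) * B.indicator 1 (X (n + 1) ω) ∂P =
        ∫⁻ ω, g (fun i => X (min i n) ω) * ENNReal.ofReal (k (X n ω)) ∂P) :
    P⟦X (n + 1) ⁻¹' B | pastSigma X n⟧ =ᵐ[P] fun ω => k (X n ω) := by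
  have hm : pastSigma X n ≤ (inferInstance : MeasurableSpace Ω) :=
    iSup₂_le fun i _ => (hX i).comap_le
  have hle : pastSigma X n ≤ MeasurableSpace.comap (fun ω i => X (min i n) ω) inferInstance := by
    refine iSup₂_le fun i hi => ?_
    rintro _ ⟨t, ht, rfl⟩
    refine ⟨(fun f => f i) ⁻¹' t, measurable_pi_apply i ht, ?_⟩
    ext ω
    simp [min_eq_left hi]
  have hXn : Measurable[pastSigma X n] (X n) :=
    (comap_measurable (X n)).mono (le_iSup₂_of_le n le_rfl le_rfl) le_rfl
  have hS : MeasurableSet (X (n + 1) ⁻¹' B) := hX (n + 1) hB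
  have hkm : Measurable fun ω => k (X n ω) := hk.comp (hX n)
  have hset : ∀ A, MeasurableSet[pastSigma X n] A →
      ∫⁻ ω in A, ENNReal.ofReal (k (X n ω)) ∂P = P (X (n + 1) ⁻¹' B ∩ A) := by
    intro A hA
    obtain ⟨C, hC, rfl⟩ := hle A hA
    have := h (C.indicator 1) (measurable_one.indicator hC)
    have e1 : ∀ (u : Ω → ℝ≥0∞), ∫⁻ ω, C.indicator 1 (fun i => X (min i n) ω) * u ω ∂P =
        ∫⁻ ω in (fun ω i => X (min i n) ω) ⁻¹' C, u ω ∂P := by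
      intro u
      rw [← lintegral_indicator (hm _ hA)]
      refine lintegral_congr fun ω => ?_
      by_cases hω : (fun i => X (min i n) ω) ∈ C
      · simp [Set.indicator, hω]
      · simp [Set.indicator, hω]
    rw [e1, e1] at this
    rw [← this]
    have e2 : ∀ ω, B.indicator (1 : E → ℝ≥0∞) (X (n + 1) ω) =
        (X (n + 1) ⁻¹' B).indicator 1 ω := fun ω => rfl
    simp only [e2]
    rw [lintegral_indicator_one hS, Measure.restrict_apply hS]
  have hint : Integrable (fun ω => k (X n ω)) P := by
    refine ⟨hkm.aestronglyMeasurable, ?_⟩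
    rw [hasFiniteIntegral_iff_ofReal hk0]
    have := hset Set.univ MeasurableSet.univ
    rw [Measure.restrict_univ] at this
    rw [this]
    exact measure_lt_top _ _
  refine (ae_eq_condExp_of_forall_setIntegral_eq hm ?_ (fun A _ _ => hint.integrableOn) ?_ ?_).symm
  · exact (integrable_const _).indicator hS
  · intro A hA _
    rw [integral_eq_lintegral_of_nonneg_ae (ae_restrict_of_ae hk0)
      hkm.aestronglyMeasurable, hset A hA, setIntegral_indicator hS]
    simp [Measure.real, Set.inter_comm]
  · exact (hk.comp hXn).aestronglyMeasurable

end CondExp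

/-! ### Columns of an independent array -/

section Independence

variable {N : ℕ}

/-- The columns of an array of independent variables are independent. -/
theorem indepColumn_of_iIndepFun {R : Type} [AddCommGroup R] [LinearOrder R]
    [MeasurableSpace R] {Ω : Type*} [MeasurableSpace Ω] {P : Measure Ω}
    [IsProbabilityMeasure P] {V : Fin N → ℕ → Ω → R} (hVm : ∀ i j, Measurable (V i j))
    (hV : iIndepFun (fun p : Fin N × ℕ => V p.1 p.2) P) (n : ℕ) {ν : ℕ → Measure R}
    (hν : ∀ i : Fin N, P.map (V i n) = ν i) :
    IndepColumn P (fun ω j i => V i j ω) n ν := by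
  constructor
  · have h := iIndepFun.indepFun_finset (Finset.univ ×ˢ Finset.range n)
      (Finset.univ ×ˢ {n}) (by
        rw [Finset.disjoint_left]
        rintro ⟨i, j⟩ h1 h2
        simp only [Finset.mem_product, Finset.mem_univ, true_and, Finset.mem_range,
          Finset.mem_singleton] at h1 h2
        omega) hV (fun p => hVm p.1 p.2)
    have h1 : Measurable fun (u : ((Finset.univ ×ˢ Finset.range n : Finset (Fin N × ℕ)) : Type) → R)
        (j : ℕ) (i : Fin N) => if hj : j < n then u ⟨(i, j), by simp [hj]⟩ else 0 := by
      refine measurable_pi_iff.2 fun j => measurable_pi_iff.2 fun i => ?_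
      split_ifs <;> fun_prop
    have h2 : Measurable fun (u : ((Finset.univ ×ˢ {n} : Finset (Fin N × ℕ)) : Type) → R)
        (i : Fin N) => u ⟨(i, n), by simp⟩ := by fun_prop
    convert h.comp h1 h2 using 1
    funext ω j
    simp only [truncSeq, Function.comp]
    split_ifs with hj
    · funext i
      simp
    · rfl
    · rfl
  · have h := hV.precomp (g := fun i : Fin N => (i, n)) (fun i j hij => by simpa using hij)
    have h' := (iIndepFun_iff_map_fun_eq_pi_map (fun i => (hVm i n).aemeasurable)).1 h
    rw [h']
    congr 1
    funext i
    exact hν i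

end Independence

/-! ### Schur polynomials -/

section Schur

variable {N : ℕ}

theorem pi_count : (Measure.pi fun _ : Fin N => (Measure.count : Measure ℤ)) = Measure.count := by
  refine Measure.ext_of_singleton fun a => ?_
  rw [Measure.pi_singleton]
  simp

theorem levelSum_triSnoc (x : Triangle N ℤ) (l : Fin (N + 1) → ℤ) {k : ℕ} (hk : k ≤ N) :
    levelSum (triSnoc x l) k = levelSum x k := by
  cases k with
  | zero => rfl
  | succ k =>
    have h1 : k < N := hk
    have h2 : k < N + 1 := by omega
    simp only [levelSum, h1, h2, dif_pos]
    exact congrArg (fun f : Fin (k + 1) → ℤ => ∑ i, f i) (triSnoc_castSucc x l ⟨k, h1⟩)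

theorem levelSum_self (x : Triangle N ℤ) : levelSum x N = ∑ i, bottomRow x i := by
  cases N with
  | zero => simp [levelSum]
  | succ N =>
    simp only [levelSum, lt_add_iff_pos_right, zero_lt_one, dif_pos]
    rfl

theorem levelSum_triSnoc_self (x : Triangle N ℤ) (l : Fin (N + 1) → ℤ) :
    levelSum (triSnoc x l) (N + 1) = ∑ i, l i := by
  rw [levelSum_self, bottomRow_triSnoc]

theorem Interlaces.finite (l : Fin (N + 1) → ℤ) : {a : Fin N → ℤ | Interlaces a l}.Finite := by
  refine (Set.finite_Icc (fun i : Fin N => l i.succ) fun i => l i.castSucc).subset fun a ha => ?_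
  exact ⟨fun i => (ha i).1, fun i => (ha i).2⟩

theorem finite_isGTPattern (l : Fin N → ℤ) :
    {x : Triangle N ℤ | IsGTPattern x ∧ bottomRow x = l}.Finite := by
  induction N with
  | zero => exact Set.toFinite _
  | succ N ih =>
    refine (((Interlaces.finite l).biUnion fun a _ => ih a).image fun x => triSnoc x l).subset ?_
    rintro x ⟨hx, rfl⟩
    rw [isGTPattern_succ_iff] at hx
    refine ⟨triInit x, ?_, triSnoc_triInit x⟩
    simp only [Set.mem_iUnion]
    exact ⟨_, hx.2, hx.1, rfl⟩

/-- A pattern with `N + 1` levels is the pair of its first `N` levels and its last one. The nested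
sums therefore visit each pattern exactly once. -/
theorem gtInt_count (E : ℕ → ℤ → ℝ≥0∞) (l : Fin N → ℤ) (f : Triangle N ℤ → ℝ≥0∞) :
    gtInt Measure.count E N l f = ∑' x : Triangle N ℤ, ind (IsGTPattern x ∧ bottomRow x = l) *
      ((∏ k : Fin N, E k (levelSum x (k.1 + 1) - levelSum x k.1)) * f x) := by
  induction N with
  | zero =>
    rw [tsum_eq_single (fun k => k.elim0) fun x hx => (hx (funext fun k => k.elim0)).elim]
    rw [ind_of ⟨fun k hk => by omega, Subsingleton.elim _ _⟩]
    simp [gtInt]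
  | succ N ih =>
    let e : Triangle (N + 1) ℤ ≃ Triangle N ℤ × (Fin (N + 1) → ℤ) :=
      { toFun := fun x => (triInit x, x (Fin.last N))
        invFun := fun p => triSnoc p.1 p.2
        left_inv := fun x => triSnoc_triInit x
        right_inv := fun p => by simp }
    rw [← e.symm.tsum_eq, Summable.tsum_prod' ENNReal.summable fun _ => ENNReal.summable]
    have hprod : ∀ (x : Triangle N ℤ) (l : Fin (N + 1) → ℤ),
        ∏ k : Fin (N + 1), E k (levelSum (triSnoc x l) (k.1 + 1) - levelSum (triSnoc x l) k.1) =
        (∏ k : Fin N, E k (levelSum x (k.1 + 1) - levelSum x k.1)) *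
          E N (∑ i, l i - ∑ i, bottomRow x i) := by
      intro x l
      rw [Fin.prod_univ_castSucc]
      congr 1
      · refine Finset.prod_congr rfl fun k _ => ?_
        rw [Fin.val_castSucc, levelSum_triSnoc x l (by omega), levelSum_triSnoc x l (by omega)]
      · rw [Fin.val_last, levelSum_triSnoc_self, levelSum_triSnoc x l le_rfl, levelSum_self]
    have h1 : ∀ x : Triangle N ℤ, ∑' l', ind (IsGTPattern (e.symm (x, l')) ∧
        bottomRow (e.symm (x, l')) = l) * ((∏ k : Fin (N + 1), E k
        (levelSum (e.symm (x, l')) (k.1 + 1) - levelSum (e.symm (x, l')) k.1)) *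
          f (e.symm (x, l'))) =
        ind (IsGTPattern x ∧ Interlaces (bottomRow x) l) *
        ((∏ k : Fin N, E k (levelSum x (k.1 + 1) - levelSum x k.1)) *
          E N (∑ i, l i - ∑ i, bottomRow x i) * f (triSnoc x l)) := by
      intro x
      change ∑' l', ind (IsGTPattern (triSnoc x l') ∧ bottomRow (triSnoc x l') = l) *
        ((∏ k : Fin (N + 1), E k (levelSum (triSnoc x l') (k.1 + 1) -
          levelSum (triSnoc x l') k.1)) * f (triSnoc x l')) = _
      rw [tsum_eq_single l]
      · rw [hprod, isGTPattern_triSnoc_iff]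
        simp
      · intro l' hl'
        rw [ind_of_not (by simp [hl']), zero_mul]
    simp only [h1]
    rw [gtInt, pi_count, lintegral_count]
    simp only [ih]
    simp only [← ENNReal.tsum_mul_left]
    rw [ENNReal.tsum_comm]
    refine tsum_congr fun x => ?_
    rw [tsum_eq_single (bottomRow x)]
    · simp only [ind_and, ind_of True.intro]
      ring
    · intro a ha
      rw [ind_of_not (p := IsGTPattern x ∧ bottomRow x = a) (by simp [ha.symm])]
      simp

/-- The weight `a ^ m`, with exponents in `ℤ`. -/
noncomputable def zpowWeight (a : ℝ) (m : ℤ) : ℝ≥0∞ := ENNReal.ofReal (a ^ m)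

theorem zpowWeight_add {a : ℝ} (ha : 0 < a) (m n : ℤ) :
    zpowWeight a (m + n) = zpowWeight a m * zpowWeight a n := by
  rw [zpowWeight, zpow_add₀ ha.ne', ENNReal.ofReal_mul (zpow_pos ha m).le]
  rfl

theorem gtInt_one_eq_schur {a : ℕ → ℝ} (ha : ∀ k, 0 < a k) (l : Fin N → ℤ) :
    gtInt Measure.count (fun k => zpowWeight (a k)) N l 1 =
      ENNReal.ofReal (schur (fun k => a k) l) := by
  have : Fintype {x : Triangle N ℤ // IsGTPattern x ∧ bottomRow x = l} :=
    (finite_isGTPattern l).fintype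
  have hpos : ∀ x : Triangle N ℤ, 0 ≤ patternWeight (fun k : Fin N => a k) x := fun x =>
    Finset.prod_nonneg fun k _ => (zpow_pos (ha k) _).le
  rw [gtInt_count, schur, finsum_eq_sum_of_fintype, ENNReal.ofReal_sum_of_nonneg fun x _ => hpos x.1,
    ← tsum_fintype (L := .unconditional _)]
  refine Eq.trans ?_ (tsum_subtype {x : Triangle N ℤ | IsGTPattern x ∧ bottomRow x = l}
      (fun x => ENNReal.ofReal (patternWeight (fun k : Fin N => a k) x))).symm
  refine tsum_congr fun x => ?_
  by_cases hx : IsGTPattern x ∧ bottomRow x = l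
  · rw [ind_of hx, Set.indicator_of_mem (show x ∈ {x : Triangle N ℤ | IsGTPattern x ∧ bottomRow x = l} from hx), one_mul, patternWeight,
      ENNReal.ofReal_prod_of_nonneg fun k _ =>
        (zpow_pos (ha k.1) (levelSum x (k.1 + 1) - levelSum x k.1)).le]
    simp [zpowWeight]
  · rw [ind_of_not hx, Set.indicator_of_notMem (show x ∉ {x : Triangle N ℤ | IsGTPattern x ∧ bottomRow x = l} from hx), zero_mul]

/-- The initial segments of `l` serve as levels. -/
theorem exists_isGTPattern {l : Fin N → ℤ} (hl : Antitone l) :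
    ∃ x : Triangle N ℤ, IsGTPattern x ∧ bottomRow x = l := by
  induction N with
  | zero => exact ⟨fun k => k.elim0, fun k hk => by omega, Subsingleton.elim _ _⟩
  | succ N ih =>
    obtain ⟨x, hx, hb⟩ := ih (l := fun i => l i.castSucc)
      fun i j hij => hl (Fin.castSucc_le_castSucc_iff.2 hij)
    refine ⟨triSnoc x l, (isGTPattern_triSnoc_iff x l).2 ⟨hx, ?_⟩, bottomRow_triSnoc x l⟩
    rw [hb]
    exact fun i => ⟨hl (Fin.castSucc_lt_succ).le, le_rfl⟩

theorem schur_pos {a : Fin N → ℝ} (ha : ∀ k, 0 < a k) {l : Fin N → ℤ} (hl : Antitone l) :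
    0 < schur a l := by
  have : Fintype {x : Triangle N ℤ // IsGTPattern x ∧ bottomRow x = l} :=
    (finite_isGTPattern l).fintype
  obtain ⟨x, hx⟩ := exists_isGTPattern hl
  rw [schur, finsum_eq_sum_of_fintype]
  exact Finset.sum_pos (fun y _ => Finset.prod_pos fun k _ => zpow_pos (ha k) _)
    ⟨⟨x, hx⟩, Finset.mem_univ _⟩

end Schur

/-! ### Entry bounds for patterns and the two forms of interlacing -/

/-- Interlacing squeezes every entry between two entries of the next level. In particular, a pattern
with bottom row zero is zero. -/
theorem IsGTPattern.abs_entry_le {R : Type*} [AddCommGroup R] [LinearOrder R] [IsOrderedAddMonoid R]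
    {N : ℕ} {x : Triangle N R} (hx : IsGTPattern x) {r : R} (h : ∀ i, |bottomRow x i| ≤ r)
    (k : Fin N) (i : Fin (k.1 + 1)) : |x k i| ≤ r := by
  induction N with
  | zero => exact k.elim0
  | succ N ih =>
    rw [isGTPattern_succ_iff] at hx
    induction k using Fin.lastCases with
    | last => exact h i
    | cast k =>
      refine ih hx.1 (fun j => abs_le.2 ⟨?_, ?_⟩) k i
      · exact (abs_le.1 (h _)).1.trans (hx.2 j).1
      · exact (hx.2 j).2.trans (abs_le.1 (h _)).2

theorem hStrip_iff {N : ℕ} {l l' : Fin N → ℤ} (hl : ∀ i, 0 ≤ l i) :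
    NonnegInterlace l l' ↔ HStrip l l' := by
  constructor
  · rintro ⟨_, h1, h2⟩
    exact ⟨h1, fun i j hij => h2 i j (by rw [Fin.lt_def]; omega)⟩
  · intro h
    refine ⟨hl, h.1, fun i j hij => ?_⟩
    have hi : i.1 + 1 < N := by have : i.1 < j.1 := hij; omega
    exact (h.antitone.2 (show (⟨i.1 + 1, hi⟩ : Fin N) ≤ j from hij)).trans (h.2 i ⟨_, hi⟩ rfl)

/-! ### RSK with geometric input -/

section Geometric

variable {N : ℕ} {Ω : Type*} [MeasurableSpace Ω] {P : Measure Ω} [IsProbabilityMeasure P]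

/-- With geometric input, the bottom rows are a Markov chain with the Schur transition
probabilities. -/
theorem condExp_bottomRow_rskPattern {ξ : Fin N → ℕ → Ω → ℕ} (hξm : ∀ i j, Measurable (ξ i j))
    (hξ : iIndepFun (fun p : Fin N × ℕ => ξ p.1 p.2) P) {a : Fin N → ℝ} {b : ℕ → ℝ} {n : ℕ}
    (ha : ∀ i, 0 < a i) (hb : ∀ j ≤ n, 0 < b j) (hab : ∀ i, ∀ j ≤ n, a i * b j < 1)
    (hlaw : ∀ i, ∀ j ≤ n, ∀ m : ℕ, P {ω | ξ i j ω = m} =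
      ENNReal.ofReal ((1 - a i * b j) * (a i * b j) ^ m)) (x' : Fin N → ℤ) :
    P⟦(fun ω => bottomRow (rskPattern (fun i j => (ξ i j ω : ℤ)) (n + 1))) ⁻¹' {x'} |
      pastSigma (fun m ω => bottomRow (rskPattern (fun i j => (ξ i j ω : ℤ)) m)) n⟧
      =ᵐ[P] fun ω => schurTransition a (b n)
        (bottomRow (rskPattern (fun i j => (ξ i j ω : ℤ)) n)) x' := by
  let c : Ω → ℕ → Fin N → ℤ := fun ω j i => ξ i j ω
  have hc0 : ∀ ω j i, 0 ≤ c ω j i := fun ω j i => Int.natCast_nonneg _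
  have hcast : Measurable fun m : ℕ => (m : ℤ) := measurable_from_top
  have hVm : ∀ i j, Measurable fun ω => (ξ i j ω : ℤ) := fun i j => hcast.comp (hξm i j)
  have hc : Measurable c := measurable_pi_iff.2 fun j => measurable_pi_iff.2 fun i => hVm i j
  have hrsk : ∀ ω m, rskPattern (fun i j => (ξ i j ω : ℤ)) m = patternProcess 0 (c ω) m := fun ω m =>
    rskPattern_eq_patternProcess (fun i j => Int.natCast_nonneg _) m
  have hGT0 : IsGTPattern (0 : Triangle N ℤ) := fun _ _ _ _ => ⟨le_rfl, le_rfl⟩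
  have hGT : ∀ ω m, IsGTPattern (patternProcess 0 (c ω) m) := fun ω m =>
    patternProcess_isGTPattern hGT0 (hc0 ω) m
  have hnonneg : ∀ ω m i, 0 ≤ bottomRow (patternProcess 0 (c ω) m) i := fun ω m i => by
    rw [← hrsk]
    exact (rskTableau_isTableau (extendRows_nonneg fun i j => Int.natCast_nonneg _) m).nonneg _ _
  simp only [hrsk]
  have hXm : ∀ m, Measurable fun ω => bottomRow (patternProcess 0 (c ω) m) := fun m =>
    (Measurable.patternProcess measurable_const hc m).bottomRow
  -- The weights of `gtInt` are indexed by `ℕ`; the value `1` beyond `N` only keeps them positive.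
  let a' : ℕ → ℝ := fun k => if h : k < N then a ⟨k, h⟩ else 1
  have ha' : ∀ k, 0 < a' k := fun k => by
    simp only [a']
    split_ifs
    · exact ha _
    · exact one_pos
  have haa : ∀ i : Fin N, a' i = a i := fun i => by simp [a']
  let E : ℕ → ℤ → ℝ≥0∞ := fun k => zpowWeight (a' k)
  let B : ℕ → ℤ → ℝ≥0∞ := fun j => zpowWeight (b j)
  let C : ℕ → ℕ → ℝ≥0∞ := fun j k => ENNReal.ofReal (1 - a' k * b j)
  let ν : ℕ → ℕ → Measure ℤ := fun j k =>
    Measure.count.withDensity fun t => ind (0 ≤ t) * (C j k * (E k t * B j t))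
  have hνfin : ∀ j k, SigmaFinite (ν j k) := fun j k => by
    refine SigmaFinite.withDensity_of_ne_top' fun t => ENNReal.mul_ne_top ?_
      (ENNReal.mul_ne_top ENNReal.ofReal_ne_top
        (ENNReal.mul_ne_top ENNReal.ofReal_ne_top ENNReal.ofReal_ne_top))
    unfold ind
    split_ifs <;> simp
  have hΦ : ∀ l : Fin N → ℤ, gtInt Measure.count E N l 1 = ENNReal.ofReal (schur a l) := fun l => by
    rw [gtInt_one_eq_schur ha']
    simp only [haa]
  have hVlaw : ∀ j ≤ n, ∀ i : Fin N, P.map (fun ω => (ξ i j ω : ℤ)) = ν j i := by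
    intro j hj i
    refine Measure.ext_of_singleton fun t => ?_
    rw [Measure.map_apply (hVm i j) (measurableSet_singleton t),
      withDensity_apply _ (measurableSet_singleton t), ← lintegral_indicator
        (measurableSet_singleton t), lintegral_count, tsum_eq_single t (by
          intro s hs; simp [hs])]
    rw [Set.indicator_of_mem (Set.mem_singleton t)]
    by_cases ht : 0 ≤ t
    · lift t to ℕ using ht
      have e : (fun ω => (ξ i j ω : ℤ)) ⁻¹' {(t : ℤ)} = {ω | ξ i j ω = t} := by
        ext ω; simp
      rw [e, hlaw i j hj, ind_of (Int.natCast_nonneg t), one_mul]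
      simp only [C, E, B, zpowWeight, haa]
      rw [← ENNReal.ofReal_mul (by positivity [ha i]), ← ENNReal.ofReal_mul (by linarith [hab i j hj])]
      simp [mul_pow]
    · have e : (fun ω => (ξ i j ω : ℤ)) ⁻¹' {t} = ∅ := by
        ext ω
        simp only [Set.mem_preimage, Set.mem_singleton_iff, Set.mem_empty_iff_false, iff_false]
        have := Int.natCast_nonneg (ξ i j ω)
        omega
      rw [e, ind_of_not ht]
      simp
  have hcol : ∀ j ≤ n, IndepColumn P c j (ν j) := fun j hj =>
    indepColumn_of_iIndepFun (V := fun i j ω => (ξ i j ω : ℤ)) hVm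
      (hξ.comp (fun _ m => (m : ℤ)) fun _ => hcast) j (hVlaw j hj)
  -- The zero pattern is the only one above the zero row, so the random initial pattern is
  -- deterministic and its mass can be cancelled at the end.
  have hdet : ∀ G : Triangle N ℤ → ℝ≥0∞,
      gtInt Measure.count E N 0 G = G 0 * ENNReal.ofReal (schur a 0) := by
    intro G
    rw [← hΦ, ← gtInt_const (fun _ => .of_discrete)]
    refine gtInt_congr fun x hx hx0 => ?_
    congr 1
    funext k i
    simpa using hx.abs_entry_le (r := 0) (by simp [hx0]) k i
  have hmass0 : ENNReal.ofReal (schur a 0) ≠ 0 := by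
    simpa using schur_pos ha (l := 0) fun _ _ _ => le_rfl
  have hC : ∏ k : Fin N, C n k = ENNReal.ofReal (∏ i, (1 - a i * b n)) := by
    rw [ENNReal.ofReal_prod_of_nonneg fun i _ => by linarith [hab i n le_rfl]]
    simp only [C, haa]
  have htrans : ∀ l : Fin N → ℤ, (∀ i, 0 ≤ l i) → Antitone l →
      0 ≤ schurTransition a (b n) l x' ∧
      (∫⁻ l', ind (HStrip l l') * ((∏ k : Fin N, C n k) * B n (∑ i, l' i - ∑ i, l i)) *
        (Set.indicator {x'} 1 l' * gtInt Measure.count E N l' 1)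
        ∂(Measure.pi fun _ => Measure.count)) / gtInt Measure.count E N l 1 =
      ENNReal.ofReal (schurTransition a (b n) l x') := by
    intro l hl0 hl
    have hs := schur_pos ha hl
    rw [pi_count, lintegral_count, tsum_eq_single x' (by intro l' hl'; simp [hl'])]
    rw [Set.indicator_of_mem (Set.mem_singleton x'), Pi.one_apply, one_mul, hΦ, hΦ,
      schurTransition, hStrip_iff hl0]
    split_ifs with h
    · have hs' := schur_pos ha h.antitone.2
      have h1 : 0 ≤ ∏ i, (1 - a i * b n) :=
        Finset.prod_nonneg fun i _ => by linarith [hab i n le_rfl]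
      have h2 := zpow_pos (hb n le_rfl) (∑ i, (x' i - l i))
      refine ⟨by positivity, ?_⟩
      rw [ind_of h, hC, ← Finset.sum_sub_distrib, one_mul, ENNReal.ofReal_mul (by positivity),
        ENNReal.ofReal_mul h1, ENNReal.ofReal_div_of_pos hs]
      simp only [B, zpowWeight, div_eq_mul_inv]
      ring
    · simp [ind_of_not h]
  refine condExp_pastSigma_ae_eq hXm n (measurableSet_singleton x')
    (k := fun l => schurTransition a (b n) l x') .of_discrete
    (ae_of_all _ fun ω => (htrans _ (hnonneg ω n) (hGT ω n).antitone_bottomRow).1)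
    fun g hg => ?_
  have key := gtInt_markov (μ := (Measure.count : Measure ℤ)) (E := E) (P := P) (c := c) (B := B)
    (C := C) (ν := ν) (measurePreserving_add_left _) (Measure.measurePreserving_sub_left _)
    (fun _ => .of_discrete) (fun k => zpowWeight_add (ha' k))
    (fun l => by rw [hΦ]; exact ENNReal.ofReal_ne_top) hc (n := n) (fun _ _ => .of_discrete)
    (fun m hm => zpowWeight_add (hb m hm)) (fun m _ => by simp [B, zpowWeight])
    (fun m _ k _ => rfl) hcol 0 hg (φ := Set.indicator {x'} 1) .of_discrete
  rw [hdet, hdet] at key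
  have key' := (ENNReal.mul_left_inj hmass0 ENNReal.ofReal_ne_top).1 key
  refine key'.trans (lintegral_congr fun ω => ?_)
  rw [(htrans _ (hnonneg ω n) (hGT ω n).antitone_bottomRow).2]
  rfl

end Geometric

/-! ### Continuity of the function `hFun` -/

section DividedDifferences

/-- The divided difference of the monomial `t ^ m` at the nodes `x 0, …, x i`. -/
def powDD (x : ℕ → ℝ) : ℕ → ℕ → ℝ
  | 0, m => x 0 ^ m
  | _ + 1, 0 => 0
  | i + 1, m + 1 => x (i + 1) * powDD x (i + 1) m + powDD x i m

/-- Newton's interpolation formula for monomials. -/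
theorem pow_eq_sum_powDD (x : ℕ → ℝ) (N m : ℕ) {k : ℕ} (hk : k < N) :
    x k ^ m = ∑ j ∈ Finset.range N, powDD x j m * ∏ l ∈ Finset.range j, (x k - x l) := by
  obtain ⟨M, rfl⟩ : ∃ M, N = M + 1 := ⟨N - 1, by omega⟩
  induction m with
  | zero =>
    rw [Finset.sum_range_succ']
    simp [powDD]
  | succ m ih =>
    rw [pow_succ', ih, Finset.mul_sum, Finset.sum_range_succ' (fun j => powDD x j (m + 1) *
      ∏ l ∈ Finset.range j, (x k - x l))]
    have hM : ∏ l ∈ Finset.range (M + 1), (x k - x l) = 0 :=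
      Finset.prod_eq_zero (Finset.mem_range.2 hk) (sub_self _)
    have e : ∀ j, x k * (powDD x j m * ∏ l ∈ Finset.range j, (x k - x l)) =
        powDD x j m * ∏ l ∈ Finset.range (j + 1), (x k - x l) +
        x j * powDD x j m * ∏ l ∈ Finset.range j, (x k - x l) := fun j => by
      rw [Finset.prod_range_succ]
      ring
    simp only [e, Finset.sum_add_distrib]
    rw [Finset.sum_range_succ, hM, Finset.sum_range_succ' (fun j => x j * powDD x j m *
      ∏ l ∈ Finset.range j, (x k - x l))]
    simp only [powDD, add_mul, Finset.sum_add_distrib, pow_succ']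
    ring

/-- The bound is crude but uniform in the order `i`; together with the factor `1 / m!` it dominates
the series of `expDD`. -/
theorem abs_powDD_le {x : ℕ → ℝ} {r : ℝ} (hr : 0 ≤ r) (hx : ∀ l, |x l| ≤ r) (i m : ℕ) :
    |powDD x i m| ≤ (r + 1) ^ m := by
  induction m generalizing i with
  | zero => cases i <;> simp [powDD]
  | succ m ih =>
    cases i with
    | zero =>
      rw [powDD, abs_pow]
      exact pow_le_pow_left₀ (abs_nonneg _) ((hx 0).trans (by linarith)) _
    | succ i =>
      rw [powDD, pow_succ']
      calc _ ≤ |x (i + 1)| * |powDD x (i + 1) m| + |powDD x i m| := by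
            rw [← abs_mul]; exact abs_add_le _ _
        _ ≤ r * (r + 1) ^ m + (r + 1) ^ m :=
            add_le_add (mul_le_mul (hx _) (ih _) (abs_nonneg _) hr) (ih _)
        _ = _ := by ring

theorem continuous_powDD (i m : ℕ) : Continuous fun x => powDD x i m := by
  induction m generalizing i with
  | zero => cases i <;> simp only [powDD] <;> fun_prop
  | succ m ih =>
    cases i with
    | zero => simp only [powDD]; fun_prop
    | succ i =>
      simp only [powDD]
      exact ((continuous_apply _).mul (ih _)).add (ih _)

theorem powDD_zero (i m : ℕ) : powDD (fun _ => 0) i m = if m = i then 1 else 0 := by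
  induction m generalizing i with
  | zero => cases i <;> simp [powDD]
  | succ m ih => cases i <;> simp [powDD, ih]

theorem powDD_of_lt (x : ℕ → ℝ) {i m : ℕ} (h : m < i) : powDD x i m = 0 := by
  induction m generalizing i with
  | zero => obtain ⟨j, rfl⟩ : ∃ j, i = j + 1 := ⟨i - 1, by omega⟩; rfl
  | succ m ih =>
    obtain ⟨j, rfl⟩ : ∃ j, i = j + 1 := ⟨i - 1, by omega⟩
    rw [powDD, ih (by omega), ih (by omega)]
    ring

theorem powDD_self (x : ℕ → ℝ) (i : ℕ) : powDD x i i = 1 := by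
  induction i with
  | zero => simp [powDD]
  | succ i ih => rw [powDD, powDD_of_lt x (by omega), ih]; ring

/-- The divided difference of `e ^ (-s t)` at the nodes `x 0, …, x i` and `y 0, …, y j`. -/
noncomputable def expDD (x y : ℕ → ℝ) (i j : ℕ) : ℝ :=
  ∑' m : ℕ, (-1) ^ m / (m.factorial : ℝ) * (powDD x i m * powDD y j m)

theorem norm_expDD_term_le {x y : ℕ → ℝ} {r : ℝ} (hr : 0 ≤ r) (hx : ∀ l, |x l| ≤ r)
    (hy : ∀ l, |y l| ≤ r) (i j m : ℕ) :
    ‖(-1) ^ m / (m.factorial : ℝ) * (powDD x i m * powDD y j m)‖ ≤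
      ((r + 1) * (r + 1)) ^ m / m.factorial := by
  rw [norm_mul, norm_mul, norm_div, norm_pow, norm_neg, norm_one, one_pow, mul_pow,
    Real.norm_eq_abs, Real.norm_eq_abs, Real.norm_eq_abs, Nat.abs_cast, one_div, div_eq_inv_mul]
  gcongr
  · exact abs_powDD_le hr hx _ _
  · exact abs_powDD_le hr hy _ _

variable {N : ℕ}

/-- Extension of a vector by zero. -/
def extendZero (x : Fin N → ℝ) : ℕ → ℝ := fun l => if h : l < N then x ⟨l, h⟩ else 0

@[simp] theorem extendZero_val (x : Fin N → ℝ) (i : Fin N) : extendZero x i = x i := by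
  simp [extendZero]

theorem abs_extendZero_le (x : Fin N → ℝ) (l : ℕ) : |extendZero x l| ≤ ‖x‖ := by
  unfold extendZero
  split_ifs with h
  · exact norm_le_pi_norm x _
  · simp

theorem continuous_extendZero : Continuous (extendZero : (Fin N → ℝ) → ℕ → ℝ) := by
  refine continuous_pi fun l => ?_
  unfold extendZero
  split_ifs <;> fun_prop

theorem summable_expDD (x y : Fin N → ℝ) (i j : ℕ) : Summable fun m : ℕ =>
    (-1) ^ m / (m.factorial : ℝ) * (powDD (extendZero x) i m * powDD (extendZero y) j m) :=
  .of_norm_bounded (Real.summable_pow_div_factorial _) fun m =>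
    norm_expDD_term_le (r := max ‖x‖ ‖y‖) (le_max_of_le_left (norm_nonneg _))
      (fun l => (abs_extendZero_le x l).trans (le_max_left _ _))
      (fun l => (abs_extendZero_le y l).trans (le_max_right _ _)) i j m

theorem continuous_expDD (i j : ℕ) : Continuous fun p : (Fin N → ℝ) × (Fin N → ℝ) =>
    expDD (extendZero p.1) (extendZero p.2) i j := by
  rw [continuous_iff_continuousAt]
  intro p
  have h : ContinuousOn (fun p : (Fin N → ℝ) × (Fin N → ℝ) =>
      expDD (extendZero p.1) (extendZero p.2) i j) (Metric.ball 0 (‖p‖ + 1)) := by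
    refine continuousOn_tsum (fun m => Continuous.continuousOn ?_)
      (Real.summable_pow_div_factorial ((‖p‖ + 1 + 1) * (‖p‖ + 1 + 1))) fun m q hq => ?_
    · exact continuous_const.mul (((continuous_powDD i m).comp
        (continuous_extendZero.comp continuous_fst)).mul
        ((continuous_powDD j m).comp (continuous_extendZero.comp continuous_snd)))
    · have hq' : ‖q‖ ≤ ‖p‖ + 1 := by simpa using (Metric.mem_ball.1 hq).le
      exact norm_expDD_term_le (by positivity)
        (fun l => (abs_extendZero_le _ l).trans ((norm_fst_le q).trans hq'))
        (fun l => (abs_extendZero_le _ l).trans ((norm_snd_le q).trans hq')) i j m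
  exact h.continuousAt (Metric.isOpen_ball.mem_nhds (by simp))

/-- Newton interpolation in both variables is applied to each monomial of the exponential series,
and the result is summed. It stays valid when nodes coincide. -/
theorem exp_neg_mul_eq_sum (x y : Fin N → ℝ) (a b : Fin N) :
    Real.exp (-(x a * y b)) = ∑ i : Fin N, ∑ j : Fin N,
      (∏ l ∈ Finset.range i, (x a - extendZero x l)) *
      expDD (extendZero x) (extendZero y) i j *
      (∏ l ∈ Finset.range j, (y b - extendZero y l)) := by
  have h1 : HasSum (fun m : ℕ => (-1) ^ m / (m.factorial : ℝ) * (x a ^ m * y b ^ m))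
      (Real.exp (-(x a * y b))) := by
    rw [Real.exp_eq_exp_ℝ]
    have e : (fun m : ℕ => (-1) ^ m / (m.factorial : ℝ) * (x a ^ m * y b ^ m)) =
        fun m : ℕ => (-(x a * y b)) ^ m / (m.factorial : ℝ) := by
      funext m
      rw [neg_pow (x a * y b), mul_pow (x a)]
      ring
    rw [e]
    exact NormedSpace.expSeries_div_hasSum_exp (-(x a * y b))
  refine h1.unique ?_
  have h2 : ∀ i j : Fin N, HasSum (fun m : ℕ =>
      (∏ l ∈ Finset.range i, (x a - extendZero x l)) *
      ((-1) ^ m / (m.factorial : ℝ) * (powDD (extendZero x) i m * powDD (extendZero y) j m)) *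
      (∏ l ∈ Finset.range j, (y b - extendZero y l)))
      ((∏ l ∈ Finset.range i, (x a - extendZero x l)) *
      expDD (extendZero x) (extendZero y) i j *
      (∏ l ∈ Finset.range j, (y b - extendZero y l))) := fun i j =>
    ((summable_expDD x y i j).hasSum.mul_left _).mul_right _
  convert hasSum_sum fun i (_ : i ∈ Finset.univ) => hasSum_sum fun j (_ : j ∈ Finset.univ) => h2 i j
    using 1
  funext m
  have hx := pow_eq_sum_powDD (extendZero x) N m a.2
  have hy := pow_eq_sum_powDD (extendZero y) N m b.2
  rw [extendZero_val, Finset.sum_range] at hx hy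
  rw [hx, hy, Finset.sum_mul_sum, Finset.mul_sum]
  refine Finset.sum_congr rfl fun i _ => ?_
  rw [Finset.mul_sum]
  refine Finset.sum_congr rfl fun j _ => ?_
  ring

/-- The product `∏ (z_j - z_i)` over the pairs `i < j`. -/
def vandermondePos (z : Fin N → ℝ) : ℝ := ∏ i : Fin N, ∏ j ∈ Finset.Ioi i, (z j - z i)

/-- At its own nodes the Newton basis gives a lower triangular matrix, and the diagonal entries
collect the differences over all pairs. -/
theorem det_newton (x : Fin N → ℝ) :
    (Matrix.of fun a i : Fin N => ∏ l ∈ Finset.range i, (x a - extendZero x l)).det =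
      vandermondePos x := by
  rw [Matrix.det_of_isLowerTriangular]
  · simp only [Matrix.of_apply, vandermondePos]
    rw [Finset.prod_comm' (t' := Finset.univ) (s' := fun j => Finset.Iio j) (by simp)]
    refine Finset.prod_congr rfl fun i _ => ?_
    rw [Finset.prod_range fun l => x i - extendZero x l]
    refine Finset.prod_bij (fun l _ => ⟨l.1, l.2.trans i.2⟩) ?_ ?_ ?_ ?_
    · intro l _; exact Finset.mem_Iio.2 (Fin.lt_def.2 l.2)
    · intro a _ b _ h; simpa [Fin.ext_iff] using h
    · intro b hb
      have hb' : b < i := Finset.mem_Iio.1 hb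
      exact ⟨⟨b.1, hb'⟩, Finset.mem_univ _, rfl⟩
    · intro l _; rw [extendZero, dif_pos (l.2.trans i.2)]
  · intro a i h
    have h' : a < i := h
    refine Finset.prod_eq_zero (Finset.mem_range.2 h') ?_
    simp

/-- The continuous extension of `det (e ^ (-πᵢ z_j)) / (Δ(π) Δ(z))`. -/
noncomputable def hDet (π z : Fin N → ℝ) : ℝ :=
  (Matrix.of fun i j : Fin N => expDD (extendZero π) (extendZero z) i j).det

/-- By `exp_neg_mul_eq_sum` the matrix is the product of the Newton matrix of `π`, the matrix of
divided differences and the transposed Newton matrix of `z`. -/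
theorem det_exp_eq (π z : Fin N → ℝ) :
    (Matrix.of fun i j => Real.exp (-(π i * z j))).det =
      vandermondePos π * hDet π z * vandermondePos z := by
  rw [hDet, ← det_newton π, ← det_newton z, ← Matrix.det_mul,
    ← Matrix.det_transpose (Matrix.of fun a i : Fin N => ∏ l ∈ Finset.range i,
      (z a - extendZero z l)), ← Matrix.det_mul]
  congr 1
  ext a b
  simp only [Matrix.of_apply, Matrix.mul_apply, Matrix.transpose_apply, exp_neg_mul_eq_sum,
    Finset.sum_mul]
  rw [Finset.sum_comm]

theorem continuous_hDet : Continuous fun p : (Fin N → ℝ) × (Fin N → ℝ) => hDet p.1 p.2 :=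
  Continuous.matrix_det (continuous_matrix fun i j => continuous_expDD i j)

/-- At `π = 0` only the term `m = i` survives, and a divided difference of order `j` kills all
powers below `j`, so the matrix is lower triangular. The value does not involve `z`, hence `gtDet 0`
is a constant multiple of the Vandermonde product. -/
theorem hDet_zero (z : Fin N → ℝ) :
    hDet 0 z = ∏ i : Fin N, (-1) ^ (i : ℕ) / ((i : ℕ).factorial : ℝ) := by
  have h0 : extendZero (0 : Fin N → ℝ) = fun _ => 0 := by
    funext l
    simp [extendZero]
  have e : ∀ i j : ℕ, expDD (fun _ => 0) (extendZero z) i j =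
      (-1) ^ i / (i.factorial : ℝ) * powDD (extendZero z) j i := by
    intro i j
    rw [expDD, tsum_eq_single i]
    · rw [powDD_zero, if_pos rfl, one_mul]
    · intro m hm
      rw [powDD_zero, if_neg hm]
      ring
  rw [hDet, Matrix.det_of_isLowerTriangular]
  · simp [h0, e, powDD_self]
  · intro i j h
    have h' : i < j := h
    simp only [Matrix.of_apply, h0, e]
    rw [powDD_of_lt _ h', mul_zero]

/-- Reversing all differences costs the same sign in both factors. -/
theorem vandermondeProd_mul (x y : Fin N → ℝ) :
    vandermondeProd x * vandermondeProd y = vandermondePos x * vandermondePos y := by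
  simp only [vandermondeProd, vandermondePos, ← Finset.prod_mul_distrib]
  refine Finset.prod_congr rfl fun i _ => Finset.prod_congr rfl fun j _ => ?_
  ring

theorem vandermondePos_ne_zero {x : Fin N → ℝ} (hx : Function.Injective x) :
    vandermondePos x ≠ 0 := by
  refine Finset.prod_ne_zero_iff.2 fun i _ => Finset.prod_ne_zero_iff.2 fun j hj => ?_
  rw [sub_ne_zero]
  exact fun h => (Finset.mem_Ioi.1 hj).ne' (hx h)

theorem ae_injective : ∀ᵐ x : Fin N → ℝ, Function.Injective x := by
  have h : ∀ i j : Fin N, i ≠ j → ∀ᵐ x : Fin N → ℝ, x i ≠ x j := by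
    intro i j hij
    let S : Submodule ℝ (Fin N → ℝ) := LinearMap.ker
      ((LinearMap.proj i : (Fin N → ℝ) →ₗ[ℝ] ℝ) - LinearMap.proj j)
    have hS : S ≠ ⊤ := by
      intro h
      have : (Pi.single i 1 : Fin N → ℝ) ∈ S := h ▸ Submodule.mem_top
      simp [S, hij] at this
    have := Measure.addHaar_submodule (volume : Measure (Fin N → ℝ)) S hS
    rw [ae_iff]
    convert this using 2
    ext x
    simp [S, sub_eq_zero]
  have h' : ∀ᵐ x : Fin N → ℝ, ∀ i j : Fin N, i ≠ j → x i ≠ x j :=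
    ae_all_iff.2 fun i => ae_all_iff.2 fun j => by
      by_cases hij : i = j
      · simp [hij]
      · simpa [hij] using h i j hij
  filter_upwards [h'] with x hx i j hij
  by_contra hne
  exact hx i j hne hij

theorem dense_injective : Dense {x : Fin N → ℝ | Function.Injective x} :=
  Measure.dense_of_ae ae_injective

/-- The pairs of injective vectors are dense, and on them the quotient coincides with the continuous
function `hDet`. -/
theorem hFun_eq_hDet (π z : Fin N → ℝ) : hFun π z = hDet π z := by
  refine extendFrom_eq ?_ ?_
  · exact (dense_injective.prod dense_injective) (π, z)
  · have h1 : Tendsto (fun p : (Fin N → ℝ) × (Fin N → ℝ) => hDet p.1 p.2)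
        (𝓝[{p | Function.Injective p.1 ∧ Function.Injective p.2}] (π, z)) (𝓝 (hDet π z)) :=
      (continuous_hDet.tendsto (π, z)).mono_left nhdsWithin_le_nhds
    refine h1.congr' ?_
    filter_upwards [self_mem_nhdsWithin] with p hp
    rw [vandermondeProd_mul, det_exp_eq, eq_div_iff
      (mul_ne_zero (vandermondePos_ne_zero hp.1) (vandermondePos_ne_zero hp.2))]
    ring

end DividedDifferences

/-! ### Determinantal formula for the integral over Gelfand-Tsetlin patterns -/

section GTDet

variable {N : ℕ}

/-- The continuous extension in `π` of `det (e ^ (-πᵢ z_j)) / ∏_{i < j} (π_j - πᵢ)`. -/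
noncomputable def gtDet (π z : Fin N → ℝ) : ℝ := vandermondePos z * hDet π z

theorem gtDet_eq_div {π : Fin N → ℝ} (hπ : Function.Injective π) (z : Fin N → ℝ) :
    gtDet π z = (Matrix.of fun i j => Real.exp (-(π i * z j))).det / vandermondePos π := by
  rw [det_exp_eq, gtDet, eq_div_iff (vandermondePos_ne_zero hπ)]
  ring

theorem continuous_vandermondePos : Continuous (vandermondePos : (Fin N → ℝ) → ℝ) := by
  unfold vandermondePos
  fun_prop

theorem continuous_gtDet : Continuous fun p : (Fin N → ℝ) × (Fin N → ℝ) => gtDet p.1 p.2 :=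
  (continuous_vandermondePos.comp continuous_snd).mul continuous_hDet

theorem vandermondePos_succ (z : Fin (N + 1) → ℝ) :
    vandermondePos z = vandermondePos (Fin.init z : Fin N → ℝ) *
      ∏ i : Fin N, (z (Fin.last N) - z i.castSucc) := by
  have e : ∀ {M : ℕ} (z : Fin M → ℝ), vandermondePos z =
      ∏ i, ∏ j, if i < j then z j - z i else 1 := fun z =>
    Finset.prod_congr rfl fun i _ => by
      rw [← Finset.prod_filter]
      congr 1
      ext j
      simp
  rw [e, e, Fin.prod_univ_castSucc]
  have h1 : ∏ j, (if Fin.last N < j then z j - z (Fin.last N) else 1) = 1 :=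
    Finset.prod_eq_one fun j _ => if_neg (not_lt.2 (Fin.le_last j))
  rw [h1, mul_one, ← Finset.prod_mul_distrib]
  refine Finset.prod_congr rfl fun i _ => ?_
  rw [Fin.prod_univ_castSucc]
  simp [Fin.init, Fin.castSucc_lt_last]

/-- Column `j` depends only on `x j`, so each term of the Leibniz formula is a product over the
coordinates of the box. -/
theorem integral_det_Icc (f : Fin N → ℝ → ℝ) (hf : ∀ i, Continuous (f i)) (a b : Fin N → ℝ) :
    ∫ x in Set.Icc a b, (Matrix.of fun i j => f i (x j)).det =
      (Matrix.of fun i j => ∫ t in Set.Icc (a j) (b j), f i t).det := by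
  simp only [Matrix.det_apply, Matrix.of_apply]
  simp only [Units.smul_def, zsmul_eq_mul]
  rw [integral_finsetSum]
  · refine Finset.sum_congr rfl fun σ _ => ?_
    rw [integral_const_mul, ← Set.pi_univ_Icc, volume_pi, Measure.restrict_pi_pi,
      integral_fintype_prod_eq_prod (fun j => f (σ j))]
  · intro σ _
    refine Continuous.integrableOn_Icc ?_
    fun_prop

/-- Dividing column `j` by the entry of its last row makes that row constant. Subtracting
neighbouring columns then leaves a single nonzero entry in it, along which the determinant is
expanded. -/
theorem det_exp_succ (π l : Fin (N + 1) → ℝ) :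
    (Matrix.of fun i j => Real.exp (-(π i * l j))).det =
      Real.exp (-(π (Fin.last N) * ∑ j, l j)) *
      (Matrix.of fun i j : Fin N =>
        Real.exp (-((π i.castSucc - π (Fin.last N)) * l j.castSucc)) -
        Real.exp (-((π i.castSucc - π (Fin.last N)) * l j.succ))).det := by
  set A : Matrix (Fin (N + 1)) (Fin (N + 1)) ℝ :=
    Matrix.of fun i j => Real.exp (-((π i - π (Fin.last N)) * l j)) with hA
  have h1 : (Matrix.of fun i j => Real.exp (-(π i * l j))).det =
      Real.exp (-(π (Fin.last N) * ∑ j, l j)) * A.det := by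
    rw [Finset.mul_sum, ← Finset.sum_neg_distrib, Real.exp_sum, ← Matrix.det_mul_row]
    congr 1
    ext i j
    simp only [hA, Matrix.of_apply, ← Real.exp_add]
    ring_nf
  rw [h1]
  congr 1
  let B : Matrix (Fin (N + 1)) (Fin (N + 1)) ℝ :=
    Matrix.of fun i => Fin.cons (A i 0) fun j : Fin N => A i j.succ - A i j.castSucc
  have h2 : A.det = B.det :=
    Matrix.det_eq_of_forall_col_eq_smul_add_pred (fun _ => 1) (fun i => rfl) fun i j => by simp [B]
  have hlast : ∀ j, A (Fin.last N) j = 1 := fun j => by simp [hA]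
  rw [h2, Matrix.det_succ_row B (Fin.last N), Finset.sum_eq_single 0]
  · have e : B (Fin.last N) 0 = 1 := hlast 0
    -- The `N` reversed column differences give the sign `(-1) ^ N`, which cancels the sign of the
    -- expansion.
    have e2 : (Matrix.of fun i j : Fin N =>
        Real.exp (-((π i.castSucc - π (Fin.last N)) * l j.castSucc)) -
        Real.exp (-((π i.castSucc - π (Fin.last N)) * l j.succ))) =
        -(B.submatrix (Fin.last N).succAbove (Fin.succAbove 0)) := by
      ext i j
      simp [B, hA]
    rw [e, e2, Matrix.det_neg]
    simp
  · intro j _ hj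
    obtain ⟨k, rfl⟩ := Fin.exists_succ_eq.2 hj
    simp [B, hlast]
  · simp

theorem integral_exp_neg_mul {q a b : ℝ} (hq : q ≠ 0) (hab : a ≤ b) :
    -q * ∫ t in Set.Icc a b, Real.exp (-(q * t)) = Real.exp (-(q * b)) - Real.exp (-(q * a)) := by
  rw [integral_Icc_eq_integral_Ioc, ← intervalIntegral.integral_of_le hab,
    intervalIntegral.integral_eq_sub_of_hasDerivAt (f := fun t => Real.exp (-(q * t)) / (-q))]
  · field_simp
    ring
  · intro t _
    refine ((((hasDerivAt_id t).const_mul q).neg.exp).div_const (-q)).congr_deriv ?_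
    rw [div_eq_iff (neg_ne_zero.2 hq)]
    simp
  · exact (by fun_prop : Continuous fun t => Real.exp (-(q * t))).intervalIntegrable _ _

/-- Integrating the determinant column by column over the interlacing box yields the differences of
exponentials in `det_exp_succ`. The factors `π (Fin.last N) - π i.castSucc` released by the
integrals are those missing from the Vandermonde product of `π`. -/
theorem gtDet_succ_of_injective {π l : Fin (N + 1) → ℝ} (hπ : Function.Injective π)
    (hl : Antitone l) :
    gtDet π l = ∫ a in Set.Icc (fun i : Fin N => l i.succ) (fun i => l i.castSucc),
      Real.exp (-(π (Fin.last N) * (∑ i, l i - ∑ i, a i))) *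
        gtDet (Fin.init π : Fin N → ℝ) a := by
  have hπ' : Function.Injective (Fin.init π : Fin N → ℝ) := fun i j h =>
    Fin.castSucc_injective _ (hπ h)
  have e1 : ∀ a : Fin N → ℝ, Real.exp (-(π (Fin.last N) * (∑ i, l i - ∑ i, a i))) *
      gtDet (Fin.init π : Fin N → ℝ) a =
      Real.exp (-(π (Fin.last N) * ∑ i, l i)) / vandermondePos (Fin.init π : Fin N → ℝ) *
      (Matrix.of fun i j : Fin N =>
        Real.exp (-((π i.castSucc - π (Fin.last N)) * a j))).det := by
    intro a
    have : (Matrix.of fun i j : Fin N =>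
        Real.exp (-((π i.castSucc - π (Fin.last N)) * a j))).det =
        Real.exp (π (Fin.last N) * ∑ i, a i) *
        (Matrix.of fun i j => Real.exp (-((Fin.init π : Fin N → ℝ) i * a j))).det := by
      rw [Finset.mul_sum, Real.exp_sum, ← Matrix.det_mul_row]
      congr 1
      ext i j
      simp only [Matrix.of_apply, ← Real.exp_add, Fin.init]
      ring_nf
    rw [gtDet_eq_div hπ', this, mul_sub, neg_sub, Real.exp_sub, Real.exp_neg]
    ring
  simp only [e1]
  rw [integral_const_mul, integral_det_Icc (fun (i : Fin N) t =>
    Real.exp (-((π i.castSucc - π (Fin.last N)) * t))) (fun i => by fun_prop), gtDet_eq_div hπ,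
    det_exp_succ, vandermondePos_succ]
  have e2 : (Matrix.of fun i j : Fin N =>
      Real.exp (-((π i.castSucc - π (Fin.last N)) * l j.castSucc)) -
      Real.exp (-((π i.castSucc - π (Fin.last N)) * l j.succ))).det =
      (∏ i : Fin N, (π (Fin.last N) - π i.castSucc)) * (Matrix.of fun i j : Fin N =>
        ∫ t in Set.Icc (l j.succ) (l j.castSucc),
          Real.exp (-((π i.castSucc - π (Fin.last N)) * t))).det := by
    rw [← Matrix.det_mul_column]
    congr 1
    ext i j
    have hq : π i.castSucc - π (Fin.last N) ≠ 0 :=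
      sub_ne_zero.2 fun h => (Fin.castSucc_lt_last i).ne (hπ h)
    have := integral_exp_neg_mul hq (hl (Fin.castSucc_lt_succ (i := j)).le)
    simp only [Matrix.of_apply]
    rw [← this]
    ring
  rw [e2]
  have h1 : ∏ i : Fin N, (π (Fin.last N) - π i.castSucc) ≠ 0 :=
    Finset.prod_ne_zero_iff.2 fun i _ => sub_ne_zero.2 fun h => (Fin.castSucc_lt_last i).ne' (hπ h)
  have h2 := vandermondePos_ne_zero hπ'
  field_simp

theorem continuous_gtDet_integrand (l : Fin (N + 1) → ℝ) :
    Continuous fun p : (Fin (N + 1) → ℝ) × (Fin N → ℝ) =>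
      Real.exp (-(p.1 (Fin.last N) * (∑ i, l i - ∑ i, p.2 i))) *
        gtDet (Fin.init p.1 : Fin N → ℝ) p.2 := by
  refine Continuous.mul (by fun_prop) (continuous_gtDet.comp (Continuous.prodMk ?_ continuous_snd))
  exact continuous_pi fun i => (continuous_apply i.castSucc).comp continuous_fst

/-- Both sides are continuous in `π`, and injective parameters are dense. -/
theorem gtDet_succ (π : Fin (N + 1) → ℝ) {l : Fin (N + 1) → ℝ} (hl : Antitone l) :
    gtDet π l = ∫ a in Set.Icc (fun i : Fin N => l i.succ) (fun i => l i.castSucc),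
      Real.exp (-(π (Fin.last N) * (∑ i, l i - ∑ i, a i))) *
        gtDet (Fin.init π : Fin N → ℝ) a := by
  have h := Continuous.ext_on dense_injective (f := fun π => gtDet π l)
    (continuous_gtDet.comp (continuous_id.prodMk continuous_const))
    (continuous_parametric_integral_of_continuous (μ := volume) (f := fun (π : Fin (N + 1) → ℝ)
      (a : Fin N → ℝ) => Real.exp (-(π (Fin.last N) * (∑ i, l i - ∑ i, a i))) *
        gtDet (Fin.init π : Fin N → ℝ) a) (continuous_gtDet_integrand l)
      (isCompact_Icc (a := fun i : Fin N => l i.succ) (b := fun i => l i.castSucc)))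
    fun π hπ => gtDet_succ_of_injective hπ hl
  exact congrFun h π

theorem integrableOn_gtDet (π l : Fin (N + 1) → ℝ) :
    IntegrableOn (fun a : Fin N → ℝ => Real.exp (-(π (Fin.last N) * (∑ i, l i - ∑ i, a i))) *
      gtDet (Fin.init π : Fin N → ℝ) a)
      (Set.Icc (fun i : Fin N => l i.succ) (fun i => l i.castSucc)) :=
  ((continuous_gtDet_integrand l).comp (continuous_const.prodMk continuous_id)).integrableOn_Icc

theorem interlaces_iff_mem_Icc {a : Fin N → ℝ} {l : Fin (N + 1) → ℝ} :
    Interlaces a l ↔ a ∈ Set.Icc (fun i : Fin N => l i.succ) (fun i => l i.castSucc) :=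
  ⟨fun h => ⟨fun i => (h i).1, fun i => (h i).2⟩, fun h i => ⟨h.1 i, h.2 i⟩⟩

theorem Interlaces.antitone {a : Fin N → ℝ} {l : Fin (N + 1) → ℝ} (h : Interlaces a l)
    (hl : Antitone l) : Antitone a := by
  intro i j hij
  rcases hij.eq_or_lt with rfl | hij
  · exact le_rfl
  · exact ((h j).2.trans (hl (Fin.succ_le_castSucc_iff.2 hij))).trans (h i).1

theorem gtDet_nonneg (π : Fin N → ℝ) {z : Fin N → ℝ} (hz : Antitone z) : 0 ≤ gtDet π z := by
  induction N with
  | zero => simp [gtDet, vandermondePos, hDet]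
  | succ N ih =>
    rw [gtDet_succ π hz]
    refine setIntegral_nonneg measurableSet_Icc fun a ha => ?_
    exact mul_nonneg (Real.exp_pos _).le (ih _ ((interlaces_iff_mem_Icc.2 ha).antitone hz))

/-- The weight `e ^ (-p t)`. -/
noncomputable def expWeight (p t : ℝ) : ℝ≥0∞ := ENNReal.ofReal (Real.exp (-(p * t)))

theorem gtInt_one_eq_gtDet (π : ℕ → ℝ) {l : Fin N → ℝ} (hl : Antitone l) :
    gtInt volume (fun k => expWeight (π k)) N l 1 =
      ENNReal.ofReal (gtDet (fun i : Fin N => π i) l) := by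
  induction N with
  | zero => simp [gtInt, gtDet, vandermondePos, hDet]
  | succ N ih =>
    rw [gtDet_succ _ hl, ofReal_integral_eq_lintegral_ofReal (integrableOn_gtDet (fun i : Fin (N + 1) => π i) l)
      (by
        refine (ae_restrict_iff' measurableSet_Icc).2 (ae_of_all _ fun a ha => ?_)
        exact mul_nonneg (Real.exp_pos _).le
          (gtDet_nonneg _ ((interlaces_iff_mem_Icc.2 ha).antitone hl))), gtInt,
      ← lintegral_indicator measurableSet_Icc]
    refine lintegral_congr fun a => ?_
    by_cases ha : Interlaces a l
    · rw [ind_of ha, Set.indicator_of_mem (interlaces_iff_mem_Icc.1 ha), one_mul,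
        ENNReal.ofReal_mul (Real.exp_pos _).le]
      congr 1
      exact ih (ha.antitone hl)
    · rw [ind_of_not ha, Set.indicator_of_notMem (fun h => ha (interlaces_iff_mem_Icc.2 h)),
        zero_mul, zero_mul]

theorem gtInt_eq_zero_of_not_antitone {E : ℕ → ℝ → ℝ≥0∞} (hE : ∀ k, Measurable (E k))
    {l : Fin N → ℝ} (hl : ¬Antitone l) (f : Triangle N ℝ → ℝ≥0∞) : gtInt volume E N l f = 0 := by
  have : gtInt volume E N l f ≤ gtInt volume E N l fun _ => 0 :=
    gtInt_mono fun x hx hxl => (hl (hxl ▸ hx.antitone_bottomRow)).elim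
  rw [gtInt_const hE, zero_mul] at this
  exact le_antisymm this zero_le

theorem measurable_expWeight (p : ℝ) : Measurable (expWeight p) := by
  unfold expWeight
  fun_prop

theorem expWeight_add (p s t : ℝ) : expWeight p (s + t) = expWeight p s * expWeight p t := by
  rw [expWeight, mul_add, neg_add, Real.exp_add, ENNReal.ofReal_mul (Real.exp_pos _).le]
  rfl

theorem gtInt_expWeight_ne_top (π : ℕ → ℝ) (l : Fin N → ℝ) :
    gtInt volume (fun k => expWeight (π k)) N l 1 ≠ ∞ := by
  by_cases hl : Antitone l
  · rw [gtInt_one_eq_gtDet π hl]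
    exact ENNReal.ofReal_ne_top
  · rw [gtInt_eq_zero_of_not_antitone (fun k => measurable_expWeight _) hl]
    exact ENNReal.zero_ne_top

/-! ### Bounds -/

/-- Compare the recursions for `π` and for `0`. Passing from `N` to `N + 1` levels changes the level
sum by at most `(2 * N + 1) * r`, and the odd numbers add up to the square in the exponent. -/
theorem gtDet_lower_bound {A r : ℝ} (hA : 0 ≤ A) (π : Fin N → ℝ)
    (hπ : ∀ i, |π i| ≤ A) {z : Fin N → ℝ} (hz : Antitone z) (hzr : ∀ i, |z i| ≤ r) :
    Real.exp (-(N ^ 2 * (A * r))) * gtDet 0 z ≤ gtDet π z := by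
  induction N with
  | zero => simp [gtDet, vandermondePos, hDet]
  | succ N ih =>
    rw [gtDet_succ π hz, gtDet_succ 0 hz, ← integral_const_mul]
    refine setIntegral_mono_on ((integrableOn_gtDet 0 z).const_mul _) (integrableOn_gtDet π z)
      measurableSet_Icc fun a ha => ?_
    have ha' := interlaces_iff_mem_Icc.2 ha
    have har : ∀ i, |a i| ≤ r := fun i => abs_le.2
      ⟨(abs_le.1 (hzr _)).1.trans (ha' i).1, (ha' i).2.trans (abs_le.1 (hzr _)).2⟩
    have h1 := ih (Fin.init π) (fun i => hπ _) (ha'.antitone hz) har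
    have h2 : |∑ i, z i - ∑ i, a i| ≤ (2 * N + 1) * r := by
      have e1 : |∑ i, z i| ≤ (N + 1) * r := by
        refine (Finset.abs_sum_le_sum_abs _ _).trans ((Finset.sum_le_sum fun i _ => hzr i).trans ?_)
        simp
      have e2 : |∑ i, a i| ≤ N * r := by
        refine (Finset.abs_sum_le_sum_abs _ _).trans ((Finset.sum_le_sum fun i _ => har i).trans ?_)
        simp
      have := abs_sub (∑ i, z i) (∑ i, a i)
      linarith
    have h3 : π (Fin.last N) * (∑ i, z i - ∑ i, a i) ≤ A * ((2 * N + 1) * r) := by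
      refine (le_abs_self _).trans ?_
      rw [abs_mul]
      exact mul_le_mul (hπ _) h2 (abs_nonneg _) hA
    have h4 : (0 : Fin (N + 1) → ℝ) (Fin.last N) = 0 := rfl
    have h5 : (Fin.init (0 : Fin (N + 1) → ℝ) : Fin N → ℝ) = 0 := rfl
    rw [h4, h5, zero_mul, neg_zero, Real.exp_zero, one_mul]
    calc _ = Real.exp (-(A * ((2 * N + 1) * r))) *
          (Real.exp (-(N ^ 2 * (A * r))) * gtDet 0 a) := by
          rw [← mul_assoc (Real.exp _) (Real.exp _), ← Real.exp_add]
          push_cast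
          ring_nf
      _ ≤ _ := by
          refine mul_le_mul (Real.exp_le_exp.2 (neg_le_neg h3)) h1
            (mul_nonneg (Real.exp_pos _).le (gtDet_nonneg _ (ha'.antitone hz))) (Real.exp_pos _).le

/-- Each difference of level sums is at least `-r`, so every parameter can be lowered to `p` at a
cost `e ^ ((A - p) * r)` per level. The remaining exponents with `p` telescope to the sum of `z`. -/
theorem gtDet_upper_bound {A p r : ℝ} (hr : 0 ≤ r) (π : Fin N → ℝ)
    (hπ : ∀ i, p ≤ π i ∧ π i ≤ A) {z : Fin N → ℝ} (hz : Antitone z) (hzr : ∀ i, -r ≤ z i) :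
    gtDet π z ≤ Real.exp (N * ((A - p) * r)) * Real.exp (-(p * ∑ i, z i)) * gtDet 0 z := by
  induction N with
  | zero => simp [gtDet, vandermondePos, hDet]
  | succ N ih =>
    rw [gtDet_succ π hz, gtDet_succ 0 hz, ← integral_const_mul]
    refine setIntegral_mono_on (integrableOn_gtDet π z) ((integrableOn_gtDet 0 z).const_mul _)
      measurableSet_Icc fun a ha => ?_
    have ha' := interlaces_iff_mem_Icc.2 ha
    have har : ∀ i, -r ≤ a i := fun i => (hzr _).trans (ha' i).1
    have h1 := ih (Fin.init π) (fun i => hπ _) (ha'.antitone hz) har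
    have h2 : -r ≤ ∑ i, z i - ∑ i, a i := by
      rw [Fin.sum_univ_castSucc]
      have := Finset.sum_le_sum fun (i : Fin N) (_ : i ∈ Finset.univ) => (ha' i).2
      linarith [hzr (Fin.last N)]
    have h3 : -(π (Fin.last N) * (∑ i, z i - ∑ i, a i)) ≤
        (A - p) * r - p * (∑ i, z i - ∑ i, a i) := by
      obtain ⟨h4, h5⟩ := hπ (Fin.last N)
      nlinarith [mul_nonneg (sub_nonneg.2 h4) (sub_nonneg.2 h2), mul_nonneg (sub_nonneg.2 h5) hr]
    have h4 : (0 : Fin (N + 1) → ℝ) (Fin.last N) = 0 := rfl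
    have h5 : (Fin.init (0 : Fin (N + 1) → ℝ) : Fin N → ℝ) = 0 := rfl
    rw [h4, h5, zero_mul, neg_zero, Real.exp_zero, one_mul]
    calc _ ≤ Real.exp ((A - p) * r - p * (∑ i, z i - ∑ i, a i)) *
          (Real.exp (N * ((A - p) * r)) * Real.exp (-(p * ∑ i, a i)) * gtDet 0 a) := by
          refine mul_le_mul (Real.exp_le_exp.2 h3) h1 (gtDet_nonneg _ (ha'.antitone hz))
            (Real.exp_pos _).le
      _ = _ := by
          rw [← mul_assoc, ← Real.exp_add, ← Real.exp_add, ← Real.exp_add]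
          push_cast
          ring_nf

/-! ### Positivity and growth of the normalized function -/

/-- The function `hDet`, normalized to be `1` at `π = 0`. -/
noncomputable def hNorm (π z : Fin N → ℝ) : ℝ := hDet π z / hDet (0 : Fin N → ℝ) 0

theorem hDet_zero_ne_zero : hDet (0 : Fin N → ℝ) 0 ≠ 0 := by
  rw [hDet_zero]
  exact Finset.prod_ne_zero_iff.2 fun i _ => div_ne_zero (pow_ne_zero _ (by norm_num))
    (Nat.cast_ne_zero.2 (Nat.factorial_ne_zero _))

theorem continuous_hNorm : Continuous fun p : (Fin N → ℝ) × (Fin N → ℝ) => hNorm p.1 p.2 :=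
  continuous_hDet.div_const _

theorem gtDet_eq_hNorm (π z : Fin N → ℝ) : gtDet π z = gtDet 0 z * hNorm π z := by
  have h : hDet 0 z = hDet (0 : Fin N → ℝ) 0 := by rw [hDet_zero, hDet_zero]
  rw [gtDet, gtDet, hNorm, h]
  field_simp [hDet_zero_ne_zero]

theorem gtDet_zero_pos {z : Fin N → ℝ} (hz : StrictAnti z) : 0 < gtDet 0 z := by
  refine lt_of_le_of_ne (gtDet_nonneg 0 hz.antitone) (Ne.symm ?_)
  have h : hDet 0 z = hDet (0 : Fin N → ℝ) 0 := by rw [hDet_zero, hDet_zero]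
  rw [gtDet, h]
  exact mul_ne_zero (vandermondePos_ne_zero hz.injective) hDet_zero_ne_zero

theorem hFun_div_hFun (π z z' : Fin N → ℝ) : hFun π z' / hFun π z = hNorm π z' / hNorm π z := by
  rw [hFun_eq_hDet, hFun_eq_hDet, hNorm, hNorm, div_div_div_cancel_right₀ hDet_zero_ne_zero]

/-- The strictly decreasing vector `z - t • (0, 1, …, N - 1)`. -/
def spread (z : Fin N → ℝ) (t : ℝ) : Fin N → ℝ := fun i => z i - t * (i : ℕ)

theorem spread_strictAnti {z : Fin N → ℝ} (hz : Antitone z) {t : ℝ} (ht : 0 < t) :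
    StrictAnti (spread z t) := by
  intro i j hij
  have h1 := hz hij.le
  have h2 : ((i : ℕ) : ℝ) < (j : ℕ) := by exact_mod_cast hij
  simp only [spread]
  nlinarith

theorem continuous_spread (z : Fin N → ℝ) : Continuous (spread z) := by
  unfold spread
  fun_prop

theorem tendsto_spread (z : Fin N → ℝ) : Tendsto (spread z) (𝓝[>] 0) (𝓝 z) := by
  have h : spread z 0 = z := by funext i; simp [spread]
  have := (continuous_spread z).tendsto 0
  rw [h] at this
  exact this.mono_left nhdsWithin_le_nhds

/-- At strictly decreasing points `gtDet_upper_bound` can be divided by `gtDet 0`; ties are reached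
as limits of `spread z t`. The `r + 1` leaves room for the entries lowered by the spreading. -/
theorem hNorm_upper_bound {A p r : ℝ} (hr : 0 ≤ r) (π : Fin N → ℝ)
    (hπ : ∀ i, p ≤ π i ∧ π i ≤ A) {z : Fin N → ℝ} (hz : Antitone z) (hzr : ∀ i, -r ≤ z i) :
    hNorm π z ≤ Real.exp (N * ((A - p) * (r + 1))) * Real.exp (-(p * ∑ i, z i)) := by
  have h1 : Tendsto (fun t => hNorm π (spread z t)) (𝓝[>] 0) (𝓝 (hNorm π z)) :=
    ((continuous_hNorm.comp (continuous_const.prodMk continuous_id)).tendsto z).comp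
      (tendsto_spread z)
  have h2 : Tendsto (fun t => Real.exp (N * ((A - p) * (r + 1))) *
      Real.exp (-(p * ∑ i, spread z t i))) (𝓝[>] 0)
      (𝓝 (Real.exp (N * ((A - p) * (r + 1))) * Real.exp (-(p * ∑ i, z i)))) :=
    ((by fun_prop : Continuous fun z : Fin N → ℝ => Real.exp (N * ((A - p) * (r + 1))) *
      Real.exp (-(p * ∑ i, z i))).tendsto z).comp (tendsto_spread z)
  have hev : ∀ᶠ t in 𝓝[>] (0 : ℝ), ∀ i, -(r + 1) ≤ spread z t i := by
    rw [eventually_all]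
    intro i
    have := ((continuous_apply i).tendsto z).comp (tendsto_spread z)
    filter_upwards [this.eventually (lt_mem_nhds (show -(r + 1) < z i by linarith [hzr i]))] with t ht
    exact ht.le
  refine le_of_tendsto_of_tendsto h1 h2 ?_
  filter_upwards [hev, self_mem_nhdsWithin] with t ht ht0
  have hs := spread_strictAnti hz ht0
  have := gtDet_upper_bound (by linarith) π hπ hs.antitone ht
  rw [gtDet_eq_hNorm, mul_comm] at this
  exact le_of_mul_le_mul_right this (gtDet_zero_pos hs)

/-- The lower bound divided by `gtDet 0` is one positive constant along `spread z t` for small `t`.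
It therefore survives the limit, also when `z` has ties and `gtDet 0 z` vanishes. -/
theorem hNorm_pos (π : Fin N → ℝ) {z : Fin N → ℝ} (hz : Antitone z) : 0 < hNorm π z := by
  set r : ℝ := ‖z‖ + 1
  have h1 : Tendsto (fun t => hNorm π (spread z t)) (𝓝[>] 0) (𝓝 (hNorm π z)) :=
    ((continuous_hNorm.comp (continuous_const.prodMk continuous_id)).tendsto z).comp
      (tendsto_spread z)
  have hev : ∀ᶠ t in 𝓝[>] (0 : ℝ), ‖spread z t‖ ≤ r := by
    have := (continuous_norm.tendsto z).comp (tendsto_spread z)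
    filter_upwards [this.eventually (gt_mem_nhds (lt_add_one ‖z‖))] with t ht
    exact ht.le
  refine lt_of_lt_of_le (Real.exp_pos (-(N ^ 2 * (‖π‖ * r)))) (ge_of_tendsto h1 ?_)
  filter_upwards [hev, self_mem_nhdsWithin] with t ht ht0
  have hs := spread_strictAnti hz ht0
  have := gtDet_lower_bound (norm_nonneg π) π (fun i => norm_le_pi_norm π i)
    hs.antitone (fun i => (norm_le_pi_norm _ i).trans ht)
  rw [gtDet_eq_hNorm π, mul_comm] at this
  exact le_of_mul_le_mul_left this (gtDet_zero_pos hs)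

end GTDet

/-! ### Eigenvalues of rank one perturbations -/

section RankOne

variable {N : ℕ}

theorem antitone_sp {M : Matrix (Fin N) (Fin N) ℂ} (hM : M.IsHermitian) : Antitone (sp hM) :=
  fun _ _ h => hM.eigenvalues₀_antitone h

theorem prod_sp {M : Matrix (Fin N) (Fin N) ℂ} (hM : M.IsHermitian) {K : Type*} [CommMonoid K]
    (f : ℝ → K) : ∏ i, f (sp hM i) = ∏ i, f (hM.eigenvalues i) := by
  have e1 : ∏ i, f (sp hM i) = ∏ k, f (hM.eigenvalues₀ k) :=
    (finCongr (Fintype.card_fin N).symm).prod_comp fun k => f (hM.eigenvalues₀ k)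
  rw [e1]
  exact ((Fintype.equivOfCardEq (Fintype.card_fin _)).symm.prod_comp
    fun k => f (hM.eigenvalues₀ k)).symm

theorem eval_charpoly_eq_prod_sp {M : Matrix (Fin N) (Fin N) ℂ} (hM : M.IsHermitian) (t : ℝ) :
    (Matrix.scalar (Fin N) (t : ℂ) - M).det = ((∏ i, (t - sp hM i) : ℝ) : ℂ) := by
  rw [← Matrix.eval_charpoly, hM.charpoly_eq, Polynomial.eval_prod,
    prod_sp hM fun s => t - s, Complex.ofReal_prod]
  simp

theorem sum_sp {M : Matrix (Fin N) (Fin N) ℂ} (hM : M.IsHermitian) :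
    ((∑ i, sp hM i : ℝ) : ℂ) = M.trace := by
  -- Read in `Multiplicative ℝ`, the product formula is the sum formula.
  have := prod_sp (K := Multiplicative ℝ) hM Multiplicative.ofAdd
  rw [hM.trace_eq_sum_eigenvalues, ← ofAdd_sum, ← ofAdd_sum] at *
  rw [Multiplicative.ofAdd.injective this]
  simp

theorem sum_sp_rankOnePerturb (z : Fin N → ℝ) (g : Fin N → ℂ) :
    ∑ i, sp (rankOnePerturb_isHermitian z g) i = ∑ i, z i + ∑ i, ‖g i‖ ^ 2 := by
  have := sum_sp (rankOnePerturb_isHermitian z g)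
  have e : (rankOnePerturb z g).trace = ∑ i, (z i : ℂ) + ∑ i, g i * star g i := by
    rw [rankOnePerturb, Matrix.trace_add, Matrix.trace_diagonal, Matrix.trace_vecMulVec,
      dotProduct]
  rw [e] at this
  apply Complex.ofReal_injective
  rw [this]
  simp [Complex.mul_conj, Complex.normSq_eq_norm_sq]

/-- The characteristic polynomial of a perturbation of `diag(z)` by a projection on a vector with
squared absolute values `w`. -/
def secular (z w : Fin N → ℝ) (t : ℝ) : ℝ :=
  ∏ i, (t - z i) - ∑ i, w i * ∏ j ∈ Finset.univ.erase i, (t - z j)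

theorem continuous_secular (t : ℝ) :
    Continuous fun p : (Fin N → ℝ) × (Fin N → ℝ) => secular p.1 p.2 t := by
  unfold secular
  fun_prop

theorem secular_eq_mul (z w : Fin N → ℝ) {t : ℝ} (ht : ∀ i, t ≠ z i) :
    secular z w t = (∏ i, (t - z i)) * (1 - ∑ i, w i / (t - z i)) := by
  rw [secular, mul_sub, mul_one, Finset.mul_sum]
  congr 1
  refine Finset.sum_congr rfl fun i _ => ?_
  rw [← Finset.mul_prod_erase _ _ (Finset.mem_univ i)]
  have := sub_ne_zero.2 (ht i)
  field_simp

/-- Away from the points `z i` this is the determinant formula for the identity plus a rank one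
matrix. Those points form a finite set and both sides are continuous in `t`. -/
theorem prod_sub_sp_eq_secular (z : Fin N → ℝ) (g : Fin N → ℂ) (t : ℝ) :
    ∏ i, (t - sp (rankOnePerturb_isHermitian z g) i) = secular z (fun i => ‖g i‖ ^ 2) t := by
  have h : ∀ t ∈ (Set.range z)ᶜ, ∏ i, (t - sp (rankOnePerturb_isHermitian z g) i) =
      secular z (fun i => ‖g i‖ ^ 2) t := by
    intro t ht
    have ht' : ∀ i, t ≠ z i := fun i h => ht ⟨i, h.symm⟩
    have hd : ∀ i, (t : ℂ) - z i ≠ 0 := fun i => sub_ne_zero.2 fun h =>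
      ht' i (Complex.ofReal_injective h)
    apply Complex.ofReal_injective
    rw [← eval_charpoly_eq_prod_sp, secular_eq_mul z _ ht']
    have e : Matrix.scalar (Fin N) (t : ℂ) - rankOnePerturb z g =
        Matrix.diagonal (fun i => (t : ℂ) - z i) *
        (1 + Matrix.replicateCol Unit (fun i => -(g i / ((t : ℂ) - z i))) *
          Matrix.replicateRow Unit (star g)) := by
      ext i j
      rw [Matrix.diagonal_mul]
      by_cases hij : i = j
      · subst hij
        simp [rankOnePerturb, Matrix.vecMulVec_apply, Matrix.mul_apply]
        field_simp [hd i]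
        ring
      · simp [rankOnePerturb, Matrix.vecMulVec_apply, Matrix.mul_apply, hij]
        field_simp [hd i]
    rw [e, Matrix.det_mul, Matrix.det_diagonal, Matrix.det_one_add_replicateCol_mul_replicateRow,
      dotProduct]
    push_cast
    congr 1
    rw [sub_eq_add_neg, ← Finset.sum_neg_distrib]
    congr 1
    refine Finset.sum_congr rfl fun i _ => ?_
    rw [← Complex.ofReal_pow, ← Complex.normSq_eq_norm_sq, ← Complex.mul_conj]
    simp
    ring
  have hdense : Dense (Set.range z)ᶜ := (Set.finite_range z).countable.dense_compl ℝ
  have := Continuous.ext_on hdense (f := fun t => ∏ i, (t - sp (rankOnePerturb_isHermitian z g) i))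
    (g := fun t => secular z (fun i => ‖g i‖ ^ 2) t) (by fun_prop)
    (by unfold secular; fun_prop) h
  exact congrFun this t

theorem eq_of_prod_sub_eq {u v : Fin N → ℝ} (hu : Antitone u) (hv : Antitone v)
    (h : ∀ t, ∏ i, (t - u i) = ∏ i, (t - v i)) : u = v := by
  have hp : ∏ i, (Polynomial.X - Polynomial.C (u i)) = ∏ i, (Polynomial.X - Polynomial.C (v i)) :=
    Polynomial.funext fun t => by simpa [Polynomial.eval_prod] using h t
  have hr := congrArg Polynomial.roots hp
  have e : ∀ u : Fin N → ℝ, (∏ i, (Polynomial.X - Polynomial.C (u i))).roots =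
      (List.ofFn u : Multiset ℝ) := fun u => by
    rw [Polynomial.roots_prod _ _
      (Finset.prod_ne_zero_iff.2 fun i _ => Polynomial.X_sub_C_ne_zero _)]
    simp [Fin.univ_val_map]
  rw [e, e, Multiset.coe_eq_coe] at hr
  exact List.ofFn_injective (hr.eq_of_sortedGE hu.sortedGE_ofFn hv.sortedGE_ofFn)

/-- To the left of all `z i` every fraction `w i / (t - z i)` is nonpositive, so the second factor
in `secular_eq_mul` is at least `1`. -/
theorem secular_ne_zero_of_lt {z w : Fin N → ℝ} (hw : ∀ i, 0 ≤ w i) {t : ℝ} (ht : ∀ i, t < z i) :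
    secular z w t ≠ 0 := by
  rw [secular_eq_mul z w fun i => (ht i).ne]
  refine mul_ne_zero (Finset.prod_ne_zero_iff.2 fun i _ => sub_ne_zero.2 (ht i).ne) ?_
  have : ∑ i, w i / (t - z i) ≤ 0 := Finset.sum_nonpos fun i _ =>
    div_nonpos_of_nonneg_of_nonpos (hw i) (sub_nonpos.2 (ht i).le)
  linarith

theorem le_sp {z : Fin N → ℝ} {g : Fin N → ℂ} {r : ℝ} (hz : ∀ i, r ≤ z i) (j : Fin N) :
    r ≤ sp (rankOnePerturb_isHermitian z g) j := by
  by_contra! h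
  refine secular_ne_zero_of_lt (w := fun i => ‖g i‖ ^ 2) (fun i => sq_nonneg _)
    (fun i => h.trans_le (hz i)) ?_
  rw [← prod_sub_sp_eq_secular]
  exact Finset.prod_eq_zero (Finset.mem_univ j) (sub_self _)

/-- The lower bound `le_sp` and the trace confine the spectra near a point to a compact box. A limit
along an ultrafilter is decreasing and has the limiting characteristic polynomial, which determines
it. -/
theorem continuous_sp : Continuous fun p : (Fin N → ℝ) × (Fin N → ℂ) =>
    sp (rankOnePerturb_isHermitian p.1 p.2) := by
  rw [continuous_iff_ultrafilter]
  rintro ⟨z, g⟩ U hU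
  set F := fun p : (Fin N → ℝ) × (Fin N → ℂ) => sp (rankOnePerturb_isHermitian p.1 p.2)
  set T := fun p : (Fin N → ℝ) × (Fin N → ℂ) => ∑ i, p.1 i + ∑ i, ‖p.2 i‖ ^ 2
  have hT : Continuous T := by fun_prop
  set r : ℝ := ‖z‖ + 1
  have hr : ∀ᶠ p : (Fin N → ℝ) × (Fin N → ℂ) in U, ‖p.1‖ ≤ r ∧ T p ≤ T (z, g) + 1 := by
    refine hU (Filter.inter_mem ?_ ?_)
    · have : ContinuousAt (fun p : (Fin N → ℝ) × (Fin N → ℂ) => ‖p.1‖) (z, g) := by fun_prop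
      filter_upwards [this.eventually (gt_mem_nhds (lt_add_one ‖z‖))] with p hp using hp.le
    · filter_upwards [hT.continuousAt.eventually (gt_mem_nhds (lt_add_one (T (z, g))))] with p hp
        using hp.le
  have hK : ∀ᶠ p in U, F p ∈ Set.Icc (fun _ => -r) fun _ => T (z, g) + 1 + N * r := by
    filter_upwards [hr] with p hp
    have hlow : ∀ i, -r ≤ F p i := le_sp fun i =>
      (neg_le_neg hp.1).trans (neg_le_of_abs_le (norm_le_pi_norm p.1 i))
    refine ⟨hlow, fun i => ?_⟩
    have h1 : ∑ i, F p i = T p := sum_sp_rankOnePerturb p.1 p.2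
    have h2 : F p i + r ≤ ∑ i, (F p i + r) :=
      Finset.single_le_sum (f := fun i => F p i + r) (fun i _ => by linarith [hlow i])
        (Finset.mem_univ i)
    rw [Finset.sum_add_distrib, h1] at h2
    simp at h2
    have : 0 ≤ r := by positivity
    simp only
    linarith [hp.2]
  obtain ⟨v, -, hv⟩ := isCompact_iff_ultrafilter_le_nhds.1
    (isCompact_Icc (a := fun _ : Fin N => -r) (b := fun _ => T (z, g) + 1 + N * r)) (U.map F)
    (le_principal_iff.2 hK)
  have hv' : Tendsto F U (𝓝 v) := hv
  have hanti : Antitone v := fun i j hij => le_of_tendsto_of_tendsto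
    (((continuous_apply j).tendsto v).comp hv') (((continuous_apply i).tendsto v).comp hv')
    (Eventually.of_forall fun p => antitone_sp _ hij)
  have heq : v = F (z, g) := by
    refine eq_of_prod_sub_eq hanti (antitone_sp _) fun t => ?_
    have h1 : Tendsto (fun p => ∏ i, (t - F p i)) U (𝓝 (∏ i, (t - v i))) :=
      ((by fun_prop : Continuous fun v : Fin N → ℝ => ∏ i, (t - v i)).tendsto v).comp hv'
    have h2 : Tendsto (fun p : (Fin N → ℝ) × (Fin N → ℂ) => secular p.1 (fun i => ‖p.2 i‖ ^ 2) t) U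
        (𝓝 (secular z (fun i => ‖g i‖ ^ 2) t)) :=
      (((continuous_secular t).comp (by fun_prop :
        Continuous fun p : (Fin N → ℝ) × (Fin N → ℂ) => (p.1, fun i => ‖p.2 i‖ ^ 2))).tendsto
        (z, g)).mono_left hU
    rw [prod_sub_sp_eq_secular]
    refine tendsto_nhds_unique h1 (h2.congr fun p => ?_)
    exact (prod_sub_sp_eq_secular p.1 p.2 t).symm
  change Tendsto F U (𝓝 (F (z, g)))
  rw [← heq]
  exact hv'

/-! ### Strict interlacing -/

theorem prod_sub_mul_neg_one_pow_pos {ι : Type*} (s : Finset ι) (v : ι → ℝ) {t : ℝ}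
    (h : ∀ j ∈ s, t ≠ v j) :
    0 < (∏ j ∈ s, (t - v j)) * (-1) ^ (s.filter fun j => t < v j).card := by
  rw [← Finset.prod_const, Finset.prod_filter, ← Finset.prod_mul_distrib]
  refine Finset.prod_pos fun j hj => ?_
  split_ifs with hlt
  · linarith
  · have := lt_of_le_of_ne (not_lt.1 hlt) (h j hj).symm
    linarith

/-- The vectors strictly interlacing with `z`. -/
def StrictStrip (z z' : Fin N → ℝ) : Prop :=
  (∀ i, z i < z' i) ∧ ∀ i j : Fin N, i.1 + 1 = j.1 → z' j < z i

theorem secular_self (z w : Fin N → ℝ) (i : Fin N) :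
    secular z w (z i) = -(w i * ∏ j ∈ Finset.univ.erase i, (z i - z j)) := by
  rw [secular, Finset.prod_eq_zero (Finset.mem_univ i) (sub_self _), Finset.sum_eq_single i]
  · ring
  · intro k _ hk
    rw [Finset.prod_eq_zero (Finset.mem_erase.2 ⟨hk.symm, Finset.mem_univ i⟩) (sub_self _), mul_zero]
  · simp

/-- Let `c i` count the roots above `z i`. The sign of the polynomial at `z i` fixes the parity of
`c i`, so the increasing counts of neighbours differ and grow by at least one. As `c` runs from at
least `1` to at most `N`, it must be `i + 1`, which is strict interlacing. -/
theorem strictStrip_of_prod_sub_eq_secular {z w v : Fin N → ℝ} (hz : StrictAnti z)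
    (hw : ∀ i, 0 < w i) (hv : Antitone v) (h : ∀ t, ∏ i, (t - v i) = secular z w t) :
    StrictStrip z v := by
  set c : Fin N → ℕ := fun i => (Finset.univ.filter fun j => z i < v j).card with hc
  have hprod : ∀ i, ∏ j ∈ Finset.univ.erase i, (z i - z j) ≠ 0 := fun i =>
    Finset.prod_ne_zero_iff.2 fun j hj => sub_ne_zero.2 fun e =>
      (Finset.mem_erase.1 hj).1 (hz.injective e).symm
  have hne : ∀ i j, z i ≠ v j := by
    intro i j e
    have h1 := h (z i)
    rw [secular_self, Finset.prod_eq_zero (Finset.mem_univ j) (sub_eq_zero.2 e)] at h1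
    exact neg_ne_zero.2 (mul_ne_zero (hw i).ne' (hprod i)) h1.symm
  have hodd : ∀ i, Odd (c i + i.1) := by
    intro i
    have h1 := prod_sub_mul_neg_one_pow_pos Finset.univ v (t := z i) fun j _ => hne i j
    have h2 := prod_sub_mul_neg_one_pow_pos (Finset.univ.erase i) z (t := z i) fun j hj e =>
      (Finset.mem_erase.1 hj).1 (hz.injective e).symm
    have e2 : ((Finset.univ.erase i).filter fun j => z i < z j) = Finset.Iio i := by
      ext j
      simp only [Finset.mem_filter, Finset.mem_erase, Finset.mem_univ, and_true, Finset.mem_Iio,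
        hz.lt_iff_gt]
      exact ⟨fun h => h.2, fun h => ⟨h.ne, h⟩⟩
    rw [e2, Fin.card_Iio] at h2
    rw [h, secular_self] at h1
    rw [← Nat.not_even_iff_odd]
    intro he
    have h3 := mul_pos (mul_pos h2 h1) (inv_pos.2 (hw i))
    have h4 : ((-1 : ℝ) ^ (i : ℕ)) * (-1) ^ c i = 1 := by rw [← pow_add, add_comm, he.neg_one_pow]
    have h5 : (∏ j ∈ Finset.univ.erase i, (z i - z j)) * (-1) ^ (i : ℕ) *
        (-(w i * ∏ j ∈ Finset.univ.erase i, (z i - z j)) * (-1) ^ c i) * (w i)⁻¹ =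
        -((∏ j ∈ Finset.univ.erase i, (z i - z j)) ^ 2 * ((-1 : ℝ) ^ (i : ℕ) * (-1) ^ c i)) := by
      have := (hw i).ne'
      field_simp
    change 0 < _ * (-(w i * _) * (-1 : ℝ) ^ c i) * _ at h3
    rw [h5, h4, mul_one] at h3
    nlinarith [sq_nonneg (∏ j ∈ Finset.univ.erase i, (z i - z j))]
  -- The counts increase weakly, and neighbours have opposite parity.
  have hstep : ∀ i j : Fin N, i.1 + 1 = j.1 → c i + 1 ≤ c j := by
    intro i j hij
    have hle : c i ≤ c j := Finset.card_le_card fun k hk => by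
      simp only [Finset.mem_filter, Finset.mem_univ, true_and] at hk ⊢
      exact (hz.antitone (show i ≤ j by rw [Fin.le_def]; omega)).trans_lt hk
    have h1 := hodd i
    have h2 := hodd j
    rw [Nat.odd_iff] at h1 h2
    omega
  have hlow : ∀ (m : ℕ) (hm : m < N), m + 1 ≤ c ⟨m, hm⟩ := by
    intro m
    induction m with
    | zero => intro hm; exact Nat.succ_le_of_lt (hodd ⟨0, hm⟩).pos
    | succ m ih => intro hm; have := hstep ⟨m, by omega⟩ ⟨m + 1, hm⟩ rfl; have := ih (by omega); omega
  have hupp : ∀ (m : ℕ) (hm : m < N), c ⟨N - 1 - m, by omega⟩ + m ≤ N := by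
    intro m
    induction m with
    | zero => intro hm; simpa [hc] using Finset.card_le_univ (α := Fin N) _
    | succ m ih =>
      intro hm
      have := hstep ⟨N - 1 - (m + 1), by omega⟩ ⟨N - 1 - m, by omega⟩
        (show N - 1 - (m + 1) + 1 = N - 1 - m by omega)
      have := ih (by omega)
      omega
  have hceq : ∀ i : Fin N, c i = i.1 + 1 := by
    intro i
    have h1 := hlow i.1 i.2
    have h2 := hupp (N - 1 - i.1) (by omega)
    have e : (⟨N - 1 - (N - 1 - i.1), by omega⟩ : Fin N) = i := by ext; simp only; omega
    rw [e] at h2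
    have : c ⟨i.1, i.2⟩ = c i := rfl
    omega
  constructor
  · intro i
    by_contra hcon
    have : c i ≤ (Finset.Iio i).card := Finset.card_le_card fun k hk => by
      simp only [Finset.mem_filter, Finset.mem_univ, true_and, Finset.mem_Iio] at hk ⊢
      by_contra hki
      exact hcon (hk.trans_le (hv (not_lt.1 hki)))
    rw [hceq, Fin.card_Iio] at this
    omega
  · intro i j hij
    refine lt_of_le_of_ne ?_ (hne i j).symm
    by_contra hcon
    have : (Finset.Iic j).card ≤ c i := Finset.card_le_card fun k hk => by
      simp only [Finset.mem_filter, Finset.mem_univ, true_and, Finset.mem_Iic] at hk ⊢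
      exact (not_le.1 hcon).trans_le (hv hk)
    rw [hceq, Fin.card_Iic] at this
    omega

end RankOne

/-! ### Squared absolute values of complex Gaussian vectors -/

section Gaussian

variable {N : ℕ}

/-- In polar coordinates the angle contributes `2 * Real.pi`, and `s = r ^ 2` turns `2 r e ^ (-r ^
2) dr` into `e ^ (-s) ds`: the squared modulus is exponential with parameter one. -/
theorem lintegral_stdComplexGaussian {f : ℝ → ℝ≥0∞} (hf : Measurable f) :
    ∫⁻ x, f (‖x‖ ^ 2) ∂stdComplexGaussian =
      ∫⁻ s in Set.Ioi 0, f s * ENNReal.ofReal (Real.exp (-s)) := by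
  have hmk : Measurable fun p : ℝ × ℝ => (⟨p.1, p.2⟩ : ℂ) :=
    Complex.measurableEquivRealProd.symm.measurable
  have hv : (1 / 2 : ℝ≥0) ≠ 0 := by norm_num
  have hpdf : ∀ x y : ℝ, gaussianPDF 0 (1 / 2) x * gaussianPDF 0 (1 / 2) y =
      ENNReal.ofReal (Real.pi⁻¹ * Real.exp (-(x ^ 2 + y ^ 2))) := by
    intro x y
    rw [gaussianPDF, gaussianPDF, ← ENNReal.ofReal_mul (gaussianPDFReal_nonneg _ _ _)]
    congr 1
    have h2 : (2 : ℝ) * ((1 / 2 : ℝ≥0) : ℝ) = 1 := by push_cast; norm_num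
    have h3 : 2 * Real.pi * ((1 / 2 : ℝ≥0) : ℝ) = Real.pi := by push_cast; ring
    rw [gaussianPDFReal, gaussianPDFReal, h2, h3, neg_add, Real.exp_add]
    simp only [sub_zero, div_one]
    have : (√Real.pi)⁻¹ * (√Real.pi)⁻¹ = Real.pi⁻¹ := by
      rw [← mul_inv, Real.mul_self_sqrt Real.pi_pos.le]
    linear_combination (Real.exp (-x ^ 2) * Real.exp (-y ^ 2)) * this
  have e1 : ∫⁻ x, f (‖x‖ ^ 2) ∂stdComplexGaussian = ∫⁻ p : ℝ × ℝ,
      ENNReal.ofReal (Real.pi⁻¹ * Real.exp (-(p.1 ^ 2 + p.2 ^ 2))) * f (p.1 ^ 2 + p.2 ^ 2) := by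
    rw [stdComplexGaussian, lintegral_map (f := fun x : ℂ => f (‖x‖ ^ 2)) (hf.comp (by fun_prop)) hmk,
      gaussianReal_of_var_ne_zero 0 hv,
      prod_withDensity (measurable_gaussianPDF _ _) (measurable_gaussianPDF _ _),
      lintegral_withDensity_eq_lintegral_mul _ (by fun_prop)
        (g := fun p : ℝ × ℝ => f (‖(⟨p.1, p.2⟩ : ℂ)‖ ^ 2))
        (hf.comp ((measurable_norm.comp hmk).pow_const 2)),
      Measure.volume_eq_prod]
    refine lintegral_congr fun p => ?_
    rw [Pi.mul_apply, hpdf, ← Complex.normSq_eq_norm_sq, Complex.normSq_apply]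
    simp only [pow_two]
  rw [e1, ← lintegral_comp_polarCoord_symm, polarCoord_target, Measure.volume_eq_prod,
    ← Measure.prod_restrict]
  have e2 : ∀ p : ℝ × ℝ, ENNReal.ofReal p.1 • (ENNReal.ofReal (Real.pi⁻¹ *
      Real.exp (-((polarCoord.symm p).1 ^ 2 + (polarCoord.symm p).2 ^ 2))) *
      f ((polarCoord.symm p).1 ^ 2 + (polarCoord.symm p).2 ^ 2)) =
      ENNReal.ofReal p.1 * (ENNReal.ofReal (Real.pi⁻¹ * Real.exp (-(p.1 ^ 2))) * f (p.1 ^ 2)) := by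
    intro p
    have : (polarCoord.symm p).1 ^ 2 + (polarCoord.symm p).2 ^ 2 = p.1 ^ 2 := by
      rw [polarCoord_symm_apply]
      linear_combination p.1 ^ 2 * Real.cos_sq_add_sin_sq p.2
    rw [this, smul_eq_mul]
  simp only [e2]
  rw [lintegral_prod _ (Measurable.aemeasurable (by fun_prop))]
  simp only [lintegral_const, Measure.restrict_apply_univ, Real.volume_Ioo]
  have himg : (fun r : ℝ => r ^ 2) '' Set.Ioi 0 = Set.Ioi 0 := by
    ext s
    simp only [Set.mem_image, Set.mem_Ioi]
    exact ⟨fun ⟨r, hr, e⟩ => e ▸ pow_pos hr 2, fun hs => ⟨√s, Real.sqrt_pos.2 hs, Real.sq_sqrt hs.le⟩⟩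
  conv_rhs => rw [← himg]
  rw [lintegral_image_eq_lintegral_abs_deriv_mul measurableSet_Ioi (f' := fun r => 2 * r)
    (fun r _ => by simpa using (hasDerivAt_pow 2 r).hasDerivWithinAt)
    (fun a ha b hb h => (pow_left_inj₀ (Set.mem_Ioi.1 ha).le (Set.mem_Ioi.1 hb).le two_ne_zero).1 h)]
  refine setLIntegral_congr_fun measurableSet_Ioi fun r hr => ?_
  have hr' : (0 : ℝ) < r := hr
  have h1 : ENNReal.ofReal r * (ENNReal.ofReal (Real.pi⁻¹ * Real.exp (-(r ^ 2))) * f (r ^ 2)) *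
      ENNReal.ofReal (Real.pi - -Real.pi) = f (r ^ 2) * (ENNReal.ofReal r *
      ENNReal.ofReal (Real.pi⁻¹ * Real.exp (-(r ^ 2))) * ENNReal.ofReal (Real.pi - -Real.pi)) := by
    ring
  have h2 : ENNReal.ofReal |2 * r| * (f (r ^ 2) * ENNReal.ofReal (Real.exp (-(r ^ 2)))) =
      f (r ^ 2) * (ENNReal.ofReal |2 * r| * ENNReal.ofReal (Real.exp (-(r ^ 2)))) := by ring
  rw [h1, h2, ← ENNReal.ofReal_mul hr'.le, ← ENNReal.ofReal_mul (by positivity),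
    ← ENNReal.ofReal_mul (abs_nonneg _), abs_of_pos (by positivity)]
  congr 2
  have := Real.pi_pos.ne'
  field_simp
  ring

instance : IsProbabilityMeasure stdComplexGaussian :=
  Measure.isProbabilityMeasure_map
    (Complex.measurableEquivRealProd.symm.measurable.aemeasurable)

theorem map_norm_sq_stdComplexGaussian :
    stdComplexGaussian.map (fun x => ‖x‖ ^ 2) =
      volume.withDensity (fun s => ind (0 < s) * ENNReal.ofReal (Real.exp (-s))) := by
  refine Measure.ext_of_lintegral _ fun f hf => ?_
  have hm : Measurable fun s : ℝ => ind (0 < s) * ENNReal.ofReal (Real.exp (-s)) :=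
    (measurable_ind measurableSet_Ioi).mul (by fun_prop)
  rw [lintegral_map hf (by fun_prop), lintegral_stdComplexGaussian hf,
    lintegral_withDensity_eq_lintegral_mul _ hm hf, ← lintegral_indicator measurableSet_Ioi]
  refine lintegral_congr fun s => ?_
  by_cases hs : 0 < s
  · rw [Set.indicator_of_mem (Set.mem_Ioi.2 hs), Pi.mul_apply, ind_of hs]
    ring
  · rw [Set.indicator_of_notMem (mt Set.mem_Ioi.1 hs), Pi.mul_apply, ind_of_not hs]
    ring

theorem lintegral_pi_prod {ν : Fin N → Measure ℝ} [∀ i, SigmaFinite (ν i)]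
    {f : Fin N → ℝ → ℝ≥0∞} (hf : ∀ i, Measurable (f i)) :
    ∫⁻ x, ∏ i, f i (x i) ∂(Measure.pi ν) = ∏ i, ∫⁻ t, f i t ∂(ν i) := by
  induction N with
  | zero => simp
  | succ N ih =>
    have hm : ∀ {M : ℕ} (g : Fin M → ℝ → ℝ≥0∞), (∀ i, Measurable (g i)) →
        Measurable fun x : Fin M → ℝ => ∏ i, g i (x i) := fun g hg =>
      Finset.measurable_prod _ fun i _ => (hg i).comp (measurable_pi_apply i)
    rw [lintegral_pi_insertNth ν 0 (hm f hf), Fin.prod_univ_succ]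
    simp only [Fin.prod_univ_succ, Fin.insertNth_zero', Fin.cons_zero, Fin.cons_succ]
    have h := fun t : ℝ => lintegral_const_mul (f 0 t)
      (hm (fun i => f i.succ) fun i => hf _) (μ := Measure.pi fun j : Fin N => ν j.succ)
    simp only [Fin.zero_succAbove, h]
    rw [lintegral_mul_const _ (hf 0), ih fun i => hf _]

theorem pi_withDensity {ν : Fin N → Measure ℝ} [∀ i, SigmaFinite (ν i)]
    {f : Fin N → ℝ → ℝ≥0∞} (hf : ∀ i, Measurable (f i))
    [∀ i, SigmaFinite ((ν i).withDensity (f i))] :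
    Measure.pi (fun i => (ν i).withDensity (f i)) =
      (Measure.pi ν).withDensity fun x => ∏ i, f i (x i) := by
  refine Measure.pi_eq fun s hs => ?_
  rw [withDensity_apply _ (MeasurableSet.univ_pi hs), Measure.restrict_pi_pi, lintegral_pi_prod hf]
  exact Finset.prod_congr rfl fun i _ => (withDensity_apply _ (hs i)).symm

theorem lintegral_pi_stdComplexGaussian {F : (Fin N → ℝ) → ℝ≥0∞} (hF : Measurable F) :
    ∫⁻ g, F (fun i => ‖g i‖ ^ 2) ∂(Measure.pi fun _ : Fin N => stdComplexGaussian) =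
      ∫⁻ w in {w | ∀ i, 0 < w i}, F w * ENNReal.ofReal (Real.exp (-∑ i, w i)) := by
  have hprob : IsProbabilityMeasure (stdComplexGaussian.map fun x => ‖x‖ ^ 2) :=
    Measure.isProbabilityMeasure_map (Measurable.aemeasurable (by fun_prop))
  have h1 := Measure.pi_map_pi (ι := Fin N) (μ := fun _ => stdComplexGaussian)
    (f := fun _ x => ‖x‖ ^ 2) (fun _ => Measurable.aemeasurable (by fun_prop))
  have hm : Measurable fun s : ℝ => ind (0 < s) * ENNReal.ofReal (Real.exp (-s)) :=
    (measurable_ind measurableSet_Ioi).mul (by fun_prop)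
  have hmeas : MeasurableSet {w : Fin N → ℝ | ∀ i, 0 < w i} := by
    rw [Set.ofPred_forall]
    exact MeasurableSet.iInter fun i => measurableSet_lt measurable_const (measurable_pi_apply i)
  rw [map_norm_sq_stdComplexGaussian] at h1 hprob
  rw [pi_withDensity fun _ => hm] at h1
  have h2 := congrArg (fun μ => ∫⁻ w, F w ∂μ) h1
  have hmp : Measurable fun w : Fin N → ℝ =>
      ∏ i, ind (0 < w i) * ENNReal.ofReal (Real.exp (-w i)) :=
    Finset.measurable_prod _ fun i _ => hm.comp (measurable_pi_apply i)
  rw [lintegral_map hF (by fun_prop), lintegral_withDensity_eq_lintegral_mul _ hmp hF] at h2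
  rw [h2, ← lintegral_indicator hmeas, volume_pi]
  refine lintegral_congr fun w => ?_
  rw [Pi.mul_apply, Finset.prod_mul_distrib, ← ENNReal.ofReal_prod_of_nonneg
    fun i _ => (Real.exp_pos _).le, ← Real.exp_sum, Finset.sum_neg_distrib]
  by_cases hw : ∀ i, 0 < w i
  · rw [Set.indicator_of_mem (show w ∈ {w : Fin N → ℝ | ∀ i, 0 < w i} from hw),
      Finset.prod_eq_one fun i _ => ind_of (hw i)]
    ring
  · rw [Set.indicator_of_notMem (show w ∉ {w : Fin N → ℝ | ∀ i, 0 < w i} from hw)]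
    push Not at hw
    obtain ⟨i, hi⟩ := hw
    rw [Finset.prod_eq_zero (Finset.mem_univ i) (ind_of_not (not_lt.2 hi)), zero_mul, zero_mul]

end Gaussian

/-! ### The change of variables from the perturbation to the eigenvalues -/

section ChangeOfVariables

variable {N : ℕ}

/-- The eigenvalues as a function of the squared absolute values of the perturbing vector. -/
noncomputable def spSq (z w : Fin N → ℝ) : Fin N → ℝ :=
  sp (rankOnePerturb_isHermitian z fun i => (√(w i) : ℂ))

theorem prod_sub_spSq (z : Fin N → ℝ) {w : Fin N → ℝ} (hw : ∀ i, 0 ≤ w i) (t : ℝ) :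
    ∏ i, (t - spSq z w i) = secular z w t := by
  rw [spSq, prod_sub_sp_eq_secular]
  congr 1
  funext i
  rw [Complex.norm_real, Real.norm_eq_abs, sq_abs, Real.sq_sqrt (hw i)]

theorem antitone_spSq (z w : Fin N → ℝ) : Antitone (spSq z w) := antitone_sp _

theorem sp_eq_spSq (z : Fin N → ℝ) (g : Fin N → ℂ) :
    sp (rankOnePerturb_isHermitian z g) = spSq z fun i => ‖g i‖ ^ 2 :=
  eq_of_prod_sub_eq (antitone_sp _) (antitone_spSq _ _) fun t => by
    rw [prod_sub_sp_eq_secular, prod_sub_spSq z fun i => sq_nonneg _]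

theorem sum_spSq (z : Fin N → ℝ) {w : Fin N → ℝ} (hw : ∀ i, 0 ≤ w i) :
    ∑ i, spSq z w i = ∑ i, z i + ∑ i, w i := by
  rw [spSq, sum_sp_rankOnePerturb]
  congr 1
  refine Finset.sum_congr rfl fun i _ => ?_
  rw [Complex.norm_real, Real.norm_eq_abs, sq_abs, Real.sq_sqrt (hw i)]

theorem continuous_spSq (z : Fin N → ℝ) : Continuous (spSq z) := by
  have h : Continuous fun w : Fin N → ℝ => (z, fun i => ((√(w i) : ℝ) : ℂ)) := by fun_prop
  have := continuous_sp.comp h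
  unfold spSq
  exact this

/-- The squared absolute values of a vector whose perturbation of `diag(z)` has the spectrum `v`. -/
noncomputable def residues (z v : Fin N → ℝ) (i : Fin N) : ℝ :=
  -(∏ j, (z i - v j)) / ∏ j ∈ Finset.univ.erase i, (z i - z j)

theorem prod_erase_sub_ne_zero {z : Fin N → ℝ} (hz : Function.Injective z) (i : Fin N) :
    ∏ j ∈ Finset.univ.erase i, (z i - z j) ≠ 0 :=
  Finset.prod_ne_zero_iff.2 fun _ hj => sub_ne_zero.2 fun e =>
    (Finset.mem_erase.1 hj).1 (hz e).symm

/-- At `t = z i` a single term of the secular polynomial survives, and it reads off `w i`. -/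
theorem residues_spSq {z w : Fin N → ℝ} (hz : Function.Injective z) (hw : ∀ i, 0 ≤ w i) :
    residues z (spSq z w) = w := by
  funext i
  rw [residues, prod_sub_spSq z hw, secular_self, neg_neg,
    mul_div_cancel_right₀ _ (prod_erase_sub_ne_zero hz i)]

theorem StrictStrip.strictAnti {z v : Fin N → ℝ} (hz : Antitone z) (h : StrictStrip z v) :
    StrictAnti v := by
  intro i j hij
  have hj : j.1 ≠ 0 := by rw [Fin.lt_def] at hij; omega
  have h1 := h.2 ⟨j.1 - 1, by omega⟩ j (by simp only; omega)
  have h2 : z ⟨j.1 - 1, by omega⟩ ≤ z i := hz (by rw [Fin.le_def]; rw [Fin.lt_def] at hij; simp only; omega)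
  exact (h1.trans_le h2).trans (h.1 i)

/-- Strict interlacing puts `i + 1` negative factors in the numerator and `i` in the denominator,
and the minus sign in `residues` compensates for the difference. -/
theorem StrictStrip.residues_pos {z v : Fin N → ℝ} (hz : StrictAnti z) (h : StrictStrip z v)
    (i : Fin N) : 0 < residues z v i := by
  have hv := h.strictAnti hz.antitone
  have hlt : ∀ j, z i < v j ↔ j ≤ i := by
    intro j
    refine ⟨fun hj => ?_, fun hj => (h.1 i).trans_le (hv.antitone hj)⟩
    by_contra hij
    have hij' : i < j := not_le.1 hij
    have h1 := h.2 i ⟨i.1 + 1, by rw [Fin.lt_def] at hij'; omega⟩ rfl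
    have h2 : v j ≤ v ⟨i.1 + 1, by rw [Fin.lt_def] at hij'; omega⟩ :=
      hv.antitone (by rw [Fin.le_def]; rw [Fin.lt_def] at hij'; simp only; omega)
    linarith
  have hne : ∀ j, z i ≠ v j := by
    intro j hj
    by_cases hij : j ≤ i
    · exact ((hlt j).2 hij).ne hj
    · have hij' : i < j := not_le.1 hij
      have h1 := h.2 i ⟨i.1 + 1, by rw [Fin.lt_def] at hij'; omega⟩ rfl
      have h2 : v j ≤ v ⟨i.1 + 1, by rw [Fin.lt_def] at hij'; omega⟩ :=
        hv.antitone (by rw [Fin.le_def]; rw [Fin.lt_def] at hij'; simp only; omega)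
      linarith
  have h1 := prod_sub_mul_neg_one_pow_pos Finset.univ v (t := z i) fun j _ => hne j
  have h2 := prod_sub_mul_neg_one_pow_pos (Finset.univ.erase i) z (t := z i) fun j hj e =>
    (Finset.mem_erase.1 hj).1 (hz.injective e).symm
  have e1 : (Finset.univ.filter fun j => z i < v j) = Finset.Iic i := by
    ext j
    simp [hlt]
  have e2 : ((Finset.univ.erase i).filter fun j => z i < z j) = Finset.Iio i := by
    ext j
    simp only [Finset.mem_filter, Finset.mem_erase, Finset.mem_univ, and_true, Finset.mem_Iio,
      hz.lt_iff_gt]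
    exact ⟨fun h => h.2, fun h => ⟨h.ne, h⟩⟩
  rw [e1, Fin.card_Iic, pow_succ] at h1
  rw [e2, Fin.card_Iio] at h2
  rw [residues]
  rcases neg_one_pow_eq_or ℝ (i : ℕ) with hs | hs
  · rw [hs] at h1 h2
    exact div_pos (by linarith) (by linarith)
  · rw [hs] at h1 h2
    exact div_pos_of_neg_of_neg (by linarith) (by linarith)

/-- Equal residues mean that two monic polynomials of degree `N` agree at the `N` points `z i`; then
they coincide, and so do their ordered roots. -/
theorem residues_injOn {z : Fin N → ℝ} (hz : Function.Injective z) :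
    Set.InjOn (residues z) {v | Antitone v} := by
  intro u hu v hv huv
  refine eq_of_prod_sub_eq hu hv fun t => ?_
  have hnat : ∀ v : Fin N → ℝ, Polynomial.degree (∏ i, (Polynomial.X - Polynomial.C (v i))) =
      ((N : ℕ) : WithBot ℕ) := fun v => by
    rw [Polynomial.degree_prod]
    simp
  have hp : ∏ i, (Polynomial.X - Polynomial.C (u i)) = ∏ i, (Polynomial.X - Polynomial.C (v i)) := by
    refine Polynomial.eq_of_degree_sub_lt_of_eval_index_eq (v := z) Finset.univ hz.injOn
      ?_ ?_
    · refine (Polynomial.degree_sub_lt_left ((hnat u).trans (hnat v).symm)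
        (Polynomial.monic_prod_X_sub_C u Finset.univ).ne_zero ?_).trans_eq ?_
      · rw [(Polynomial.monic_prod_X_sub_C u Finset.univ).leadingCoeff,
          (Polynomial.monic_prod_X_sub_C v Finset.univ).leadingCoeff]
      · rw [hnat]
        simp
    · intro i _
      have := congrFun huv i
      rw [residues, residues, div_left_inj' (prod_erase_sub_ne_zero hz i), neg_inj] at this
      simpa [Polynomial.eval_prod] using this
  have := congrArg (Polynomial.eval t) hp
  simpa [Polynomial.eval_prod] using this

theorem image_residues {z : Fin N → ℝ} (hz : StrictAnti z) :
    residues z '' {v | StrictStrip z v} = {w | ∀ i, 0 < w i} := by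
  ext w
  constructor
  · rintro ⟨v, hv, rfl⟩
    exact fun i => StrictStrip.residues_pos hz hv i
  · intro hw
    have hw' : ∀ i, 0 ≤ w i := fun i => (hw i).le
    exact ⟨spSq z w, strictStrip_of_prod_sub_eq_secular hz hw (antitone_spSq z w)
      (prod_sub_spSq z hw'), residues_spSq hz.injective hw'⟩

theorem spSq_residues {z v : Fin N → ℝ} (hz : StrictAnti z) (hv : StrictStrip z v) :
    spSq z (residues z v) = v :=
  residues_injOn hz.injective (antitone_spSq _ _) (hv.strictAnti hz.antitone).antitone
    (residues_spSq hz.injective fun i => (hv.residues_pos hz i).le)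

/-- Each column evaluates a polynomial of degree below `N` at the `z i`, so the matrix is a
Vandermonde matrix times a coefficient matrix that depends on `v` alone. -/
theorem det_prod_erase_sub (v : Fin N → ℝ) : ∃ d : ℝ, ∀ z : Fin N → ℝ,
    (Matrix.of fun i k => ∏ j ∈ Finset.univ.erase k, (z i - v j)).det = vandermondePos z * d := by
  refine ⟨(Matrix.of fun m k : Fin N =>
    (∏ j ∈ Finset.univ.erase k, (Polynomial.X - Polynomial.C (v j))).coeff m).det, fun z => ?_⟩
  have hv : vandermondePos z = (Matrix.vandermonde z).det := (Matrix.det_vandermonde z).symm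
  rw [hv, ← Matrix.det_mul]
  congr 1
  ext i k
  have hdeg : (∏ j ∈ Finset.univ.erase k, (Polynomial.X - Polynomial.C (v j))).natDegree < N := by
    rw [Polynomial.natDegree_prod_of_monic _ _ fun j _ => Polynomial.monic_X_sub_C _]
    have := k.2
    simp
    omega
  have := Polynomial.eval_eq_sum_range' hdeg (z i)
  rw [Polynomial.eval_prod] at this
  simp only [Polynomial.eval_sub, Polynomial.eval_X, Polynomial.eval_C] at this
  rw [Matrix.of_apply, this, Matrix.mul_apply, Finset.sum_range]
  exact Finset.sum_congr rfl fun m _ => by simp [Matrix.vandermonde_apply, mul_comm]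

theorem abs_prod_prod_erase (v : Fin N → ℝ) :
    ∏ i, |∏ j ∈ Finset.univ.erase i, (v i - v j)| = vandermondePos v ^ 2 := by
  have h := Finset.prod_prod_Ioi_mul_eq_prod_prod_off_diag fun j i : Fin N => |v i - v j|
  have h2 : ∏ i, |∏ j ∈ Finset.univ.erase i, (v i - v j)| = ∏ i, ∏ j ∈ {i}ᶜ, |v i - v j| := by
    refine Finset.prod_congr rfl fun i _ => ?_
    rw [Finset.abs_prod]
    congr 1
    ext j
    simp
  rw [h2, ← h, vandermondePos, ← Finset.prod_pow]
  refine Finset.prod_congr rfl fun i _ => ?_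
  rw [← Finset.prod_pow]
  refine Finset.prod_congr rfl fun j _ => ?_
  rw [abs_sub_comm, ← abs_mul, ← sq, abs_of_nonneg (sq_nonneg _)]

/-- The constant `d` does not depend on `z`, so it can be found at `z = v`, where the matrix is
diagonal. -/
theorem abs_det_prod_erase_sub (z : Fin N → ℝ) {v : Fin N → ℝ} (hv : Function.Injective v) :
    |(Matrix.of fun i k => ∏ j ∈ Finset.univ.erase k, (z i - v j)).det| =
      |vandermondePos z| * |vandermondePos v| := by
  obtain ⟨d, hd⟩ := det_prod_erase_sub v
  have h1 : |(Matrix.of fun i k => ∏ j ∈ Finset.univ.erase k, (v i - v j)).det| =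
      vandermondePos v ^ 2 := by
    have : (Matrix.of fun i k => ∏ j ∈ Finset.univ.erase k, (v i - v j)) =
        Matrix.diagonal fun k => ∏ j ∈ Finset.univ.erase k, (v k - v j) := by
      ext i k
      by_cases hik : i = k
      · subst hik; simp
      · rw [Matrix.diagonal_apply_ne _ hik, Matrix.of_apply]
        exact Finset.prod_eq_zero (Finset.mem_erase.2 ⟨hik, Finset.mem_univ i⟩) (sub_self _)
    rw [this, Matrix.det_diagonal, Finset.abs_prod, abs_prod_prod_erase]
  rw [hd, abs_mul, ← sq_abs (vandermondePos v)] at h1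
  have h2 : |vandermondePos v| ≠ 0 := abs_ne_zero.2 (vandermondePos_ne_zero hv)
  have h3 : |d| = |vandermondePos v| := by
    rw [sq] at h1
    exact mul_left_cancel₀ h2 h1
  rw [hd, abs_mul, h3]

/-- The Jacobian matrix of `residues z` at `v`. -/
noncomputable def residuesJacobian (z v : Fin N → ℝ) : Matrix (Fin N) (Fin N) ℝ :=
  Matrix.of fun i k => (∏ j ∈ Finset.univ.erase i, (z i - z j))⁻¹ *
    (Matrix.of fun i k => ∏ j ∈ Finset.univ.erase k, (z i - v j)) i k

theorem hasFDerivAt_residues (z v : Fin N → ℝ) :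
    HasFDerivAt (residues z) (Matrix.toLin' (residuesJacobian z v)).toContinuousLinearMap v := by
  rw [hasFDerivAt_pi']
  intro i
  have h1 : ∀ j ∈ (Finset.univ : Finset (Fin N)),
      HasFDerivAt (fun v : Fin N → ℝ => z i - v j)
        (-(ContinuousLinearMap.proj j : (Fin N → ℝ) →L[ℝ] ℝ)) v := fun j _ =>
    (hasFDerivAt_apply j v).const_sub (z i)
  have h2 := ((HasFDerivAt.finsetProd h1).neg.mul_const
    (∏ j ∈ Finset.univ.erase i, (z i - z j))⁻¹)
  have e : (fun v : Fin N → ℝ => residues z v i) = fun v =>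
      (-fun v : Fin N → ℝ => ∏ j, (z i - v j)) v * (∏ j ∈ Finset.univ.erase i, (z i - z j))⁻¹ := by
    funext v
    rw [residues, div_eq_mul_inv]
    rfl
  rw [e]
  refine h2.congr_fderiv ?_
  ext x
  simp only [residuesJacobian, smul_apply, neg_apply,
    sum_apply, ContinuousLinearMap.comp_apply,
    ContinuousLinearMap.proj_apply, LinearMap.coe_toContinuousLinearMap', Matrix.toLin'_apply,
    Matrix.mulVec, dotProduct, Matrix.of_apply, smul_eq_mul]
  rw [← Finset.sum_neg_distrib, Finset.mul_sum]
  refine Finset.sum_congr rfl fun k _ => ?_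
  ring

theorem abs_det_residuesJacobian {z v : Fin N → ℝ} (hz : Function.Injective z)
    (hv : Function.Injective v) :
    |(residuesJacobian z v).det| = |vandermondePos v| / |vandermondePos z| := by
  rw [residuesJacobian, Matrix.det_mul_column, abs_mul, abs_det_prod_erase_sub z hv,
    Finset.abs_prod]
  simp only [abs_inv]
  rw [Finset.prod_inv_distrib, abs_prod_prod_erase, ← sq_abs]
  have := abs_ne_zero.2 (vandermondePos_ne_zero hz)
  field_simp

theorem gtDet_zero_div {z v : Fin N → ℝ} (hz : StrictAnti z) (hv : StrictAnti v) :
    gtDet 0 v / gtDet 0 z = |vandermondePos v| / |vandermondePos z| := by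
  rw [← abs_of_pos (gtDet_zero_pos hz), ← abs_of_pos (gtDet_zero_pos hv), gtDet, gtDet, abs_mul,
    abs_mul]
  have h : ∀ z, hDet (0 : Fin N → ℝ) z = hDet (0 : Fin N → ℝ) 0 := fun z => by
    rw [hDet_zero, hDet_zero]
  rw [h z, h v, mul_div_mul_right _ _ (abs_ne_zero.2 hDet_zero_ne_zero)]

theorem measurableSet_strictStrip (z : Fin N → ℝ) : MeasurableSet {v | StrictStrip z v} := by
  have : {v | StrictStrip z v} = (⋂ i, {v | z i < v i}) ∩
      ⋂ (i : Fin N) (j : Fin N) (_ : i.1 + 1 = j.1), {v | v j < z i} := by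
    ext v
    simp [StrictStrip]
  rw [this]
  refine (MeasurableSet.iInter fun i => measurableSet_lt measurable_const
    (measurable_pi_apply i)).inter (MeasurableSet.iInter fun i => MeasurableSet.iInter fun j =>
      MeasurableSet.iInter fun _ => measurableSet_lt (measurable_pi_apply j) measurable_const)

theorem hStrip_iff_strictStrip_ae (z : Fin N → ℝ) : ∀ᵐ v : Fin N → ℝ, HStrip z v ↔ StrictStrip z v := by
  have h : ∀ i j : Fin N, ∀ᵐ v : Fin N → ℝ, v i ≠ z j := fun i j => by
    rw [volume_pi]
    exact Measure.ae_eval_ne (μ := fun _ : Fin N => (volume : Measure ℝ)) i (z j)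
  filter_upwards [ae_all_iff.2 fun i => ae_all_iff.2 fun j => h i j] with v hv
  exact ⟨fun h => ⟨fun i => lt_of_le_of_ne (h.1 i) (hv i i).symm,
    fun i j hij => lt_of_le_of_ne (h.2 i j hij) (hv j i)⟩,
    fun h => ⟨fun i => (h.1 i).le, fun i j hij => (h.2 i j hij).le⟩⟩

/-- Substitute `w = residues z v` in the law of the squared absolute values. The Jacobian is the
quotient of Vandermonde products, and by the trace the sum of `w` is the increment of the eigenvalue
sum. -/
theorem lintegral_sp {z : Fin N → ℝ} (hz : StrictAnti z) {F : (Fin N → ℝ) → ℝ≥0∞}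
    (hF : Measurable F) :
    ∫⁻ g, F (sp (rankOnePerturb_isHermitian z g)) ∂(Measure.pi fun _ : Fin N => stdComplexGaussian) =
      ∫⁻ v, ind (HStrip z v) *
        ENNReal.ofReal (gtDet 0 v / gtDet 0 z * Real.exp (-(∑ i, v i - ∑ i, z i))) * F v := by
  simp only [sp_eq_spSq]
  rw [lintegral_pi_stdComplexGaussian (F := fun w => F (spSq z w))
    (hF.comp (continuous_spSq z).measurable), ← image_residues hz,
    lintegral_image_eq_lintegral_abs_det_fderiv_mul volume (measurableSet_strictStrip z)
      (fun v _ => (hasFDerivAt_residues z v).hasFDerivWithinAt)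
      ((residues_injOn hz.injective).mono fun v hv =>
        (StrictStrip.strictAnti hz.antitone hv).antitone),
    ← lintegral_indicator (measurableSet_strictStrip z)]
  refine lintegral_congr_ae ?_
  filter_upwards [hStrip_iff_strictStrip_ae z] with v hv
  by_cases h : StrictStrip z v
  · have hs := h.strictAnti hz.antitone
    rw [Set.indicator_of_mem (show v ∈ {v | StrictStrip z v} from h), ind_of (hv.2 h), one_mul,
      spSq_residues hz h, gtDet_zero_div hz hs, ContinuousLinearMap.det,
      LinearMap.coe_toContinuousLinearMap, LinearMap.det_toLin',
      abs_det_residuesJacobian hz.injective hs.injective, ENNReal.ofReal_mul (by positivity)]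
    have hsum := sum_spSq z fun i => (h.residues_pos hz i).le
    rw [spSq_residues hz h] at hsum
    have : ∑ i, residues z v i = ∑ i, v i - ∑ i, z i := by linarith
    rw [this]
    ring
  · rw [Set.indicator_of_notMem (show v ∉ {v | StrictStrip z v} from h),
      ind_of_not (fun h' => h (hv.1 h')), zero_mul, zero_mul]

end ChangeOfVariables

/-! ### The transition kernels -/

section TransitionQ

variable {N : ℕ}

theorem expMeasure_eq_withDensity {p c : ℝ} (h : 0 ≤ p + c) :
    expMeasure (p + c) = volume.withDensity fun t =>
      ind (0 ≤ t) * (ENNReal.ofReal (p + c) * (expWeight p t * expWeight c t)) := by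
  change volume.withDensity (exponentialPDF (p + c)) = _
  congr 1
  funext t
  rw [exponentialPDF_eq]
  by_cases ht : 0 ≤ t
  · rw [if_pos ht, ind_of ht, one_mul, expWeight, expWeight, ← ENNReal.ofReal_mul (Real.exp_pos _).le,
      ← Real.exp_add, ← ENNReal.ofReal_mul h]
    ring_nf
  · rw [if_neg ht, ind_of_not ht, zero_mul, ENNReal.ofReal_zero]

/-- The density of `transitionQ` with respect to the law of the Gaussian vector. -/
noncomputable def transitionDensity (π : Fin N → ℝ) (c : ℝ) (z z' : Fin N → ℝ) : ℝ :=
  (∏ i, (π i + c)) * (hNorm π z' / hNorm π z) * Real.exp (-((c - 1) * (∑ i, z' i - ∑ i, z i)))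

theorem measurable_transitionDensity (π : Fin N → ℝ) (c : ℝ) :
    Measurable fun p : (Fin N → ℝ) × (Fin N → ℝ) => transitionDensity π c p.1 p.2 := by
  have h : Measurable (hNorm π) :=
    (continuous_hNorm.comp (continuous_const.prodMk continuous_id)).measurable
  unfold transitionDensity
  exact (((h.comp measurable_snd).div (h.comp measurable_fst)).const_mul _).mul (by fun_prop)

theorem measurable_sp (z : Fin N → ℝ) :
    Measurable fun g : Fin N → ℂ => sp (rankOnePerturb_isHermitian z g) :=
  (continuous_sp.comp (continuous_const.prodMk continuous_id)).measurable

theorem continuous_sp_left (g : Fin N → ℂ) :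
    Continuous fun z : Fin N → ℝ => sp (rankOnePerturb_isHermitian z g) := by
  have h : Continuous fun z : Fin N → ℝ => (z, g) := by fun_prop
  have := continuous_sp.comp h
  exact this

theorem lintegral_transitionQ (π : Fin N → ℝ) (c : ℝ) (z : Fin N → ℝ) {f : (Fin N → ℝ) → ℝ≥0∞}
    (hf : Measurable f) :
    ∫⁻ z', f z' ∂(transitionQ π c z) =
      ∫⁻ g, ENNReal.ofReal (transitionDensity π c z (sp (rankOnePerturb_isHermitian z g))) *
        f (sp (rankOnePerturb_isHermitian z g)) ∂(Measure.pi fun _ : Fin N => stdComplexGaussian) := by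
  have e : (fun z' => ENNReal.ofReal
      ((∏ i, (π i + c)) * (hFun π z' / hFun π z) * Real.exp (-((c - 1) * ∑ i, (z' i - z i))))) =
      fun z' => ENNReal.ofReal (transitionDensity π c z z') := by
    funext z'
    rw [hFun_div_hFun, transitionDensity, Finset.sum_sub_distrib]
  have hm : Measurable fun z' => ENNReal.ofReal (transitionDensity π c z z') :=
    ((measurable_transitionDensity π c).comp measurable_prodMk_left).ennreal_ofReal
  rw [transitionQ, e, lintegral_withDensity_eq_lintegral_mul _ hm hf, baseQ,
    lintegral_map (hm.mul hf) (measurable_sp z)]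
  rfl

theorem measurable_lintegral_transitionQ (π : Fin N → ℝ) (c : ℝ) {f : (Fin N → ℝ) → ℝ≥0∞}
    (hf : Measurable f) : Measurable fun z => ∫⁻ z', f z' ∂(transitionQ π c z) := by
  simp only [lintegral_transitionQ π c _ hf]
  have hs : Measurable fun p : (Fin N → ℝ) × (Fin N → ℂ) =>
      sp (rankOnePerturb_isHermitian p.1 p.2) := continuous_sp.measurable
  refine Measurable.lintegral_prod_right' (f := fun p : (Fin N → ℝ) × (Fin N → ℂ) =>
    ENNReal.ofReal (transitionDensity π c p.1 (sp (rankOnePerturb_isHermitian p.1 p.2))) *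
        f (sp (rankOnePerturb_isHermitian p.1 p.2))) ?_
  exact ((measurable_transitionDensity π c).comp
    (measurable_fst.prodMk hs)).ennreal_ofReal.mul (hf.comp hs)

theorem transitionQ_compl_chamber (π : Fin N → ℝ) (c : ℝ) (z : Fin N → ℝ) :
    transitionQ π c z (chamber N)ᶜ = 0 := by
  refine withDensity_absolutelyContinuous _ _ ?_
  have hS : MeasurableSet (chamber N) := by
    have : chamber N = ⋂ (i : Fin N) (j : Fin N) (_ : i ≤ j), {x | x j ≤ x i} := by
      ext x
      simp [chamber, Antitone]
    rw [this]
    exact MeasurableSet.iInter fun i => MeasurableSet.iInter fun j => MeasurableSet.iInter fun _ =>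
      measurableSet_le (measurable_pi_apply j) (measurable_pi_apply i)
  rw [baseQ, Measure.map_apply (measurable_sp z) hS.compl]
  have : (fun g : Fin N → ℂ => sp (rankOnePerturb_isHermitian z g)) ⁻¹' (chamber N)ᶜ = ∅ := by
    ext g
    simp only [Set.mem_preimage, Set.mem_compl_iff, Set.mem_empty_iff_false, iff_false, not_not]
    exact antitone_sp _
  rw [this, measure_empty]

theorem HStrip.gtInt_eq {π : ℕ → ℝ} {z z' : Fin N → ℝ} (h : HStrip z z') :
    gtInt volume (fun k => expWeight (π k)) N z' 1 =
      ENNReal.ofReal (gtDet 0 z' * hNorm (fun i : Fin N => π i) z') := by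
  rw [gtInt_one_eq_gtDet π h.antitone.2, gtDet_eq_hNorm]

/-- The quotient of Vandermonde products times that of `hNorm` is the quotient of the pattern
masses, and `e ^ (-s)` times `e ^ (-(c - 1) s)` is `e ^ (-c s)`. The result is the kernel of the
intertwining relation. -/
theorem lintegral_transitionQ_of_strictAnti {π : ℕ → ℝ} (hπ : ∀ i, 0 < π i) {c : ℝ} (hc : 0 ≤ c)
    {z : Fin N → ℝ} (hz : StrictAnti z) {f : (Fin N → ℝ) → ℝ≥0∞} (hf : Measurable f) :
    ∫⁻ z', f z' ∂(transitionQ (fun i : Fin N => π i) c z) =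
      (∫⁻ z', ind (HStrip z z') *
        ((∏ k : Fin N, ENNReal.ofReal (π k + c)) * expWeight c (∑ i, z' i - ∑ i, z i)) *
        (f z' * gtInt volume (fun k => expWeight (π k)) N z' 1)
        ∂(Measure.pi fun _ => volume)) / gtInt volume (fun k => expWeight (π k)) N z 1 := by
  have hm : Measurable fun z' =>
      ENNReal.ofReal (transitionDensity (fun i : Fin N => π i) c z z') :=
    ((measurable_transitionDensity _ c).comp measurable_prodMk_left).ennreal_ofReal
  rw [lintegral_transitionQ _ _ _ hf, lintegral_sp hz
    (F := fun z' => ENNReal.ofReal (transitionDensity (fun i : Fin N => π i) c z z') * f z')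
    (hm.mul hf), gtInt_one_eq_gtDet π hz.antitone, ENNReal.div_eq_inv_mul, volume_pi]
  have hpos := gtDet_zero_pos hz
  have hN := hNorm_pos (fun i : Fin N => π i) hz.antitone
  have hgt : 0 < gtDet (fun i : Fin N => π i) z := by
    rw [gtDet_eq_hNorm]
    exact mul_pos hpos hN
  rw [← lintegral_const_mul' _ _ (ENNReal.inv_ne_top.2 (ENNReal.ofReal_pos.2 hgt).ne')]
  refine lintegral_congr fun z' => ?_
  by_cases h : HStrip z z'
  · have hz' := h.antitone.2
    rw [ind_of h, one_mul, one_mul, h.gtInt_eq, ← ENNReal.ofReal_inv_of_pos hgt, expWeight,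
      ← ENNReal.ofReal_prod_of_nonneg (s := Finset.univ) (f := fun k : Fin N => π k + c)
        fun i _ => add_nonneg (hπ i).le hc]
    have h1 : 0 ≤ ∏ i : Fin N, (π i + c) := Finset.prod_nonneg fun i _ => add_nonneg (hπ i).le hc
    have h2 : 0 ≤ gtDet 0 z' := gtDet_nonneg 0 hz'
    have h3 := hNorm_pos (fun i : Fin N => π i) hz'
    have e1 : ∀ a b c d e : ℝ≥0∞, a * (b * c * (d * e)) = a * b * c * e * d := fun a b c d e => by ring
    rw [e1, ← mul_assoc, ← ENNReal.ofReal_mul (by positivity), ← ENNReal.ofReal_mul (by positivity),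
      ← ENNReal.ofReal_mul (by positivity), ← ENNReal.ofReal_mul (by positivity)]
    congr 2
    rw [transitionDensity, gtDet_eq_hNorm (fun i : Fin N => π i) z]
    have e2 : Real.exp (-(c * (∑ i, z' i - ∑ i, z i))) =
        Real.exp (-(∑ i, z' i - ∑ i, z i)) * Real.exp (-((c - 1) * (∑ i, z' i - ∑ i, z i))) := by
      rw [← Real.exp_add]
      ring_nf
    rw [e2]
    field_simp
  · rw [ind_of_not h]
    simp

/-- Conservation of mass is the intertwining relation for the constant function, inserting a column
of probability laws. -/
theorem transitionQ_univ_of_strictAnti {π : ℕ → ℝ} (hπ : ∀ i, 0 < π i) {c : ℝ} (hc : 0 ≤ c)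
    {z : Fin N → ℝ} (hz : StrictAnti z) :
    transitionQ (fun i : Fin N => π i) c z Set.univ = 1 := by
  have hp : ∀ k, IsProbabilityMeasure (expMeasure (π k + c)) := fun k =>
    isProbabilityMeasure_expMeasure (add_pos_of_pos_of_nonneg (hπ k) hc)
  have h := lintegral_transitionQ_of_strictAnti hπ hc hz (f := fun _ => 1) measurable_const
  have h2 := gtInt_patternInsert (μ := (volume : Measure ℝ)) (N := N)
    (E := fun k => expWeight (π k)) (B := expWeight c)
    (C := fun k => ENNReal.ofReal (π k + c)) (ν := fun k => expMeasure (π k + c))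
    (fun c => measurePreserving_add_left _ c) (fun c => Measure.measurePreserving_sub_left _ c)
    (fun k => measurable_expWeight _) (fun k x y => expWeight_add _ x y) (measurable_expWeight c)
    (fun x y => expWeight_add _ x y) (by simp [expWeight])
    (fun k _ => expMeasure_eq_withDensity (add_nonneg (hπ k).le hc)) z
    (f := fun _ => 1) measurable_const
  simp only [lintegral_const, measure_univ, one_mul] at h h2
  rw [h]
  have h3 : (fun _ : Triangle N ℝ => (1 : ℝ≥0∞)) = 1 := rfl
  rw [h3] at h2
  rw [← h2]
  refine ENNReal.div_self ?_ (gtInt_expWeight_ne_top π z)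
  rw [gtInt_one_eq_gtDet π hz.antitone, gtDet_eq_hNorm]
  exact (ENNReal.ofReal_pos.2 (mul_pos (gtDet_zero_pos hz) (hNorm_pos _ hz.antitone))).ne'

theorem lintegral_exp_norm_sq_lt_top {q : ℝ} (hq : 0 < q) :
    ∫⁻ g, ENNReal.ofReal (Real.exp (-((q - 1) * ∑ i, ‖g i‖ ^ 2)))
      ∂(Measure.pi fun _ : Fin N => stdComplexGaussian) < ∞ := by
  have hm : Measurable fun w : Fin N → ℝ => ENNReal.ofReal (Real.exp (-((q - 1) * ∑ i, w i))) := by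
    fun_prop
  have hm1 : Measurable fun t : ℝ => ind (0 < t) * ENNReal.ofReal (Real.exp (-q * t)) :=
    (measurable_ind measurableSet_Ioi).mul (by fun_prop)
  have hmeas : MeasurableSet {w : Fin N → ℝ | ∀ i, 0 < w i} := by
    rw [Set.ofPred_forall]
    exact MeasurableSet.iInter fun i => measurableSet_lt measurable_const (measurable_pi_apply i)
  rw [lintegral_pi_stdComplexGaussian hm, ← lintegral_indicator hmeas]
  have h1 : ∫⁻ t, ind (0 < t) * ENNReal.ofReal (Real.exp (-q * t)) < ∞ := by
    refine lt_of_eq_of_lt ?_ (exp_neg_integrableOn_Ioi 0 hq).lintegral_lt_top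
    rw [← lintegral_indicator measurableSet_Ioi]
    refine lintegral_congr fun t => ?_
    by_cases ht : 0 < t
    · rw [ind_of ht, Set.indicator_of_mem (Set.mem_Ioi.2 ht), one_mul]
    · rw [ind_of_not ht, Set.indicator_of_notMem (mt Set.mem_Ioi.1 ht), zero_mul]
  have h2 : ∫⁻ w : Fin N → ℝ, ∏ i, (ind (0 < w i) * ENNReal.ofReal (Real.exp (-q * w i))) < ∞ := by
    rw [volume_pi, lintegral_pi_prod fun _ => hm1]
    exact ENNReal.prod_lt_top fun i _ => h1
  refine lt_of_le_of_lt (lintegral_mono fun w => ?_) h2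
  by_cases hw : ∀ i, 0 < w i
  · rw [Set.indicator_of_mem (show w ∈ {w : Fin N → ℝ | ∀ i, 0 < w i} from hw),
      Finset.prod_mul_distrib, Finset.prod_eq_one fun i _ => ind_of (hw i), one_mul,
      ← ENNReal.ofReal_prod_of_nonneg fun i _ => (Real.exp_pos _).le, ← Real.exp_sum,
      ← ENNReal.ofReal_mul (Real.exp_pos _).le, ← Real.exp_add, ← Finset.mul_sum]
    refine le_of_eq ?_
    ring_nf
  · rw [Set.indicator_of_notMem (show w ∉ {w : Fin N → ℝ | ∀ i, 0 < w i} from hw)]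
    exact zero_le

theorem exists_pos_le (π : Fin N → ℝ) (hπ : ∀ i, 0 < π i) : ∃ p, 0 < p ∧ ∀ i, p ≤ π i := by
  rcases isEmpty_or_nonempty (Fin N) with h | h
  · exact ⟨1, one_pos, fun i => h.elim i⟩
  · obtain ⟨i, hi⟩ := Finite.exists_min π
    exact ⟨π i, hπ i, hi⟩

theorem continuousAt_transitionDensity (π : Fin N → ℝ) (c : ℝ) {z : Fin N → ℝ} (hz : Antitone z)
    {S : (Fin N → ℝ) → Fin N → ℝ} (hS : Continuous S) :
    ContinuousAt (fun z : Fin N → ℝ => transitionDensity π c z (S z)) z := by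
  have h : Continuous (hNorm π) := continuous_hNorm.comp (continuous_const.prodMk continuous_id)
  unfold transitionDensity
  refine ContinuousAt.mul (ContinuousAt.mul continuousAt_const ?_) ?_
  · exact (h.comp hS).continuousAt.div h.continuousAt (hNorm_pos π hz).ne'
  · fun_prop

/-- The transition kernels have the Feller property on the chamber. -/
theorem tendsto_lintegral_transitionQ {π : Fin N → ℝ} (hπ : ∀ i, 0 < π i) {c : ℝ} (hc : 0 ≤ c)
    {z : Fin N → ℝ} (hz : Antitone z) (f : BoundedContinuousFunction (Fin N → ℝ) ℝ≥0) :
    Tendsto (fun z => ∫⁻ z', f z' ∂(transitionQ π c z)) (𝓝[chamber N] z)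
      (𝓝 (∫⁻ z', f z' ∂(transitionQ π c z))) := by
  have hf : Measurable fun z => (f z : ℝ≥0∞) := f.continuous.measurable.coe_nnreal_ennreal
  simp only [lintegral_transitionQ π c _ hf]
  obtain ⟨p, hp, hpπ⟩ := exists_pos_le π hπ
  set A : ℝ := ‖π‖ with hA
  have hπA : ∀ i, p ≤ π i ∧ π i ≤ A := fun i => ⟨hpπ i, (le_abs_self _).trans (norm_le_pi_norm π i)⟩
  set r : ℝ := ‖z‖ + 1 with hr
  have hr0 : 0 ≤ r := by positivity
  have hhz := hNorm_pos π hz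
  obtain ⟨M, hM⟩ : ∃ M : ℝ≥0, ∀ x, f x ≤ M := ⟨nndist f 0, fun x => by
    have := BoundedContinuousFunction.nndist_coe_le_nndist (f := f) (g := 0) x
    simpa using this⟩
  -- Near `z` the denominator is at least half of `hNorm π z`, and `e ^ (p N r)` bounds the part of
  -- `hNorm_upper_bound` that involves the sum of the starting point.
  set K : ℝ := (∏ i, (π i + c)) * (Real.exp (N * ((A - p) * (r + 1))) * Real.exp (p * (N * r)) /
    (hNorm π z / 2)) with hK
  have hprod : 0 ≤ ∏ i, (π i + c) := Finset.prod_nonneg fun i _ => add_nonneg (hπ i).le hc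
  have hcont : Continuous (hNorm π) := continuous_hNorm.comp (continuous_const.prodMk continuous_id)
  have hev : ∀ᶠ y in 𝓝[chamber N] z, Antitone y ∧ ‖y‖ ≤ r ∧ hNorm π z / 2 ≤ hNorm π y := by
    have h1 : ∀ᶠ y in 𝓝 z, ‖y‖ < r :=
      continuous_norm.continuousAt.eventually (gt_mem_nhds (lt_add_one ‖z‖))
    have h2 : ∀ᶠ y in 𝓝 z, hNorm π z / 2 < hNorm π y :=
      hcont.continuousAt.eventually (lt_mem_nhds (half_lt_self hhz))
    filter_upwards [self_mem_nhdsWithin, nhdsWithin_le_nhds h1, nhdsWithin_le_nhds h2] with y a b d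
    exact ⟨a, b.le, d.le⟩
  have hbound : ∀ y : Fin N → ℝ, Antitone y ∧ ‖y‖ ≤ r ∧ hNorm π z / 2 ≤ hNorm π y →
      ∀ g, transitionDensity π c y (sp (rankOnePerturb_isHermitian y g)) ≤
        K * Real.exp (-((p + c - 1) * ∑ i, ‖g i‖ ^ 2)) := by
    rintro y ⟨hy, hyr, hyh⟩ g
    have hyi : ∀ i, |y i| ≤ r := fun i => (norm_le_pi_norm y i).trans hyr
    have hsum := sum_sp_rankOnePerturb y g
    have h1 : hNorm π (sp (rankOnePerturb_isHermitian y g)) ≤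
        Real.exp (N * ((A - p) * (r + 1))) * Real.exp (p * (N * r)) *
        Real.exp (-(p * ∑ i, ‖g i‖ ^ 2)) := by
      refine (hNorm_upper_bound hr0 π hπA (antitone_sp _) (le_sp fun i => (abs_le.1 (hyi i)).1)).trans ?_
      rw [mul_assoc, ← Real.exp_add (p * (N * r))]
      refine mul_le_mul_of_nonneg_left (Real.exp_le_exp.2 ?_) (Real.exp_pos _).le
      rw [hsum]
      have : -(N * r) ≤ ∑ i, y i := by
        have := Finset.sum_le_sum fun i (_ : i ∈ Finset.univ) => (abs_le.1 (hyi i)).1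
        simpa using this
      nlinarith
    have hyp : 0 < hNorm π y := hNorm_pos π hy
    rw [transitionDensity, hsum, add_sub_cancel_left, hK]
    -- The decay of `hNorm` supplies the exponent `p`. This keeps the bound integrable against the
    -- Gaussian law, since `p + c > 0` even when `c = 0`.
    have e : Real.exp (-((p + c - 1) * ∑ i, ‖g i‖ ^ 2)) = Real.exp (-(p * ∑ i, ‖g i‖ ^ 2)) *
        Real.exp (-((c - 1) * ∑ i, ‖g i‖ ^ 2)) := by
      rw [← Real.exp_add]
      ring_nf
    rw [e, ← mul_assoc _ (Real.exp _) (Real.exp _)]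
    refine mul_le_mul_of_nonneg_right ?_ (Real.exp_pos _).le
    rw [mul_assoc (∏ i, (π i + c)), div_mul_eq_mul_div]
    exact mul_le_mul_of_nonneg_left (div_le_div₀ (by positivity) h1 (by positivity) hyh) hprod
  refine tendsto_lintegral_filter_of_dominated_convergence
    (fun g => ENNReal.ofReal (K * Real.exp (-((p + c - 1) * ∑ i, ‖g i‖ ^ 2))) * M) ?_ ?_ ?_ ?_
  · refine Eventually.of_forall fun y => ?_
    have hm := ((measurable_transitionDensity π c).comp
      (measurable_prodMk_left (x := y))).ennreal_ofReal.mul hf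
    exact hm.comp (measurable_sp y)
  · filter_upwards [hev] with y hy
    refine ae_of_all _ fun g => ?_
    exact mul_le_mul' (ENNReal.ofReal_le_ofReal (hbound y hy g)) (ENNReal.coe_le_coe.2 (hM _))
  · rw [lintegral_mul_const' _ _ ENNReal.coe_ne_top]
    refine ENNReal.mul_ne_top ?_ ENNReal.coe_ne_top
    have hK0 : 0 ≤ K := by positivity
    simp only [ENNReal.ofReal_mul hK0]
    rw [lintegral_const_mul' _ _ ENNReal.ofReal_ne_top]
    exact ENNReal.mul_ne_top ENNReal.ofReal_ne_top (lintegral_exp_norm_sq_lt_top (by linarith)).ne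
  · refine ae_of_all _ fun g => ?_
    have hs := continuous_sp_left g
    refine ENNReal.Tendsto.mul ?_ (Or.inr ENNReal.coe_ne_top) ?_ (Or.inr ENNReal.ofReal_ne_top)
    · exact (ENNReal.continuous_ofReal.tendsto _).comp
        ((continuousAt_transitionDensity π c hz hs).tendsto.mono_left nhdsWithin_le_nhds)
    · exact ((ENNReal.continuous_coe.comp (f.continuous.comp hs)).tendsto z).mono_left
        nhdsWithin_le_nhds

theorem tendsto_spread_chamber {z : Fin N → ℝ} (hz : Antitone z) :
    Tendsto (spread z) (𝓝[>] 0) (𝓝[chamber N] z) :=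
  tendsto_nhdsWithin_of_tendsto_nhds_of_eventually_within _ (tendsto_spread z) <| by
    filter_upwards [self_mem_nhdsWithin] with t ht
    exact (spread_strictAnti hz ht).antitone

/-- The Feller property for the constant function carries total mass one from strictly decreasing
points to their limits. -/
theorem isProbabilityMeasure_transitionQ {π : ℕ → ℝ} (hπ : ∀ i, 0 < π i) {c : ℝ} (hc : 0 ≤ c)
    {z : Fin N → ℝ} (hz : Antitone z) :
    IsProbabilityMeasure (transitionQ (fun i : Fin N => π i) c z) := by
  refine ⟨?_⟩
  have h := (tendsto_lintegral_transitionQ (fun i : Fin N => hπ i) hc hz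
    (BoundedContinuousFunction.const _ 1)).comp (tendsto_spread_chamber hz)
  simp only [BoundedContinuousFunction.const_apply, ENNReal.coe_one, lintegral_one] at h
  refine tendsto_nhds_unique h (tendsto_const_nhds.congr' ?_)
  filter_upwards [self_mem_nhdsWithin] with t ht
  rw [Function.comp_apply]
  exact (transitionQ_univ_of_strictAnti hπ hc (spread_strictAnti hz ht)).symm

end TransitionQ

/-! ### The Markov property with exponential input -/

theorem ext_of_lintegral_mul_boundedContinuous {S T : Type*} [TopologicalSpace S]
    [MeasurableSpace S] [BorelSpace S] [HasOuterApproxClosed S] [TopologicalSpace T]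
    [MeasurableSpace T] [BorelSpace T] [HasOuterApproxClosed T]
    {μ ν : Measure (S × T)} [IsFiniteMeasure μ]
    (h : ∀ (f : BoundedContinuousFunction S ℝ≥0) (g : BoundedContinuousFunction T ℝ≥0),
      ∫⁻ p, f p.1 * g p.2 ∂μ = ∫⁻ p, f p.1 * g p.2 ∂ν) : μ = ν := by
  let e : (S × T) ≃ᵐ ((Unit → S) × (Unit → T)) :=
    .symm <| .prodCongr (.funUnique ..) (.funUnique ..)
  rw [← e.map_measurableEquiv_injective.eq_iff]
  refine Measure.ext_of_lintegral_prod_mul_prod_boundedContinuousFunction fun f g ↦ ?_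
  rw [lintegral_map_equiv, lintegral_map_equiv]
  simpa [e] using! h (f ()) (g ())

/-! ### Discarding null sets under the pattern integral -/

section Null

variable {R : Type} [AddCommGroup R] [LinearOrder R] [IsOrderedAddMonoid R] [TopologicalSpace R]
  [OrderClosedTopology R] [IsTopologicalAddGroup R] [SecondCountableTopology R]
  [MeasurableSpace R] [BorelSpace R] {N : ℕ}
  {μ : Measure R} [SigmaFinite μ] {E : ℕ → R → ℝ≥0∞}

theorem gtInt_add_right (hE : ∀ k, Measurable (E k)) (l : Fin N → R) (f : Triangle N R → ℝ≥0∞)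
    {g : Triangle N R → ℝ≥0∞} (hg : Measurable g) :
    gtInt μ E N l (fun x => f x + g x) = gtInt μ E N l f + gtInt μ E N l g := by
  induction N with
  | zero => rfl
  | succ N ih =>
    have hg' : Measurable fun x => g (triSnoc x l) :=
      hg.comp (Measurable.triSnoc measurable_id measurable_const)
    have hm : Measurable fun a : Fin N → R => gtInt μ E N a (fun x => g (triSnoc x l)) :=
      Measurable.gtInt hE measurable_id
        (hg.comp (Measurable.triSnoc measurable_snd measurable_const))
    simp only [gtInt]
    rw [← lintegral_add_right]
    · refine lintegral_congr fun a => ?_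
      rw [ih a (fun x => f (triSnoc x l)) hg', mul_add]
    · refine Measurable.mul (Measurable.mul ?_ ?_) hm
      · exact measurable_ind (measurableSet_interlaces measurable_id measurable_const)
      · exact (hE N).comp (by fun_prop)

/-- Adding `∞` times the indicator of the bad set makes the inequality pointwise without changing
the right-hand integral. Only the bad set has to be measurable, not `F` or `G`. -/
theorem gtInt_lintegral_le_of_null (hE : ∀ k, Measurable (E k)) {Ω : Type*} [MeasurableSpace Ω]
    {P : Measure Ω} [SFinite P] {l : Fin N → R} {F G : Triangle N R → Ω → ℝ≥0∞}
    {bad : Triangle N R → Ω → Prop} (hbad : MeasurableSet {p : Triangle N R × Ω | bad p.1 p.2})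
    (h0 : gtInt μ E N l (fun x => ∫⁻ ω, ind (bad x ω) ∂P) = 0)
    (h : ∀ x, IsGTPattern x → ∀ ω, ¬bad x ω → F x ω = G x ω) :
    gtInt μ E N l (fun x => ∫⁻ ω, F x ω ∂P) ≤ gtInt μ E N l (fun x => ∫⁻ ω, G x ω ∂P) := by
  have hind : Measurable fun p : Triangle N R × Ω => ind (bad p.1 p.2) := measurable_ind hbad
  have hind' : Measurable fun x => ∫⁻ ω, ind (bad x ω) ∂P :=
    Measurable.lintegral_prod_right' (f := fun p : Triangle N R × Ω => ind (bad p.1 p.2)) hind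
  calc gtInt μ E N l (fun x => ∫⁻ ω, F x ω ∂P)
      ≤ gtInt μ E N l (fun x => ∫⁻ ω, G x ω ∂P + ∞ * ∫⁻ ω, ind (bad x ω) ∂P) := by
        refine gtInt_mono fun x hx _ => ?_
        have hx' : Measurable fun ω => ind (bad x ω) := hind.comp measurable_prodMk_left
        rw [← lintegral_const_mul _ hx', ← lintegral_add_right _ (hx'.const_mul _)]
        refine lintegral_mono fun ω => ?_
        by_cases hb : bad x ω
        · rw [ind_of hb]
          simp
        · rw [h x hx ω hb]
          exact le_self_add
    _ = gtInt μ E N l (fun x => ∫⁻ ω, G x ω ∂P) := by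
        rw [gtInt_add_right hE l _ (hind'.const_mul _), gtInt_const_mul hE l hind', h0, mul_zero,
          add_zero]

end Null

/-! ### Passage to the zero initial pattern -/

section Exponential

variable {N : ℕ}

theorem measurableSet_strictAnti : MeasurableSet {v : Fin N → ℝ | StrictAnti v} := by
  have : {v : Fin N → ℝ | StrictAnti v} = ⋂ (i : Fin N) (j : Fin N) (_ : i < j), {x | x j < x i} := by
    ext x
    simp [StrictAnti]
  rw [this]
  exact MeasurableSet.iInter fun i => MeasurableSet.iInter fun j => MeasurableSet.iInter fun _ =>
    measurableSet_lt (measurable_pi_apply j) (measurable_pi_apply i)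

/-- Every entry of a pattern is bounded by its bottom row, so the random patterns above `spread 0 t`
shrink to the zero pattern. This replaces an average over the zero row itself, which has no mass for
`N ≥ 2`. -/
theorem tendsto_gtAvg_spread {π : ℕ → ℝ} {F : Triangle N ℝ → ℝ≥0∞} {a : ℝ≥0∞}
    (h : Tendsto F (𝓝[{x | IsGTPattern x}] 0) (𝓝 a)) :
    Tendsto (fun t => gtAvg volume (fun k => expWeight (π k)) (spread 0 t) F) (𝓝[>] 0) (𝓝 a) := by
  have hE : ∀ k, Measurable (expWeight (π k)) := fun k => measurable_expWeight _
  have key : ∀ p : ℝ≥0∞ → Prop, (∀ᶠ x in 𝓝[{x | IsGTPattern x}] (0 : Triangle N ℝ), p (F x)) →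
      ∀ᶠ t in 𝓝[>] (0 : ℝ), ∀ x : Triangle N ℝ, IsGTPattern x → bottomRow x = spread 0 t →
        p (F x) := by
    intro p hp
    rw [eventually_nhdsWithin_iff, Metric.eventually_nhds_iff] at hp
    obtain ⟨δ, hδ, hp⟩ := hp
    have h1 := (tendsto_spread (0 : Fin N → ℝ)).eventually (Metric.ball_mem_nhds _ (half_pos hδ))
    filter_upwards [h1] with t ht x hx hxt
    refine hp ?_ hx
    have ht' : ‖spread (0 : Fin N → ℝ) t‖ < δ / 2 := by simpa using ht
    have : ‖x‖ ≤ δ / 2 := by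
      refine (pi_norm_le_iff_of_nonneg (half_pos hδ).le).2 fun k =>
        (pi_norm_le_iff_of_nonneg (half_pos hδ).le).2 fun i => ?_
      refine hx.abs_entry_le (fun i => ?_) k i
      rw [hxt]
      exact (norm_le_pi_norm (spread 0 t) i).trans ht'.le
    rw [dist_zero_right]
    linarith
  have hmass : ∀ t : ℝ, 0 < t →
      gtInt volume (fun k => expWeight (π k)) N (spread 0 t) 1 ≠ 0 := fun t ht => by
    have hs := spread_strictAnti (z := (0 : Fin N → ℝ)) (fun _ _ _ => le_rfl) ht
    rw [gtInt_one_eq_gtDet π hs.antitone, gtDet_eq_hNorm]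
    exact (ENNReal.ofReal_pos.2 (mul_pos (gtDet_zero_pos hs) (hNorm_pos _ hs.antitone))).ne'
  refine tendsto_order.2 ⟨fun b hb => ?_, fun b hb => ?_⟩
  · obtain ⟨b', hb1, hb2⟩ := exists_between hb
    filter_upwards [key (fun y => b' < y) (h.eventually (lt_mem_nhds hb2)), self_mem_nhdsWithin]
      with t ht ht0
    refine hb1.trans_le ?_
    rw [gtAvg, ENNReal.le_div_iff_mul_le (Or.inl (hmass t ht0))
      (Or.inl (gtInt_expWeight_ne_top π _)), ← gtInt_const hE]
    exact gtInt_mono fun x hx hxt => (ht x hx hxt).le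
  · obtain ⟨b', hb1, hb2⟩ := exists_between hb
    filter_upwards [key (fun y => y < b') (h.eventually (gt_mem_nhds hb1)), self_mem_nhdsWithin]
      with t ht ht0
    refine lt_of_le_of_lt ?_ hb2
    rw [gtAvg, ENNReal.div_le_iff_le_mul (Or.inl (hmass t ht0))
      (Or.inl (gtInt_expWeight_ne_top π _)), ← gtInt_const hE]
    exact gtInt_mono fun x hx hxt => (ht x hx hxt).le

variable {Ω : Type*} [MeasurableSpace Ω] {P : Measure Ω} [IsProbabilityMeasure P]
  {π : ℕ → ℝ} {ρ : ℕ → ℝ} {c : Ω → ℕ → Fin N → ℝ}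

theorem gtInt_expWeight_markov (hπ : ∀ i, 0 < π i) (hρ : ∀ j, 0 ≤ ρ j) (hc : Measurable c)
    (hcol : ∀ m, IndepColumn P c m fun k => expMeasure (π k + ρ m)) (n : ℕ) (z : Fin N → ℝ)
    {g : (ℕ → Fin N → ℝ) → ℝ≥0∞} (hg : Measurable g) {φ : (Fin N → ℝ) → ℝ≥0∞}
    (hφ : Measurable φ) :
    gtInt volume (fun k => expWeight (π k)) N z (fun x => ∫⁻ ω, g (bottomHistory x (c ω) n) *
      φ (bottomRow (patternProcess x (c ω) (n + 1))) ∂P) =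
    gtInt volume (fun k => expWeight (π k)) N z (fun x => ∫⁻ ω, g (bottomHistory x (c ω) n) *
      ((∫⁻ l', ind (HStrip (bottomRow (patternProcess x (c ω) n)) l') *
        ((∏ k : Fin N, ENNReal.ofReal (π k + ρ n)) *
          expWeight (ρ n) (∑ i, l' i - ∑ i, bottomRow (patternProcess x (c ω) n) i)) *
        (φ l' * gtInt volume (fun k => expWeight (π k)) N l' 1) ∂(Measure.pi fun _ => volume)) /
        gtInt volume (fun k => expWeight (π k)) N (bottomRow (patternProcess x (c ω) n)) 1) ∂P) := by
  have hp : ∀ j k, IsProbabilityMeasure (expMeasure (π k + ρ j)) := fun j k =>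
    isProbabilityMeasure_expMeasure (add_pos_of_pos_of_nonneg (hπ k) (hρ j))
  exact gtInt_markov (μ := (volume : Measure ℝ)) (E := fun k => expWeight (π k)) (P := P) (c := c)
    (B := fun j => expWeight (ρ j)) (C := fun j k => ENNReal.ofReal (π k + ρ j))
    (ν := fun j k => expMeasure (π k + ρ j))
    (measurePreserving_add_left _) (Measure.measurePreserving_sub_left _)
    (fun _ => measurable_expWeight _) (fun k => expWeight_add _)
    (gtInt_expWeight_ne_top π) hc (n := n) (fun _ _ => measurable_expWeight _)
    (fun m _ => expWeight_add _) (fun m _ => by simp [expWeight])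
    (fun m _ k _ => expMeasure_eq_withDensity (add_nonneg (hπ k).le (hρ m)))
    (fun m _ => hcol m) z hg hφ

theorem measurableSet_not_strictAnti_patternProcess (hc : Measurable c) (n : ℕ) :
    MeasurableSet {p : Triangle N ℝ × Ω |
      ¬StrictAnti (bottomRow (patternProcess p.1 (c p.2) n))} := by
  have hm : Measurable fun p : Triangle N ℝ × Ω => bottomRow (patternProcess p.1 (c p.2) n) :=
    (Measurable.patternProcess measurable_fst (hc.comp measurable_snd) n).bottomRow
  exact (hm measurableSet_strictAnti).compl

/-- Started from a strictly decreasing bottom row, the bottom rows are almost surely strictly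
decreasing. -/
theorem gtInt_not_strictAnti (hπ : ∀ i, 0 < π i) (hρ : ∀ j, 0 ≤ ρ j) (hc : Measurable c)
    (hcol : ∀ m, IndepColumn P c m fun k => expMeasure (π k + ρ m)) (n : ℕ) {z : Fin N → ℝ}
    (hz : StrictAnti z) :
    gtInt volume (fun k => expWeight (π k)) N z (fun x =>
      ∫⁻ ω, ind (¬StrictAnti (bottomRow (patternProcess x (c ω) n))) ∂P) = 0 := by
  have hE : ∀ k, Measurable (expWeight (π k)) := fun k => measurable_expWeight _
  cases n with
  | zero =>
    rw [gtInt_congr (g := fun _ => 0) fun x _ hx => ?_, gtInt_const hE, zero_mul]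
    simp only [patternProcess]
    rw [ind_of_not (by rw [hx]; exact not_not.2 hz)]
    simp
  | succ n =>
    have h := gtInt_expWeight_markov hπ hρ hc hcol n z (g := 1) measurable_one
      (φ := fun v => ind (¬StrictAnti v)) (measurable_ind measurableSet_strictAnti.compl)
    simp only [Pi.one_apply, one_mul] at h
    rw [h, gtInt_congr (g := fun _ => 0) fun x _ _ => ?_, gtInt_const hE, zero_mul]
    refine (lintegral_congr fun ω => ?_).trans lintegral_zero
    refine ENNReal.div_eq_zero_iff.2 (Or.inl ?_)
    rw [← volume_pi]
    refine (lintegral_congr_ae ?_).trans lintegral_zero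
    filter_upwards [ae_injective (N := N)] with l' hl'
    by_cases hs : HStrip (bottomRow (patternProcess x (c ω) n)) l'
    · rw [ind_of_not (not_not.2 (hs.antitone.2.strictAnti_of_injective hl')), zero_mul, mul_zero]
    · rw [ind_of_not hs, zero_mul, zero_mul]

/-- The two kernels are identified only at strictly decreasing rows. From a strictly decreasing
start, other rows are met with probability zero. -/
theorem gtInt_transitionQ (hπ : ∀ i, 0 < π i) (hρ : ∀ j, 0 ≤ ρ j) (hc : Measurable c)
    (hcol : ∀ m, IndepColumn P c m fun k => expMeasure (π k + ρ m)) (n : ℕ) {z : Fin N → ℝ}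
    (hz : StrictAnti z) {g : (ℕ → Fin N → ℝ) → ℝ≥0∞} (hg : Measurable g)
    {φ : (Fin N → ℝ) → ℝ≥0∞} (hφ : Measurable φ) :
    gtInt volume (fun k => expWeight (π k)) N z (fun x => ∫⁻ ω, g (bottomHistory x (c ω) n) *
      φ (bottomRow (patternProcess x (c ω) (n + 1))) ∂P) =
    gtInt volume (fun k => expWeight (π k)) N z (fun x => ∫⁻ ω, g (bottomHistory x (c ω) n) *
      ∫⁻ z', φ z' ∂(transitionQ (fun i : Fin N => π i) (ρ n)
        (bottomRow (patternProcess x (c ω) n))) ∂P) := by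
  rw [gtInt_expWeight_markov hπ hρ hc hcol n z hg hφ]
  have hE : ∀ k, Measurable (expWeight (π k)) := fun k => measurable_expWeight _
  have h0 := gtInt_not_strictAnti hπ hρ hc hcol n hz
  have hbad := measurableSet_not_strictAnti_patternProcess hc n
  refine le_antisymm (gtInt_lintegral_le_of_null hE hbad h0 fun x _ ω hs => ?_)
    (gtInt_lintegral_le_of_null hE hbad h0 fun x _ ω hs => ?_)
  · rw [lintegral_transitionQ_of_strictAnti hπ (hρ n) (not_not.1 hs) hφ]
  · rw [lintegral_transitionQ_of_strictAnti hπ (hρ n) (not_not.1 hs) hφ]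

theorem continuous_bottomHistory (c : ℕ → Fin N → ℝ) (n : ℕ) :
    Continuous fun x : Triangle N ℝ => bottomHistory x c n :=
  continuous_pi fun _ => (continuous_patternProcess continuous_id continuous_const _).bottomRow

theorem exists_nnreal_bound {S : Type*} [TopologicalSpace S] (f : BoundedContinuousFunction S ℝ≥0) :
    ∃ M : ℝ≥0, ∀ x, f x ≤ M := ⟨nndist f 0, fun x => by
  have := BoundedContinuousFunction.nndist_coe_le_nndist (f := f) (g := 0) x
  simpa using this⟩

theorem isGTPattern_zero : IsGTPattern (0 : Triangle N ℝ) := fun _ _ _ _ => ⟨le_rfl, le_rfl⟩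

/-- As functions of the initial pattern, both sides are continuous at zero within the patterns: the
left by continuity of insertion, the right also by the Feller property. Their averages above `spread
0 t` agree for every `t > 0`. -/
theorem lintegral_bottomHistory_mul_of_continuous (hπ : ∀ i, 0 < π i) (hρ : ∀ j, 0 ≤ ρ j)
    (hc : Measurable c) (hc0 : ∀ ω j i, 0 ≤ c ω j i)
    (hcol : ∀ m, IndepColumn P c m fun k => expMeasure (π k + ρ m)) (n : ℕ)
    (g : BoundedContinuousFunction (ℕ → Fin N → ℝ) ℝ≥0)
    (φ : BoundedContinuousFunction (Fin N → ℝ) ℝ≥0) :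
    ∫⁻ ω, g (bottomHistory 0 (c ω) n) * φ (bottomRow (patternProcess 0 (c ω) (n + 1))) ∂P =
    ∫⁻ ω, g (bottomHistory 0 (c ω) n) * ∫⁻ z', φ z' ∂(transitionQ (fun i : Fin N => π i) (ρ n)
        (bottomRow (patternProcess 0 (c ω) n))) ∂P := by
  have hgm : Measurable fun h => (g h : ℝ≥0∞) := g.continuous.measurable.coe_nnreal_ennreal
  have hφm : Measurable fun v => (φ v : ℝ≥0∞) := φ.continuous.measurable.coe_nnreal_ennreal
  obtain ⟨M, hM⟩ := exists_nnreal_bound g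
  obtain ⟨M', hM'⟩ := exists_nnreal_bound φ
  have hTm := measurable_lintegral_transitionQ (fun i : Fin N => π i) (ρ n) hφm
  have hT : ∀ z : Fin N → ℝ, Antitone z →
      ∫⁻ z', φ z' ∂(transitionQ (fun i : Fin N => π i) (ρ n) z) ≤ M' := fun z hz => by
    have := isProbabilityMeasure_transitionQ hπ (hρ n) hz
    refine (lintegral_mono fun z' => ENNReal.coe_le_coe.2 (hM' z')).trans ?_
    simp
  have hpm : ∀ (x : Triangle N ℝ) m, Measurable fun ω => bottomRow (patternProcess x (c ω) m) :=
    fun x m => (Measurable.patternProcess measurable_const hc m).bottomRow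
  have hhm : ∀ x : Triangle N ℝ, Measurable fun ω => bottomHistory x (c ω) n := fun x =>
    Measurable.bottomHistory measurable_const hc n
  have hanti : ∀ x : Triangle N ℝ, IsGTPattern x → ∀ ω m,
      Antitone (bottomRow (patternProcess x (c ω) m)) := fun x hx ω m =>
    (patternProcess_isGTPattern hx (hc0 ω) m).antitone_bottomRow
  have hgt : ∀ ω, Tendsto (fun x => (g (bottomHistory x (c ω) n) : ℝ≥0∞))
      (𝓝[{x | IsGTPattern x}] 0) (𝓝 (g (bottomHistory 0 (c ω) n))) := fun ω =>
    ((ENNReal.continuous_coe.comp (g.continuous.comp (continuous_bottomHistory (c ω) n))).tendsto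
      0).mono_left nhdsWithin_le_nhds
  have hbt : ∀ ω m, Tendsto (fun x : Triangle N ℝ => bottomRow (patternProcess x (c ω) m))
      (𝓝[{x | IsGTPattern x}] 0) (𝓝 (bottomRow (patternProcess 0 (c ω) m))) := fun ω m =>
    ((continuous_patternProcess continuous_id continuous_const m).bottomRow.tendsto 0).mono_left
      nhdsWithin_le_nhds
  have h1 : Tendsto (fun x : Triangle N ℝ => ∫⁻ ω, g (bottomHistory x (c ω) n) *
      φ (bottomRow (patternProcess x (c ω) (n + 1))) ∂P) (𝓝[{x | IsGTPattern x}] 0)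
      (𝓝 (∫⁻ ω, g (bottomHistory 0 (c ω) n) *
        φ (bottomRow (patternProcess 0 (c ω) (n + 1))) ∂P)) := by
    refine tendsto_lintegral_filter_of_dominated_convergence (fun _ => (M : ℝ≥0∞) * M')
      (Eventually.of_forall fun x => (hgm.comp (hhm x)).mul (hφm.comp (hpm x _)))
      (Eventually.of_forall fun x => ae_of_all _ fun ω =>
        mul_le_mul' (ENNReal.coe_le_coe.2 (hM _)) (ENNReal.coe_le_coe.2 (hM' _)))
      (by simpa using ENNReal.mul_ne_top ENNReal.coe_ne_top ENNReal.coe_ne_top)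
      (ae_of_all _ fun ω => ?_)
    exact ENNReal.Tendsto.mul (hgt ω) (Or.inr ENNReal.coe_ne_top)
      (((ENNReal.continuous_coe.comp φ.continuous).tendsto _).comp (hbt ω (n + 1)))
      (Or.inr ENNReal.coe_ne_top)
  have h2 : Tendsto (fun x : Triangle N ℝ => ∫⁻ ω, g (bottomHistory x (c ω) n) *
      ∫⁻ z', φ z' ∂(transitionQ (fun i : Fin N => π i) (ρ n)
        (bottomRow (patternProcess x (c ω) n))) ∂P) (𝓝[{x | IsGTPattern x}] 0)
      (𝓝 (∫⁻ ω, g (bottomHistory 0 (c ω) n) *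
        ∫⁻ z', φ z' ∂(transitionQ (fun i : Fin N => π i) (ρ n)
        (bottomRow (patternProcess 0 (c ω) n))) ∂P)) := by
    refine tendsto_lintegral_filter_of_dominated_convergence (fun _ => (M : ℝ≥0∞) * M')
      (Eventually.of_forall fun x => (hgm.comp (hhm x)).mul (hTm.comp (hpm x _)))
      ?_ (by simpa using ENNReal.mul_ne_top ENNReal.coe_ne_top ENNReal.coe_ne_top)
      (ae_of_all _ fun ω => ?_)
    · filter_upwards [self_mem_nhdsWithin] with x hx
      exact ae_of_all _ fun ω =>
        mul_le_mul' (ENNReal.coe_le_coe.2 (hM _)) (hT _ (hanti x hx ω n))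
    · have hz := hanti 0 isGTPattern_zero ω n
      refine ENNReal.Tendsto.mul (hgt ω) (Or.inr ((hT _ hz).trans_lt ENNReal.coe_lt_top).ne)
        ?_ (Or.inr ENNReal.coe_ne_top)
      refine (tendsto_lintegral_transitionQ (fun i : Fin N => hπ i) (hρ n) hz φ).comp ?_
      refine tendsto_nhdsWithin_of_tendsto_nhds_of_eventually_within _ (hbt ω n) ?_
      filter_upwards [self_mem_nhdsWithin] with x hx
      exact hanti x hx ω n
  refine tendsto_nhds_unique (tendsto_gtAvg_spread (π := π) h1)
    ((tendsto_gtAvg_spread (π := π) h2).congr' ?_)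
  filter_upwards [self_mem_nhdsWithin] with t ht
  rw [gtAvg, gtAvg, gtInt_transitionQ hπ hρ hc hcol n
    (spread_strictAnti (fun _ _ _ => le_rfl) ht) hgm hφm]

/-- Products of bounded continuous functions determine the joint law of the history and the next
row, so the continuous case identifies this law with the one built from the kernel. -/
theorem lintegral_bottomHistory_mul (hπ : ∀ i, 0 < π i) (hρ : ∀ j, 0 ≤ ρ j)
    (hc : Measurable c) (hc0 : ∀ ω j i, 0 ≤ c ω j i)
    (hcol : ∀ m, IndepColumn P c m fun k => expMeasure (π k + ρ m)) (n : ℕ)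
    {g : (ℕ → Fin N → ℝ) → ℝ≥0∞} (hg : Measurable g) {φ : (Fin N → ℝ) → ℝ≥0∞}
    (hφ : Measurable φ) :
    ∫⁻ ω, g (bottomHistory 0 (c ω) n) * φ (bottomRow (patternProcess 0 (c ω) (n + 1))) ∂P =
    ∫⁻ ω, g (bottomHistory 0 (c ω) n) * ∫⁻ z', φ z' ∂(transitionQ (fun i : Fin N => π i) (ρ n)
        (bottomRow (patternProcess 0 (c ω) n))) ∂P := by
  have hpm : ∀ m, Measurable fun ω => bottomRow (patternProcess (0 : Triangle N ℝ) (c ω) m) :=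
    fun m => (Measurable.patternProcess measurable_const hc m).bottomRow
  have hhm : Measurable fun ω => bottomHistory (0 : Triangle N ℝ) (c ω) n :=
    Measurable.bottomHistory measurable_const hc n
  let κ : Kernel Ω (Fin N → ℝ) :=
    ⟨fun ω => transitionQ (fun i : Fin N => π i) (ρ n) (bottomRow (patternProcess 0 (c ω) n)), by
      refine Measure.measurable_of_measurable_coe _ fun B hB => ?_
      have := (measurable_lintegral_transitionQ (fun i : Fin N => π i) (ρ n)
        (measurable_one.indicator hB)).comp (hpm n)
      simpa only [Function.comp_def, lintegral_indicator_one hB] using this⟩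
  have hκ : IsMarkovKernel κ := ⟨fun ω => isProbabilityMeasure_transitionQ hπ (hρ n)
    (patternProcess_isGTPattern isGTPattern_zero (hc0 ω) n).antitone_bottomRow⟩
  have h2m : Measurable fun p : Ω × (Fin N → ℝ) =>
      (bottomHistory (0 : Triangle N ℝ) (c p.1) n, p.2) :=
    (hhm.comp measurable_fst).prodMk measurable_snd
  have e1 : ∀ F : (ℕ → Fin N → ℝ) × (Fin N → ℝ) → ℝ≥0∞, Measurable F →
      ∫⁻ p, F p ∂(P.map fun ω => (bottomHistory (0 : Triangle N ℝ) (c ω) n,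
        bottomRow (patternProcess 0 (c ω) (n + 1)))) =
      ∫⁻ ω, F (bottomHistory 0 (c ω) n, bottomRow (patternProcess 0 (c ω) (n + 1))) ∂P := fun F hF =>
    lintegral_map hF (hhm.prodMk (hpm (n + 1)))
  have e2 : ∀ F : (ℕ → Fin N → ℝ) × (Fin N → ℝ) → ℝ≥0∞, Measurable F →
      ∫⁻ p, F p ∂((P ⊗ₘ κ).map fun p => (bottomHistory (0 : Triangle N ℝ) (c p.1) n, p.2)) =
      ∫⁻ ω, ∫⁻ z', F (bottomHistory 0 (c ω) n, z') ∂(κ ω) ∂P := fun F hF => by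
    rw [lintegral_map hF h2m]
    exact Measure.lintegral_compProd (hF.comp h2m)
  have hprob : IsProbabilityMeasure (P.map fun ω => (bottomHistory (0 : Triangle N ℝ) (c ω) n,
      bottomRow (patternProcess 0 (c ω) (n + 1)))) :=
    Measure.isProbabilityMeasure_map (hhm.prodMk (hpm (n + 1))).aemeasurable
  have heq : P.map (fun ω => (bottomHistory (0 : Triangle N ℝ) (c ω) n,
      bottomRow (patternProcess 0 (c ω) (n + 1)))) =
      (P ⊗ₘ κ).map fun p => (bottomHistory (0 : Triangle N ℝ) (c p.1) n, p.2) := by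
    refine ext_of_lintegral_mul_boundedContinuous fun f g => ?_
    have hfm : Measurable fun h => (f h : ℝ≥0∞) := f.continuous.measurable.coe_nnreal_ennreal
    have hgm : Measurable fun v => (g v : ℝ≥0∞) := g.continuous.measurable.coe_nnreal_ennreal
    have hm : Measurable fun p : (ℕ → Fin N → ℝ) × (Fin N → ℝ) => (f p.1 : ℝ≥0∞) * g p.2 :=
      (hfm.comp measurable_fst).mul (hgm.comp measurable_snd)
    rw [e1 _ hm, e2 _ hm]
    refine (lintegral_bottomHistory_mul_of_continuous hπ hρ hc hc0 hcol n f g).trans ?_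
    refine lintegral_congr fun ω => ?_
    exact (lintegral_const_mul _ hgm).symm
  have hm : Measurable fun p : (ℕ → Fin N → ℝ) × (Fin N → ℝ) => g p.1 * φ p.2 :=
    (hg.comp measurable_fst).mul (hφ.comp measurable_snd)
  have h3 := e1 _ hm
  rw [heq, e2 _ hm] at h3
  refine h3.symm.trans (lintegral_congr fun ω => ?_)
  exact lintegral_const_mul (μ := transitionQ (fun i : Fin N => π i) (ρ n)
    (bottomRow (patternProcess 0 (c ω) n))) (g (bottomHistory 0 (c ω) n)) hφ

end Exponential

/-! ### Exponential variables as limits of geometric variables -/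

section Geometric

theorem expMeasure_Ici {r : ℝ} (hr : 0 < r) {s : ℝ} (hs : 0 ≤ s) :
    expMeasure r (Set.Ici s) = ENNReal.ofReal (Real.exp (-(r * s))) := by
  have := isProbabilityMeasure_expMeasure hr
  have h0 : expMeasure r {s} = 0 := withDensity_absolutelyContinuous _ _ (measure_singleton s)
  have h1 : Set.Ici s = Set.Ioi s ∪ {s} := by
    rw [Set.union_singleton, Set.Ioi_insert]
  have h2 : expMeasure r (Set.Ici s) = expMeasure r (Set.Ioi s) := by
    refine le_antisymm ?_ (measure_mono Set.Ioi_subset_Ici_self)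
    rw [h1]
    refine (measure_union_le _ _).trans ?_
    rw [h0, add_zero]
  rw [h2, ← Set.compl_Iic, measure_compl measurableSet_Iic (measure_ne_top _ _), measure_univ,
    ← ofReal_cdf, cdf_expMeasure_eq hr, if_pos hs, ← ENNReal.ofReal_one,
    ← ENNReal.ofReal_sub _ (sub_nonneg.2 (Real.exp_le_one_iff.2 (by nlinarith)))]
  congr 1
  ring

/-- The integer part of a multiple of an exponential variable is geometric. -/
theorem expMeasure_floor {r t : ℝ} (hr : 0 < r) (ht : 0 < t) (m : ℕ) :
    expMeasure r {w | ⌊t * w⌋₊ = m} =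
      ENNReal.ofReal ((1 - Real.exp (-(r / t))) * Real.exp (-(r / t)) ^ m) := by
  have := isProbabilityMeasure_expMeasure hr
  have hmeas : ∀ m : ℕ, MeasurableSet {w : ℝ | m ≤ ⌊t * w⌋₊} := fun m =>
    measurableSet_le measurable_const (Nat.measurable_floor.comp (by fun_prop))
  have htail : ∀ m : ℕ, expMeasure r {w | m ≤ ⌊t * w⌋₊} =
      ENNReal.ofReal (Real.exp (-(r / t)) ^ m) := by
    intro m
    -- The natural floor of a negative number is `0`, so for `m = 0` the event is the whole line
    -- rather than a half-line.
    rcases Nat.eq_zero_or_pos m with rfl | hm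
    · simp
    · have e : {w : ℝ | m ≤ ⌊t * w⌋₊} = Set.Ici (m / t) := by
        ext w
        simp only [Set.mem_Ici]
        rw [div_le_iff₀ ht, mul_comm]
        exact Nat.le_floor_iff' hm.ne'
      rw [e, expMeasure_Ici hr (by positivity), ← Real.exp_nat_mul]
      congr 2
      field_simp
  have hset : {w : ℝ | ⌊t * w⌋₊ = m} = {w | m ≤ ⌊t * w⌋₊} \ {w | m + 1 ≤ ⌊t * w⌋₊} := by
    ext w
    change ⌊t * w⌋₊ = m ↔ m ≤ ⌊t * w⌋₊ ∧ ¬m + 1 ≤ ⌊t * w⌋₊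
    omega
  have hsub : {w : ℝ | m + 1 ≤ ⌊t * w⌋₊} ⊆ {w | m ≤ ⌊t * w⌋₊} :=
    fun w hw => (Nat.le_succ m).trans hw
  rw [hset, measure_sdiff hsub (hmeas (m + 1)).nullMeasurableSet (measure_ne_top _ _), htail, htail,
    ← ENNReal.ofReal_sub _ (by positivity)]
  congr 1
  ring

/-- The multiple of an exponential variable with parameter `p + q` whose integer part is geometric
with parameter `(1 - p / L) (1 - q / L)`. -/
noncomputable def geomScale (p q L : ℝ) : ℝ :=
  (p + q) / -Real.log ((1 - p / L) * (1 - q / L))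

theorem geomScale_spec {p q L : ℝ} (hp : 0 < p) (hq : 0 ≤ q) (hpL : p < L) (hqL : q < L) :
    0 < geomScale p q L ∧
      Real.exp (-((p + q) / geomScale p q L)) = (1 - p / L) * (1 - q / L) := by
  have hL : 0 < L := hp.trans hpL
  have h1 : 0 < 1 - p / L := sub_pos.2 ((div_lt_one hL).2 hpL)
  have h2 : 0 < 1 - q / L := sub_pos.2 ((div_lt_one hL).2 hqL)
  have h3 : 1 - p / L < 1 := sub_lt_self 1 (div_pos hp hL)
  have h4 : 1 - q / L ≤ 1 := sub_le_self 1 (div_nonneg hq hL.le)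
  have h5 : (1 - p / L) * (1 - q / L) < 1 := by nlinarith
  have hlog : Real.log ((1 - p / L) * (1 - q / L)) < 0 := Real.log_neg (mul_pos h1 h2) h5
  refine ⟨div_pos (by linarith) (by linarith), ?_⟩
  have : (p + q) / geomScale p q L = -Real.log ((1 - p / L) * (1 - q / L)) := by
    rw [geomScale]
    have : p + q ≠ 0 := by linarith
    have := (neg_pos.2 hlog).ne'
    field_simp
  rw [this, neg_neg, Real.exp_log (mul_pos h1 h2)]

/-- The logarithm of the product splits, and `L * log (1 - p / L)` tends to `-p`, likewise for `q`.
-/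
theorem tendsto_geomScale_div {p q : ℝ} (hp : 0 < p) (hq : 0 ≤ q) :
    Tendsto (fun L => geomScale p q L / L) atTop (𝓝 1) := by
  have h1 := (Real.tendsto_mul_log_one_add_div_atTop (-p)).add
    (Real.tendsto_mul_log_one_add_div_atTop (-q))
  have hne : -(-p + -q) ≠ 0 := by
    have : 0 < p + q := by linarith
    linarith
  have h2 := (h1.neg.inv₀ hne).const_mul (p + q)
  have e : (p + q) * (-(-p + -q))⁻¹ = 1 := by
    have : p + q ≠ 0 := by linarith
    rw [neg_add, neg_neg, neg_neg, mul_inv_cancel₀ this]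
  rw [e] at h2
  refine h2.congr' ?_
  filter_upwards [eventually_gt_atTop p, eventually_gt_atTop q] with L hpL hqL
  have hL : 0 < L := hp.trans hpL
  have h3 : 1 - p / L ≠ 0 := (sub_pos.2 ((div_lt_one hL).2 hpL)).ne'
  have h4 : 1 - q / L ≠ 0 := (sub_pos.2 ((div_lt_one hL).2 hqL)).ne'
  rw [geomScale, Real.log_mul h3 h4]
  have e1 : 1 + -p / L = 1 - p / L := by ring
  have e2 : 1 + -q / L = 1 - q / L := by ring
  rw [e1, e2, div_div, ← mul_add, div_eq_mul_inv (p + q), neg_mul, mul_comm L]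

theorem tendsto_floor_geomScale_div {p q : ℝ} (hp : 0 < p) (hq : 0 ≤ q) {w : ℝ} (hw : 0 ≤ w) :
    Tendsto (fun L => (⌊geomScale p q L * w⌋₊ : ℝ) / L) atTop (𝓝 w) := by
  have h1 : Tendsto (fun L => geomScale p q L / L * w) atTop (𝓝 w) := by
    simpa using (tendsto_geomScale_div hp hq).mul_const w
  have h2 : Tendsto (fun L => geomScale p q L / L * w - L⁻¹) atTop (𝓝 w) := by
    simpa using h1.sub tendsto_inv_atTop_zero
  refine tendsto_of_tendsto_of_tendsto_of_le_of_le' h2 h1 ?_ ?_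
  · filter_upwards [eventually_gt_atTop 0] with L hL
    have := (Nat.lt_floor_add_one (geomScale p q L * w)).le
    rw [le_div_iff₀ hL]
    have e : (geomScale p q L / L * w - L⁻¹) * L = geomScale p q L * w - 1 := by
      field_simp
    linarith
  · filter_upwards [eventually_gt_atTop p, eventually_gt_atTop q] with L hpL hqL
    have hL : 0 < L := hp.trans hpL
    have := Nat.floor_le (mul_nonneg (geomScale_spec hp hq hpL hqL).1.le hw)
    rw [div_le_iff₀ hL]
    refine this.trans_eq ?_
    field_simp

end Geometric

/-! ### Convergence of RSK with geometric input -/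

section Coupling

variable {N : ℕ}

theorem continuous_patternProcess_array (R : Type) [AddCommGroup R] [LinearOrder R]
    [IsOrderedAddMonoid R] [TopologicalSpace R] [OrderClosedTopology R] [IsTopologicalAddGroup R] :
    Continuous fun (w : Fin N × ℕ → R) (n : ℕ) =>
      patternProcess (0 : Triangle N R) (fun j i => w (i, j)) n :=
  continuous_pi fun n => continuous_patternProcess continuous_const
    (continuous_pi fun j => continuous_pi fun i => continuous_apply (i, j)) n

theorem ae_nonneg_of_hasLaw_expMeasure {Ω : Type*} [MeasurableSpace Ω] {P : Measure Ω}
    {V : Ω → ℝ} {r : ℝ} (hr : 0 < r) (h : HasLaw V (expMeasure r) P) : ∀ᵐ ω ∂P, 0 ≤ V ω := by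
  have := isProbabilityMeasure_expMeasure hr
  have h1 : ∀ᵐ w ∂(expMeasure r), 0 ≤ w := by
    refine (prob_compl_eq_zero_iff (measurableSet_Ici (a := (0 : ℝ)))).2 ?_
    rw [expMeasure_Ici hr le_rfl]
    simp
  rw [← h.map_eq] at h1
  exact ae_of_ae_map h.aemeasurable h1

/-- Convergence in distribution involves only the law at each `L`, so the arrays may be rebuilt on
one space from a single exponential array. There the inputs converge almost surely, and RSK is
continuous. -/
theorem tendstoInDistribution_rskPattern {π : Fin N → ℝ} (hπ : ∀ i, 0 < π i) {ρ : ℕ → ℝ}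
    (hρ : ∀ j, 0 ≤ ρ j) {Ω : Type*} [MeasurableSpace Ω] {P : Measure Ω} [IsProbabilityMeasure P]
    {W : Fin N → ℕ → Ω → ℝ} (hWm : ∀ i j, Measurable (W i j))
    (hWindep : iIndepFun (fun p : Fin N × ℕ => W p.1 p.2) P)
    (hWlaw : ∀ i j, HasLaw (W i j) (expMeasure (π i + ρ j)) P)
    {Ω' : ℝ → Type*} [∀ L, MeasurableSpace (Ω' L)] {μ : ∀ L, Measure (Ω' L)}
    [∀ L, IsProbabilityMeasure (μ L)] {ξ : ∀ L, Fin N → ℕ → Ω' L → ℕ}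
    (hξm : ∀ L i j, Measurable (ξ L i j))
    (hξ : ∀ L, iIndepFun (fun p : Fin N × ℕ => ξ L p.1 p.2) (μ L))
    (hlaw : ∀ L i j, π i < L → ρ j < L → ∀ m : ℕ, μ L {ω | ξ L i j ω = m} =
        ENNReal.ofReal ((1 - (1 - π i / L) * (1 - ρ j / L)) *
          ((1 - π i / L) * (1 - ρ j / L)) ^ m)) :
    TendstoInDistribution
      (fun L ω (n : ℕ) (k : Fin N) (i : Fin (k.1 + 1)) =>
        ((rskPattern (fun i j => (ξ L i j ω : ℤ)) n k i : ℤ) : ℝ) / L)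
      atTop (fun ω n => rskPattern (fun i j => W i j ω) n) μ P := by
  classical
  -- the recursion as a function of the input array
  let T : (Fin N × ℕ → ℝ) → ℕ → Triangle N ℝ := fun w n =>
    patternProcess 0 (fun j i => w (i, j)) n
  have hT : Continuous T := continuous_patternProcess_array ℝ
  have hexp : ∀ p : Fin N × ℕ, IsProbabilityMeasure (expMeasure (π p.1 + ρ p.2)) := fun p =>
    isProbabilityMeasure_expMeasure (add_pos_of_pos_of_nonneg (hπ _) (hρ _))
  have hmap : ∀ L (p : Fin N × ℕ), IsProbabilityMeasure ((μ L).map (ξ L p.1 p.2)) := fun L p =>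
    Measure.isProbabilityMeasure_map (hξm L _ _).aemeasurable
  have hW0 : ∀ᵐ ω ∂P, ∀ i j, 0 ≤ W i j ω := ae_all_iff.2 fun i => ae_all_iff.2 fun j =>
    ae_nonneg_of_hasLaw_expMeasure (add_pos_of_pos_of_nonneg (hπ i) (hρ j)) (hWlaw i j)
  -- a common probability space
  let Q : Measure (Fin N × ℕ → ℝ × (ℝ → ℕ)) := Measure.infinitePi fun p =>
    (expMeasure (π p.1 + ρ p.2)).prod (Measure.infinitePi fun L => (μ L).map (ξ L p.1 p.2))
  -- When `L` is too small for a given entry, the law of that entry is unspecified and a copy is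
  -- taken from the second component. Thus the laws of the whole arrays agree for every `L`.
  let y : ∀ (L : ℝ) (p : Fin N × ℕ), ℝ × (ℝ → ℕ) → ℕ := fun L p u =>
    if π p.1 < L ∧ ρ p.2 < L then ⌊geomScale (π p.1) (ρ p.2) L * u.1⌋₊ else u.2 L
  have hy : ∀ L p, Measurable (y L p) := fun L p => by
    simp only [y]
    split_ifs
    · exact Nat.measurable_floor.comp (by fun_prop)
    · fun_prop
  have hlawW : P.map (fun ω p => W p.1 p.2 ω) =
      Measure.infinitePi fun p : Fin N × ℕ => expMeasure (π p.1 + ρ p.2) := by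
    rw [iIndepFun.map_fun_eq_infinitePi_map (X := fun p : Fin N × ℕ => W p.1 p.2)
      (fun p => hWm p.1 p.2) hWindep]
    congr 1
    funext p
    exact (hWlaw p.1 p.2).map_eq
  have hlawQ1 : Q.map (fun θ p => (θ p).1) =
      Measure.infinitePi fun p : Fin N × ℕ => expMeasure (π p.1 + ρ p.2) := by
    rw [Measure.infinitePi_map_pi _ fun p => measurable_fst]
    congr 1
    funext p
    exact measurePreserving_fst.map_eq
  have hmarg : ∀ L (p : Fin N × ℕ), ((expMeasure (π p.1 + ρ p.2)).prod
      (Measure.infinitePi fun L => (μ L).map (ξ L p.1 p.2))).map (y L p) =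
      (μ L).map (ξ L p.1 p.2) := by
    intro L p
    by_cases h : π p.1 < L ∧ ρ p.2 < L
    · obtain ⟨ht, hab⟩ := geomScale_spec (hπ p.1) (hρ p.2) h.1 h.2
      have hfl : Measurable fun w : ℝ => ⌊geomScale (π p.1) (ρ p.2) L * w⌋₊ :=
        Nat.measurable_floor.comp (by fun_prop)
      have e : y L p = (fun w : ℝ => ⌊geomScale (π p.1) (ρ p.2) L * w⌋₊) ∘ Prod.fst := by
        funext u
        simp only [y, if_pos h, Function.comp]
      rw [e, ← Measure.map_map hfl measurable_fst, measurePreserving_fst.map_eq]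
      refine Measure.ext_of_singleton fun m => ?_
      rw [Measure.map_apply hfl (measurableSet_singleton m),
        Measure.map_apply (hξm L _ _) (measurableSet_singleton m)]
      refine (expMeasure_floor (add_pos_of_pos_of_nonneg (hπ p.1) (hρ p.2)) ht m).trans ?_
      rw [hab]
      exact (hlaw L p.1 p.2 h.1 h.2 m).symm
    · have e : y L p = (fun u : ℝ → ℕ => u L) ∘ Prod.snd := by
        funext u
        simp only [y, if_neg h, Function.comp]
      rw [e, ← Measure.map_map (by fun_prop) measurable_snd, measurePreserving_snd.map_eq]
      exact Measure.infinitePi_map_eval _ L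
  have hlawQ2 : ∀ L, Q.map (fun θ p => y L p (θ p)) = (μ L).map (fun ω p => ξ L p.1 p.2 ω) := by
    intro L
    rw [iIndepFun.map_fun_eq_infinitePi_map (X := fun p : Fin N × ℕ => ξ L p.1 p.2)
      (fun p => hξm L p.1 p.2) (hξ L),
      Measure.infinitePi_map_pi _ fun p => hy L p]
    congr 1
    funext p
    exact hmarg L p
  -- the rescaled process as a function of the input array
  let X : ℝ → (Fin N × ℕ → ℕ) → ℕ → Triangle N ℝ := fun L η n k i =>
    ((rskPattern (fun i j => (η (i, j) : ℤ)) n k i : ℤ) : ℝ) / L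
  have hXm : ∀ L, Measurable (X L) := by
    intro L
    have hcast : Measurable fun m : ℕ => (m : ℤ) := measurable_from_top
    have hreal : Measurable fun m : ℤ => (m : ℝ) := measurable_from_top
    have h1 : Measurable fun η : Fin N × ℕ → ℕ => fun n : ℕ =>
        patternProcess (0 : Triangle N ℤ) (fun j i => (η (i, j) : ℤ)) n :=
      measurable_pi_iff.2 fun n => Measurable.patternProcess measurable_const
        (measurable_pi_iff.2 fun j => measurable_pi_iff.2 fun i =>
          hcast.comp (measurable_pi_apply (i, j))) n
    refine measurable_pi_iff.2 fun n => measurable_pi_iff.2 fun k => measurable_pi_iff.2 fun i => ?_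
    have h2 : ∀ η : Fin N × ℕ → ℕ, rskPattern (fun i j => (η (i, j) : ℤ)) n =
        patternProcess 0 (fun j i => (η (i, j) : ℤ)) n := fun η =>
      rskPattern_eq_patternProcess (fun i j => Int.natCast_nonneg _) n
    simp only [X, h2]
    exact (hreal.comp ((measurable_pi_apply i).comp ((measurable_pi_apply k).comp
      ((measurable_pi_apply n).comp h1)))).div_const L
  -- Division by a positive `L` is a monotone additive map, so the rescaled integer pattern is RSK
  -- of the rescaled array.
  have hXT : ∀ L, 0 < L → ∀ η, X L η = T fun p => (η p : ℝ) / L := by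
    intro L hL η
    let f : ℤ →+ ℝ := (AddMonoidHom.mulRight (L⁻¹ : ℝ)).comp (Int.castAddHom ℝ)
    have hf : Monotone f := fun a b hab => by
      simp only [f, AddMonoidHom.comp_apply, AddMonoidHom.mulRight_apply, Int.coe_castAddHom]
      exact mul_le_mul_of_nonneg_right (Int.cast_le.2 hab) (inv_nonneg.2 hL.le)
    funext n k i
    have h1 := map_rskPattern f hf (fun i j => (η (i, j) : ℤ)) n k i
    have h2 : (fun i j => f (η (i, j) : ℤ)) = fun (i : Fin N) (j : ℕ) => (η (i, j) : ℝ) / L := by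
      funext i j
      simp [f, div_eq_mul_inv]
    rw [h2, rskPattern_eq_patternProcess (ξ := fun (i : Fin N) (j : ℕ) => (η (i, j) : ℝ) / L)
      (fun i j => by positivity) n] at h1
    have h3 : T (fun p => (η p : ℝ) / L) n k i =
        patternProcess (0 : Triangle N ℝ) (fun j i => (η (i, j) : ℝ) / L) n k i := rfl
    rw [h3, ← h1]
    exact div_eq_mul_inv _ _
  have hXarr : ∀ L, Measurable fun ω (p : Fin N × ℕ) => ξ L p.1 p.2 ω := fun L =>
    measurable_pi_iff.2 fun p => hξm L p.1 p.2
  have hYarr : ∀ L, Measurable fun (θ : Fin N × ℕ → ℝ × (ℝ → ℕ)) p => y L p (θ p) := fun L =>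
    measurable_pi_iff.2 fun p => (hy L p).comp (measurable_pi_apply p)
  have hWarr : Measurable fun ω (p : Fin N × ℕ) => W p.1 p.2 ω :=
    measurable_pi_iff.2 fun p => hWm p.1 p.2
  have hZT : (fun ω => T fun p => W p.1 p.2 ω) =ᵐ[P]
      fun ω n => rskPattern (fun i j => W i j ω) n := by
    filter_upwards [hW0] with ω hω
    funext n
    exact (rskPattern_eq_patternProcess hω n).symm
  have h1st : Measurable fun (θ : Fin N × ℕ → ℝ × (ℝ → ℕ)) p => (θ p).1 := by fun_prop
  have hcoupled : TendstoInDistribution (fun L θ => X L fun p => y L p (θ p)) atTop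
      (fun θ => T fun p => (θ p).1) (fun _ => Q) Q := by
    refine tendstoInDistribution_of_ae_tendsto (fun L => ((hXm L).comp (hYarr L)).aemeasurable)
      (hT.measurable.comp h1st).aemeasurable ?_
    have h0 : ∀ᵐ θ ∂Q, ∀ p, 0 ≤ (θ p).1 := by
      refine ae_all_iff.2 fun p => ?_
      refine ae_nonneg_of_hasLaw_expMeasure (r := π p.1 + ρ p.2)
        (add_pos_of_pos_of_nonneg (hπ p.1) (hρ p.2)) ⟨(measurable_fst.comp (measurable_pi_apply p)).aemeasurable, ?_⟩
      have : (fun θ : Fin N × ℕ → ℝ × (ℝ → ℕ) => (θ p).1) =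
          (fun v : Fin N × ℕ → ℝ => v p) ∘ fun θ p => (θ p).1 := rfl
      rw [this, ← Measure.map_map (by fun_prop) h1st, hlawQ1]
      exact Measure.infinitePi_map_eval _ p
    filter_upwards [h0] with θ hθ
    have h2 : Tendsto (fun (L : ℝ) (p : Fin N × ℕ) => (y L p (θ p) : ℝ) / L) atTop
        (𝓝 fun p => (θ p).1) := by
      refine tendsto_pi_nhds.2 fun p => ?_
      refine (tendsto_floor_geomScale_div (hπ p.1) (hρ p.2) (hθ p)).congr' ?_
      filter_upwards [eventually_gt_atTop (π p.1), eventually_gt_atTop (ρ p.2)] with L h1 h2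
      simp only [y, if_pos (And.intro h1 h2)]
    refine ((hT.tendsto _).comp h2).congr' ?_
    filter_upwards [eventually_gt_atTop 0] with L hL
    exact (hXT L hL fun p => y L p (θ p)).symm
  have hlawX : ∀ L, Q.map (fun θ => X L fun p => y L p (θ p)) =
      (μ L).map (fun ω => X L fun p => ξ L p.1 p.2 ω) := by
    intro L
    have e1 := Measure.map_map (μ := Q) (hXm L) (hYarr L)
    have e2 := Measure.map_map (μ := μ L) (hXm L) (hXarr L)
    rw [hlawQ2] at e1
    exact e1.symm.trans e2
  have hlawZ : Q.map (fun θ => T fun p => (θ p).1) =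
      P.map (fun ω n => rskPattern (fun i j => W i j ω) n) := by
    rw [← Measure.map_congr hZT]
    have e1 := Measure.map_map (μ := Q) hT.measurable h1st
    have e2 := Measure.map_map (μ := P) hT.measurable hWarr
    rw [hlawQ1, ← hlawW] at e1
    exact e1.symm.trans e2
  refine ⟨fun L => ((hXm L).comp (hXarr L)).aemeasurable,
    (hT.measurable.comp hWarr).aemeasurable.congr hZT, ?_⟩
  -- Both the approximating laws and the limit law are those of the coupled variables, so the
  -- convergence transfers.
  have h := hcoupled.tendsto.congr (f₂ := fun L => ⟨(μ L).map fun ω => X L fun p => ξ L p.1 p.2 ω,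
    Measure.isProbabilityMeasure_map ((hXm L).comp (hXarr L)).aemeasurable⟩)
    fun L => Subtype.ext (hlawX L)
  have e : (⟨Q.map fun θ => T fun p => (θ p).1,
      Measure.isProbabilityMeasure_map (μ := Q) (f := fun θ => T fun p => (θ p).1)
        (hT.measurable.comp h1st).aemeasurable⟩ :
      ProbabilityMeasure (ℕ → Triangle N ℝ)) =
      ⟨P.map fun ω n => rskPattern (fun i j => W i j ω) n, Measure.isProbabilityMeasure_map
        ((hT.measurable.comp hWarr).aemeasurable.congr hZT)⟩ := Subtype.ext hlawZ
  exact e ▸ h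

end Coupling

/-! ### Measurability of RSK -/

section Measurability

variable {Ω : Type*} [MeasurableSpace Ω]

theorem measurable_rowInsert {y ξ : Ω → ℕ → ℝ} (hy : ∀ k, Measurable fun ω => y ω k)
    (hξ : ∀ k, Measurable fun ω => ξ ω k) (k : ℕ) :
    Measurable fun ω => rowInsert (y ω) (ξ ω) k := by
  induction k with
  | zero => exact (hy 0).add (hξ 0)
  | succ k ih => exact ((hy (k + 1)).max ih).add (hξ (k + 1))

theorem measurable_bumped {y ξ : Ω → ℕ → ℝ} (hy : ∀ k, Measurable fun ω => y ω k)
    (hξ : ∀ k, Measurable fun ω => ξ ω k) (k : ℕ) :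
    Measurable fun ω => bumped (y ω) (ξ ω) k := by
  have h := measurable_rowInsert hy hξ
  cases k with
  | zero => exact ((hξ 0).add (hy 0)).sub (h 0)
  | succ k => exact ((hξ (k + 1)).add ((hy (k + 1)).sub (hy k))).sub ((h (k + 1)).sub (h k))

theorem measurable_wordAtRow {x : Ω → ℕ → ℕ → ℝ} {ξ : Ω → ℕ → ℝ}
    (hx : ∀ i k, Measurable fun ω => x ω i k) (hξ : ∀ k, Measurable fun ω => ξ ω k) (i k : ℕ) :
    Measurable fun ω => wordAtRow (x ω) (ξ ω) i k := by
  induction i generalizing k with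
  | zero => exact hξ k
  | succ i ih => exact measurable_bumped (hx i) ih k

theorem measurable_rskTableau {ξ : Ω → ℕ → ℕ → ℝ} (hξ : ∀ i j, Measurable fun ω => ξ ω i j)
    (n i k : ℕ) : Measurable fun ω => rskTableau (ξ ω) n i k := by
  induction n generalizing i k with
  | zero => exact measurable_const
  | succ n ih =>
    exact measurable_rowInsert (ih i) (measurable_wordAtRow ih (fun k => hξ k n) i) k

theorem measurable_extendRows {N : ℕ} {ξ : Ω → Fin N → ℕ → ℝ}
    (hξ : ∀ i j, Measurable fun ω => ξ ω i j) (i j : ℕ) :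
    Measurable fun ω => extendRows (ξ ω) i j := by
  unfold extendRows
  split_ifs
  · exact hξ _ j
  · exact measurable_const

end Measurability

/-! ### The main theorem -/

section Main

variable {N : ℕ} {π : Fin N → ℝ} {ρ : ℕ → ℝ} {Ω : Type*} [MeasurableSpace Ω] {P : Measure Ω}
  [IsProbabilityMeasure P] {W : Fin N → ℕ → Ω → ℝ}

/-- The bottom rows of the patterns that RSK produces from exponential variables are a Markov
chain. -/
theorem isMarkovChainOn_bottomRow_rskPattern (hπ : ∀ i, 0 < π i) (hρ : ∀ j, 0 ≤ ρ j)
    (hWm : ∀ i j, Measurable (W i j)) (hWindep : iIndepFun (fun p : Fin N × ℕ => W p.1 p.2) P)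
    (hWlaw : ∀ i j, HasLaw (W i j) (expMeasure (π i + ρ j)) P) :
    IsMarkovChainOn (chamber N) P (fun n ω => bottomRow (rskPattern (fun i j => W i j ω) n))
      (fun n => transitionQ π (ρ n)) := by
  let π' : ℕ → ℝ := fun k => if h : k < N then π ⟨k, h⟩ else 1
  have hπ' : ∀ k, 0 < π' k := fun k => by
    simp only [π']
    split_ifs
    · exact hπ _
    · exact one_pos
  have hext : (fun i : Fin N => π' i) = π := funext fun i => by simp [π']
  have hprob : ∀ n, ∀ z ∈ chamber N, IsProbabilityMeasure (transitionQ π (ρ n) z) :=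
    fun n z hz => by
      rw [← hext]
      exact isProbabilityMeasure_transitionQ hπ' (hρ n) hz
  have hker : ∀ n, ∀ B : Set (Fin N → ℝ), MeasurableSet B →
      Measurable fun z => transitionQ π (ρ n) z B := fun n B hB => by
    have h := measurable_lintegral_transitionQ π (ρ n)
      (measurable_one.indicator hB : Measurable (B.indicator (1 : (Fin N → ℝ) → ℝ≥0∞)))
    simpa only [lintegral_indicator_one hB] using h
  have hchain : ∀ n, Measurable fun ω => bottomRow (rskPattern (fun i j => W i j ω) n) :=
    fun n => measurable_pi_iff.2 fun i =>
      measurable_rskTableau (measurable_extendRows fun i j => hWm i j) n _ _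
  have hW0 : ∀ᵐ ω ∂P, ∀ i j, 0 ≤ W i j ω := ae_all_iff.2 fun i => ae_all_iff.2 fun j =>
    ae_nonneg_of_hasLaw_expMeasure (add_pos_of_pos_of_nonneg (hπ i) (hρ j)) (hWlaw i j)
  -- Truncation at zero changes the variables only on a null set and makes the columns nonnegative
  -- everywhere, as the results on `patternProcess` require.
  let V : Fin N → ℕ → Ω → ℝ := fun i j ω => max (W i j ω) 0
  let c : Ω → ℕ → Fin N → ℝ := fun ω j i => V i j ω
  have hmax : Measurable fun x : ℝ => max x 0 := by fun_prop
  have hVm : ∀ i j, Measurable (V i j) := fun i j => hmax.comp (hWm i j)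
  have hc : Measurable c := measurable_pi_iff.2 fun j => measurable_pi_iff.2 fun i => hVm i j
  have hc0 : ∀ ω j i, 0 ≤ c ω j i := fun ω j i => le_max_right _ _
  have hV : iIndepFun (fun p : Fin N × ℕ => V p.1 p.2) P :=
    hWindep.comp (fun _ x => max x 0) fun _ => hmax
  have hcol : ∀ m, IndepColumn P c m fun k => expMeasure (π' k + ρ m) := fun m =>
    indepColumn_of_iIndepFun hVm hV m fun i => by
      have e : V i m =ᵐ[P] W i m := by
        filter_upwards [hW0] with ω hω
        exact max_eq_left (hω i m)
      rw [Measure.map_congr e, (hWlaw i m).map_eq, ← congrFun hext i]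
  have hcW : ∀ᵐ ω ∂P, ∀ n, rskPattern (fun i j => W i j ω) n = patternProcess 0 (c ω) n := by
    filter_upwards [hW0] with ω hω n
    have e : c ω = fun j i => W i j ω := by
      funext j i
      exact max_eq_left (hω i j)
    rw [e]
    exact rskPattern_eq_patternProcess hω n
  have hmem : ∀ᵐ ω ∂P, ∀ n, bottomRow (rskPattern (fun i j => W i j ω) n) ∈ chamber N := by
    filter_upwards [hcW] with ω hω n
    rw [hω n]
    exact (patternProcess_isGTPattern isGTPattern_zero (hc0 ω) n).antitone_bottomRow
  refine ⟨hprob, fun n z _ => transitionQ_compl_chamber π (ρ n) z,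
    fun n B hB => (hker n B hB).comp measurable_subtype_coe, hchain, hmem, fun n B hB => ?_⟩
  refine condExp_pastSigma_ae_eq hchain n hB (k := fun z => (transitionQ π (ρ n) z).real B)
    (hker n B hB).ennreal_toReal (Eventually.of_forall fun ω => measureReal_nonneg) fun g hg => ?_
  have h := lintegral_bottomHistory_mul hπ' hρ hc hc0 hcol n hg
    (measurable_one.indicator hB : Measurable (B.indicator (1 : (Fin N → ℝ) → ℝ≥0∞)))
  simp only [lintegral_indicator_one hB, hext] at h
  calc ∫⁻ ω, g (fun i => bottomRow (rskPattern (fun i j => W i j ω) (min i n))) *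
        B.indicator 1 (bottomRow (rskPattern (fun i j => W i j ω) (n + 1))) ∂P
      = ∫⁻ ω, g (bottomHistory 0 (c ω) n) *
          B.indicator 1 (bottomRow (patternProcess 0 (c ω) (n + 1))) ∂P := by
        refine lintegral_congr_ae ?_
        filter_upwards [hcW] with ω hω
        simp only [hω]
        rfl
    _ = _ := h
    _ = ∫⁻ ω, g (fun i => bottomRow (rskPattern (fun i j => W i j ω) (min i n))) *
          ENNReal.ofReal ((transitionQ π (ρ n)
            (bottomRow (rskPattern (fun i j => W i j ω) n))).real B) ∂P := by
        refine lintegral_congr_ae ?_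
        filter_upwards [hcW, hmem] with ω hω hz
        have := hprob n _ (hz n)
        rw [ofReal_measureReal]
        simp only [hω]
        rfl

end Main

/-- Columns and the sequence `\hat π` are indexed from `0`: `W i j` and `ρ j` are the entries with
one-based column index `j + 1`, so that the kernel from time `n` to time `n + 1` uses `ρ n`. -/
theorem lemma3 {N : ℕ} (hN : 0 < N)
    (π : Fin N → ℝ) (hπ : ∀ i, 0 < π i) (ρ : ℕ → ℝ) (hρ : ∀ j, 0 ≤ ρ j)
    {Ω : Type*} [MeasurableSpace Ω] (P : Measure Ω) [IsProbabilityMeasure P]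
    (W : Fin N → ℕ → Ω → ℝ) (hWm : ∀ i j, Measurable (W i j))
    (hWindep : iIndepFun (fun p : Fin N × ℕ => W p.1 p.2) P)
    (hWlaw : ∀ i j, HasLaw (W i j) (expMeasure (π i + ρ j)) P)
    (Z : ℕ → Ω → Triangle N ℝ) (hZ : ∀ n ω, Z n ω = rskPattern (fun i j => W i j ω) n) :
    -- almost surely all the `Z n` are Gelfand-Tsetlin patterns
    (∀ᵐ ω ∂P, ∀ n, IsGTPattern (Z n ω)) ∧
    -- the bottom rows are a Markov chain with the asserted kernels
    IsMarkovChainOn (chamber N) P (fun n ω => bottomRow (Z n ω))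
      (fun n => transitionQ π (ρ n)) ∧
    -- the first coordinate of the bottom row is the last-passage time
    (∀ᵐ ω ∂P, ∀ n, IsGreatest (pathWeights (extendRows fun i j => W i j ω) (N - 1, n))
      (bottomRow (Z (n + 1) ω) ⟨0, hN⟩)) ∧
    -- the limit `L → ∞` of RSK with geometric input
    (∀ (Ω' : ℝ → Type*) [∀ L, MeasurableSpace (Ω' L)] (μ : ∀ L, Measure (Ω' L))
      [∀ L, IsProbabilityMeasure (μ L)] (ξ : ∀ L, Fin N → ℕ → Ω' L → ℕ),
      (∀ L i j, Measurable (ξ L i j)) →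
      (∀ L, iIndepFun (fun p : Fin N × ℕ => ξ L p.1 p.2) (μ L)) →
      (∀ L i j, π i < L → ρ j < L → ∀ m : ℕ, μ L {ω | ξ L i j ω = m} =
        ENNReal.ofReal ((1 - (1 - π i / L) * (1 - ρ j / L)) *
          ((1 - π i / L) * (1 - ρ j / L)) ^ m)) →
      -- at finite `L` the bottom rows are Markov with the Schur transition probabilities
      (∀ L, (∀ i, π i < L) → ∀ n, (∀ j ≤ n, ρ j < L) → ∀ x' : Fin N → ℤ,
        (μ L)⟦(fun ω => bottomRow (rskPattern (fun i j => (ξ L i j ω : ℤ)) (n + 1))) ⁻¹' {x'} |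
            pastSigma (fun m ω => bottomRow (rskPattern (fun i j => (ξ L i j ω : ℤ)) m)) n⟧
          =ᵐ[μ L] fun ω => schurTransition (fun i => 1 - π i / L) (1 - ρ n / L)
            (bottomRow (rskPattern (fun i j => (ξ L i j ω : ℤ)) n)) x') ∧
      -- the rescaled pattern processes converge in distribution to `Z`
      TendstoInDistribution
        (fun L ω (n : ℕ) (k : Fin N) (i : Fin (k.1 + 1)) =>
          ((rskPattern (fun i j => (ξ L i j ω : ℤ)) n k i : ℤ) : ℝ) / L)
        atTop (fun ω n => Z n ω) μ P) := by
  obtain rfl : Z = fun n ω => rskPattern (fun i j => W i j ω) n := by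
    funext n ω
    exact hZ n ω
  have hW0 : ∀ᵐ ω ∂P, ∀ i j, 0 ≤ W i j ω := ae_all_iff.2 fun i => ae_all_iff.2 fun j =>
    ae_nonneg_of_hasLaw_expMeasure (add_pos_of_pos_of_nonneg (hπ i) (hρ j)) (hWlaw i j)
  refine ⟨?_, isMarkovChainOn_bottomRow_rskPattern hπ hρ hWm hWindep hWlaw, ?_, ?_⟩
  · filter_upwards [hW0] with ω hω n
    exact (rskTableau_isTableau (extendRows_nonneg hω) n).isGTPattern N
  · filter_upwards [hW0] with ω hω n
    exact isGreatest_pathWeights (extendRows_nonneg hω) (N - 1) n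
  · intro Ω' _ μ _ ξ hξm hξ hlaw
    refine ⟨fun L hπL n hρL x' => ?_, tendstoInDistribution_rskPattern hπ hρ hWm hWindep hWlaw
      hξm hξ hlaw⟩
    have hL : 0 < L := (hπ ⟨0, hN⟩).trans (hπL ⟨0, hN⟩)
    have ha : ∀ i, 0 < 1 - π i / L := fun i => sub_pos.2 ((div_lt_one hL).2 (hπL i))
    have hb : ∀ j ≤ n, 0 < 1 - ρ j / L := fun j hj => sub_pos.2 ((div_lt_one hL).2 (hρL j hj))
    refine condExp_bottomRow_rskPattern (b := fun j => 1 - ρ j / L) (hξm L) (hξ L) ha hb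
      (fun i j hj => ?_) (fun i j hj => hlaw L i j (hπL i) (hρL j hj)) x'
    have h1 : 0 < π i / L := div_pos (hπ i) hL
    have h2 : 0 ≤ ρ j / L := div_nonneg (hρ j) hL.le
    nlinarith [ha i, hb j hj]
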